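/- **Setting.** Let $1\le r\le d$ and let $A,B\in\mathbb R^{d\times r}$, $A_\xi,B_\xi\in\mathbb R^{d\times(d-r)}$ satisfy $A^\top A=B^\top B=\mathrm{diag}(\sigma_1^2,\dots,\sigma_r^2)$, $A_\xi^\top A_\xi=B_\xi^\top B_\xi=\sigma_\xi^2 I_{d-r}$, $A^\top A_\xi=B^\top B_\xi=0$, with all $\sigma_p>0$ and $\sigma_\xi>0$. Let $\sigma_{\max}^2,\sigma_{\min}^2$ be the maximum and minimum of $\sigma_1^2,\dots,\sigma_r^2,\sigma_\xi^2$. A positive pair is $x_A^+=Az^++A_\xi\xi_A^+$, $x_B^+=Bz^++B_\xi\xi_B^+$; negatives are $x_A^-=Az^-+A_\xi\xi_A^-$, $x_B^-=Bz^-+B_\xi\xi_B^-$. Here $z^\pm$ are uniform on $\{\pm1/\sqrt d\}^r$ and $\xi_A^\pm,\xi_B^\pm$ are uniform on $\{\pm1/\sqrt d\}^{d-r}$, all independent. The learner with weights $W_A,W_B\in\mathbb R^{d\times m}$ is $f_A(x)=W_A^\top x/\sqrt{\mathbb E\|W_A^\top x_A\|^2}$, $f_B(x)=W_B^\top x/\sqrt{\mathbb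 E\|W_B^\top x_B\|^2}$, and we write $f_A^\pm=f_A(x_A^\pm)$, $f_B^\pm=f_B(x_B^\pm)$. For $K>0$ and inverse temperature $\tau\in(0,1]$ put $$S_A=\frac{e^{\tau^2\langle f_A^+,f_B^+\rangle}}{e^{\tau^2\langle f_A^+,f_B^+\rangle}+K\,\mathbb E_{x_B^-}e^{\tau^2\langle f_A^+,f_B^-\rangle}},\qquad S_B=\frac{e^{\tau^2\langle f_A^+,f_B^+\rangle}}{e^{\tau^2\langle f_A^+,f_B^+\rangle}+K\,\mathbb E_{x_A^-}e^{\tau^2\langle f_A^-,f_B^+\rangle}},$$ and $\mathcal L=-\mathbb E\log S_A-\mathbb E\log S_B$. All entries of $W_A(0),W_B(0)$ are i.i.d. $\mathcal N(0,1/m)$, and the weights follow the gradient flow $\dot W_A=-\tau^{-2}\nabla_{W_A}\mathcal L$, $\dot W_B=-\tau^{-2}\nabla_{W_B}\mathcal L$ on $[0,\infty)$ with $\tau$ constant. Write $K_A=W_A^\top A$, $K_B=W_B^\top B$, $K_{A,\xi}=W_A^\top A_\xi$, $K_{B,\xi}=W_B^\top B_\xi$, let $[M]_p$ be the $p$-th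 column of $M$, and let $\bar v=v/\|v\|$. **Lemma.** There are constants $c,C>0$ such that for every $K>0$ and every $k\in\mathbb N$ there are $a,b,e\in\mathbb N$ for which the following holds. Let $d,r,m$ and $A,B,A_\xi,B_\xi,\sigma,\sigma_\xi$ be as above with $$\frac{\sigma_{\max}^2}{\sigma_{\min}^2}\max\Big\{1,\frac{(d-r)\sigma_\xi^2}{r\,\sigma_{\min}^2}\Big\}\le c\log d,$$ let $m\ge d^a$, $\tau\in(0,1]$, $\tau^2\le d^{-b}$, and let $\delta_-,\delta_{N/S},\delta_{A/B},\delta_{\xi,\kappa_0},\delta_{AB,\perp},\delta_{\xi,\perp},\delta_{\mathrm{fail}}\ge d^{-k}$. Then, with probability at least $1-\delta_{\mathrm{fail}}$ over the initialization, every solution of the gradient flow has the following properties. There is an earliest time $T_1\ge 0$ at which $$\langle\overline{[K_A]_p},\overline{[K_B]_p}\rangle\ge1-\delta_-\quad\text{and}\quad\frac{\|[K_{A,\xi}]_q\|}{\|[K_A]_p\|}\le\delta_{N/S}\qquad\text{for all }p\in[r],\ q\in[d-r];$$ it satisfies $T_1\le d^e$; and at every $t\in[0,T_1]$ all columns of $K_A,K_B,K_{A,\xi},K_{B,\xi}$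 are nonzero, $\max_{p,q\in[r]}\|[K_A]_p\|/\|[K_A]_q\|\le C\sqrt d$, and 1. $\big|\|[K_A]_p\|^2-\|[K_B]_p\|^2\big|\le\delta_{A/B}\|[K_B]_p\|^2$ and $\big|\|[K_{A,\xi}]_q\|^2-\|[K_{B,\xi}]_q\|^2\big|\le\delta_{A/B}\|[K_{B,\xi}]_q\|^2$ for all $p\in[r]$, $q\in[d-r]$; 2. $\big|1-\|[K_{A,\xi}]_p\|/\|[K_{A,\xi}]_q\|\big|\le\delta_{\xi,\kappa_0}$ for all $p,q\in[d-r]$; 3. $|\langle\overline{[K_{\mathcal C}]_p},\overline{[K_{\mathcal D}]_q}\rangle|\le\delta_{AB,\perp}$ for all $\mathcal C,\mathcal D\in\{A,B\}$ and $p\ne q$ in $[r]$; 4. $|\langle\overline{[K_{\mathcal C}]_p},\overline{[K_{\mathcal D,\xi}]_q}\rangle|\le\delta_{\xi,\perp}$ and $|\langle\overline{[K_{A,\xi}]_s},\overline{[K_{B,\xi}]_q}\rangle|\le\delta_{\xi,\perp}$ for all $\mathcal C,\mathcal D\in\{A,B\}$, $p\in[r]$ and $q,s\in[d-r]$. -/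

import Mathlib

open scoped BigOperators Matrix

noncomputable section

namespace Contrastive

/-! ### Data-generating model -/

/-- The parameters of the linear data-generating model: signal encoders `A, B ∈ ℝ^{d × r}` and
noise encoders `Aξ, Bξ ∈ ℝ^{d × (d - r)}`, with `Aᵀ A = Bᵀ B = diag (σ²)`,
`Aξᵀ Aξ = Bξᵀ Bξ = σξ² I`, and signal directions orthogonal to noise directions. -/
structure DataModel (d r : ℕ) where
  A : Matrix (Fin d) (Fin r) ℝ
  B : Matrix (Fin d) (Fin r) ℝ
  Aξ : Matrix (Fin d) (Fin (d - r)) ℝ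
  Bξ : Matrix (Fin d) (Fin (d - r)) ℝ
  σ : Fin r → ℝ
  σξ : ℝ
  σ_pos : ∀ p, 0 < σ p
  σξ_pos : 0 < σξ
  A_gram : Aᵀ * A = Matrix.diagonal fun p => σ p ^ 2
  B_gram : Bᵀ * B = Matrix.diagonal fun p => σ p ^ 2
  Aξ_gram : Aξᵀ * Aξ = σξ ^ 2 • (1 : Matrix (Fin (d - r)) (Fin (d - r)) ℝ)
  Bξ_gram : Bξᵀ * Bξ = σξ ^ 2 • (1 : Matrix (Fin (d - r)) (Fin (d - r)) ℝ)
  A_orth : Aᵀ * Aξ = 0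
  B_orth : Bᵀ * Bξ = 0

namespace DataModel

variable {d r : ℕ} (D : DataModel d r)

/-- `σ_max²`, the maximum of `σ₁², …, σ_r², σξ²`. -/
def sigmaMaxSq : ℝ := max (⨆ p, D.σ p ^ 2) (D.σξ ^ 2)

/-- `σ_min²`, the minimum of `σ₁², …, σ_r², σξ²` (used for `r ≥ 1`). -/
def sigmaMinSq : ℝ := min (⨅ p, D.σ p ^ 2) (D.σξ ^ 2)

/-- `(σ_max² / σ_min²) · max {1, (d - r) σξ² / (r σ_min²)} ≤ c log d`. -/
def WellConditioned (c : ℝ) : Prop :=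
  D.sigmaMaxSq / D.sigmaMinSq *
    max 1 (((d : ℝ) - r) * D.σξ ^ 2 / (r * D.sigmaMinSq)) ≤ c * Real.log d

end DataModel

/-- The finite sample space `{±1}ⁿ`; the uniform distribution on it is used throughout. -/
abbrev SignVec (n : ℕ) : Type := Fin n → ℤˣ

/-- The vector of `{±1/√d}ⁿ` with the given signs. -/
def latent (d : ℕ) {n : ℕ} (s : SignVec n) : Fin n → ℝ := fun i => ((s i : ℤ) : ℝ) / √(d : ℝ)

/-- An input `x = M z + Mξ ξ`. -/
def encode {d r : ℕ} (M : Matrix (Fin d) (Fin r) ℝ) (Mξ : Matrix (Fin d) (Fin (d - r)) ℝ)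
    (z : SignVec r) (ξ : SignVec (d - r)) : Fin d → ℝ :=
  M *ᵥ latent d z + Mξ *ᵥ latent d ξ

/-! ### The learner -/

/-- The unnormalized output `Wᵀ x` on the input `x = M z + Mξ ξ`. -/
def rawOutput {d r m : ℕ} (M : Matrix (Fin d) (Fin r) ℝ) (Mξ : Matrix (Fin d) (Fin (d - r)) ℝ)
    (W : Matrix (Fin d) (Fin m) ℝ) (z : SignVec r) (ξ : SignVec (d - r)) :
    EuclideanSpace ℝ (Fin m) :=
  WithLp.toLp 2 (Wᵀ *ᵥ encode M Mξ z ξ)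

/-- The batch-normalized output `f(x) = Wᵀ x / √(E ‖Wᵀ x‖²)` on the input `x = M z + Mξ ξ`. -/
def feature {d r m : ℕ} (M : Matrix (Fin d) (Fin r) ℝ) (Mξ : Matrix (Fin d) (Fin (d - r)) ℝ)
    (W : Matrix (Fin d) (Fin m) ℝ) (z : SignVec r) (ξ : SignVec (d - r)) :
    EuclideanSpace ℝ (Fin m) :=
  (√(𝔼 z' : SignVec r, 𝔼 ξ' : SignVec (d - r), ‖rawOutput M Mξ W z' ξ'‖ ^ 2))⁻¹ •
    rawOutput M Mξ W z ξ

section Loss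

variable {d r m : ℕ} (D : DataModel d r) (K τ : ℝ) (WA WB : Matrix (Fin d) (Fin m) ℝ)

/-- `S_A(x_A⁺, x_B⁺)` for `x_A⁺ = A z + Aξ ξA`, `x_B⁺ = B z + Bξ ξB`; the negative `x_B⁻` is drawn
independently. -/
def SA (z : SignVec r) (ξA ξB : SignVec (d - r)) : ℝ :=
  let fA := feature D.A D.Aξ WA
  let fB := feature D.B D.Bξ WB
  Real.exp (τ ^ 2 * inner ℝ (fA z ξA) (fB z ξB)) /
    (Real.exp (τ ^ 2 * inner ℝ (fA z ξA) (fB z ξB)) +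
      K * 𝔼 z' : SignVec r, 𝔼 ξ' : SignVec (d - r),
        Real.exp (τ ^ 2 * inner ℝ (fA z ξA) (fB z' ξ')))

/-- `S_B(x_A⁺, x_B⁺)`; the negative `x_A⁻` is drawn independently. -/
def SB (z : SignVec r) (ξA ξB : SignVec (d - r)) : ℝ :=
  let fA := feature D.A D.Aξ WA
  let fB := feature D.B D.Bξ WB
  Real.exp (τ ^ 2 * inner ℝ (fA z ξA) (fB z ξB)) /
    (Real.exp (τ ^ 2 * inner ℝ (fA z ξA) (fB z ξB)) +
      K * 𝔼 z' : SignVec r, 𝔼 ξ' : SignVec (d - r),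
        Real.exp (τ ^ 2 * inner ℝ (fA z' ξ') (fB z ξB)))

/-- The population contrastive loss `L = - E log S_A - E log S_B`. -/
def loss : ℝ :=
  - (𝔼 z : SignVec r, 𝔼 ξA : SignVec (d - r), 𝔼 ξB : SignVec (d - r),
      Real.log (SA D K τ WA WB z ξA ξB))
  - (𝔼 z : SignVec r, 𝔼 ξA : SignVec (d - r), 𝔼 ξB : SignVec (d - r),
      Real.log (SB D K τ WA WB z ξA ξB))

/-- The gradient of the loss in `W_A`: the matrix of the partial derivatives `∂L/∂[W_A]_{i,k}`. -/
def gradA : Matrix (Fin d) (Fin m) ℝ := Matrix.of fun i k =>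
  deriv (fun x : ℝ => loss D K τ (WA + x • Matrix.single i k 1) WB) 0

/-- The gradient of the loss in `W_B`: the matrix of the partial derivatives `∂L/∂[W_B]_{i,k}`. -/
def gradB : Matrix (Fin d) (Fin m) ℝ := Matrix.of fun i k =>
  deriv (fun x : ℝ => loss D K τ WA (WB + x • Matrix.single i k 1)) 0

end Loss

/-- `(W_A, W_B)` solves, on `[0, ∞)`, the gradient flow
`Ẇ_A = - τ⁻² ∇_{W_A} L`, `Ẇ_B = - τ⁻² ∇_{W_B} L` with constant inverse temperature `τ`. -/
def IsGradientFlow {d r m : ℕ} (D : DataModel d r) (K τ : ℝ)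
    (WA WB : ℝ → Matrix (Fin d) (Fin m) ℝ) : Prop :=
  ∀ t : ℝ, 0 ≤ t → ∀ (i : Fin d) (k : Fin m),
    HasDerivWithinAt (fun s => WA s i k) (-(τ ^ 2)⁻¹ * gradA D K τ (WA t) (WB t) i k)
      (Set.Ici 0) t ∧
    HasDerivWithinAt (fun s => WB s i k) (-(τ ^ 2)⁻¹ * gradB D K τ (WA t) (WB t) i k)
      (Set.Ici 0) t

/-- The law of the initial weights `(W_A, W_B)`: all entries are iid `N(0, 1/m)`. -/
def initLaw (d m : ℕ) : MeasureTheory.Measure ((Fin d → Fin m → ℝ) × (Fin d → Fin m → ℝ)) :=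
  (MeasureTheory.Measure.pi fun _ => MeasureTheory.Measure.pi fun _ =>
    ProbabilityTheory.gaussianReal 0 (m : NNReal)⁻¹).prod
  (MeasureTheory.Measure.pi fun _ => MeasureTheory.Measure.pi fun _ =>
    ProbabilityTheory.gaussianReal 0 (m : NNReal)⁻¹)

/-! ### The quantities that are tracked -/

/-- The `p`-th column of a matrix, as a Euclidean vector. -/
def column {m n : ℕ} (M : Matrix (Fin m) (Fin n) ℝ) (p : Fin n) : EuclideanSpace ℝ (Fin m) :=
  WithLp.toLp 2 fun k => M k p

/-- The normalized `p`-th column. -/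
def unitColumn {m n : ℕ} (M : Matrix (Fin m) (Fin n) ℝ) (p : Fin n) : EuclideanSpace ℝ (Fin m) :=
  ‖column M p‖⁻¹ • column M p

/-- The end condition of Stage 1, for `K_A, K_B ∈ ℝ^{m × r}` and `K_{A,ξ} ∈ ℝ^{m × (d - r)}`. -/
def Aligned {m r n : ℕ} (KA KB : Matrix (Fin m) (Fin r) ℝ) (KAξ : Matrix (Fin m) (Fin n) ℝ)
    (δm δNS : ℝ) : Prop :=
  (∀ p, 1 - δm ≤ inner ℝ (unitColumn KA p) (unitColumn KB p)) ∧
  (∀ p q, ‖column KAξ q‖ / ‖column KA p‖ ≤ δNS)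

/-- No column vanishes, so that all quotients and normalized columns below are meaningful. -/
def ColumnsNonzero {m r n : ℕ} (KA KB : Matrix (Fin m) (Fin r) ℝ)
    (KAξ KBξ : Matrix (Fin m) (Fin n) ℝ) : Prop :=
  (∀ p, column KA p ≠ 0 ∧ column KB p ≠ 0) ∧ (∀ q, column KAξ q ≠ 0 ∧ column KBξ q ≠ 0)

/-- Closeness to the infinite-width regime: approximately equal column norms and approximately
orthogonal columns. -/
structure NearInfiniteWidth {m r n : ℕ} (KA KB : Matrix (Fin m) (Fin r) ℝ)
    (KAξ KBξ : Matrix (Fin m) (Fin n) ℝ) (δAB δξκ δperp δξperp : ℝ) : Prop where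
  signal_norm : ∀ p, |‖column KA p‖ ^ 2 - ‖column KB p‖ ^ 2| ≤ δAB * ‖column KB p‖ ^ 2
  noise_norm : ∀ q, |‖column KAξ q‖ ^ 2 - ‖column KBξ q‖ ^ 2| ≤ δAB * ‖column KBξ q‖ ^ 2
  noise_cond : ∀ p q, |1 - ‖column KAξ p‖ / ‖column KAξ q‖| ≤ δξκ
  signal_signal : ∀ M ∈ ({KA, KB} : Set _), ∀ M' ∈ ({KA, KB} : Set _), ∀ p q, p ≠ q →
    |inner ℝ (unitColumn M p) (unitColumn M' q)| ≤ δperp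
  signal_noise : ∀ M ∈ ({KA, KB} : Set _), ∀ M' ∈ ({KAξ, KBξ} : Set _), ∀ p q,
    |inner ℝ (unitColumn M p) (unitColumn M' q)| ≤ δξperp
  noise_noise : ∀ s q, |inner ℝ (unitColumn KAξ s) (unitColumn KBξ q)| ≤ δξperp

/-- The Stage 1 conclusion along a trajectory `(W_A, W_B)`, with `K_A = W_Aᵀ A`, `K_B = W_Bᵀ B`,
`K_{A,ξ} = W_Aᵀ Aξ`, `K_{B,ξ} = W_Bᵀ Bξ`: the earliest time `T₁` at which the end condition holds
exists and is at most `Tmax`, and on `[0, T₁]` the condition number of `K_A` is at most `κmax` and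
the trajectory stays close to the infinite-width regime. -/
def StageOneConclusion {d r m : ℕ} (D : DataModel d r) (WA WB : ℝ → Matrix (Fin d) (Fin m) ℝ)
    (Tmax κmax δm δNS δAB δξκ δperp δξperp : ℝ) : Prop :=
  ∃ T₁ : ℝ,
    IsLeast {t : ℝ | 0 ≤ t ∧
      Aligned ((WA t)ᵀ * D.A) ((WB t)ᵀ * D.B) ((WA t)ᵀ * D.Aξ) δm δNS} T₁ ∧
    T₁ ≤ Tmax ∧
    ∀ t ∈ Set.Icc 0 T₁,
      ColumnsNonzero ((WA t)ᵀ * D.A) ((WB t)ᵀ * D.B) ((WA t)ᵀ * D.Aξ) ((WB t)ᵀ * D.Bξ) ∧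
      (∀ p q, ‖column ((WA t)ᵀ * D.A) p‖ / ‖column ((WA t)ᵀ * D.A) q‖ ≤ κmax) ∧
      NearInfiniteWidth ((WA t)ᵀ * D.A) ((WB t)ᵀ * D.B) ((WA t)ᵀ * D.Aξ) ((WB t)ᵀ * D.Bξ)
        δAB δξκ δperp δξperp

end Contrastive

end

/-!
The proof compares the gradient flow with its limit at infinite temperature and solves the limit
explicitly.

*Reduction to the columns.* The loss depends on the weights only through the columns of
`K_A, K_{A,ξ}, K_B, K_{B,ξ}` (`loss_eq`), and since the encoders have orthogonal columns, each of
these columns moves along its own gradient, at a speed proportional to its squared singular value.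
For small `τ` the softmax weights of the negatives are nearly constant, and in the gradient only the
correlation of the positive pairs and the derivative of the normalization survive. For a signal
pair `a, b` and a noise column `x` this gives, when the total norms `nA` and `nB` of the two sides
agree,
`a' = lam (α b - α ρ a)`, `b' = lam (α a - α ρ b)`, `x' = - lamx α ρ x`,
with a common speed `α` and the correlation `ρ` of the positive pairs. On a noise column the error
has to be small relative to the column itself, which may become superpolynomially small. This holds
because flipping a noise sign changes the softmax weights only in proportion to that column
(`norm_colGrad_signal_le`, `norm_colGrad_noise_le`, `isPerturbed_matFlow`).

*Explicit solution.* With the clocks `θ = ∫ α` and `w = ∫ α ρ`, the sum `a + b` grows like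
`exp (lam (θ - w))`, the difference `a - b` decays like `exp (-lam (θ + w))`, and the noise behaves
like `exp (-lamx w)` (`exists_clocks`). So the pairs align, the noise decays, and directions are
essentially kept, which yields all near-orthogonality from that of the initial columns.

*Control for a long time.* Two things have to be excluded. First, the signal columns could grow at
very different rates; but `(θ - w)' = α (1 - ρ)`, where `1 - ρ` is bounded by the share of the noise
and the misalignment up to constants, and both are integrable: a bounded potential grows at least
as fast (`potentialRate_ge`, `growth_le`). Hence `θ - w ≤ 48 M`, where `M` is the ratio of noise to signal,
for all times. Second, the norms on the two sides could drift apart, which would spoil the limiting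
equations. This is excluded by a maximum principle for the ratios of the squared norms of all
columns at once, with tolerances that grow with the same potential (`signal_touch`, `noise_touch`,
`excess_neg`). Continuous induction combines the two (`controlled`).

*Parameters.* By Chebyshev's inequality the rows of the initial weights are nearly orthonormal
(`exists_initLaw_gram_le`), hence the initial columns nearly orthogonal (`nearOrthogonal_matFlow`).
The assumption on the data bounds the product of the condition number `κ` and of `M` by
`log d / 1000`, so every exponential of a multiple of `κ M` that occurs is at most `d`, and all
errors can be taken to be powers of one small number `g = d ^ (-γ)` (`regime_matFlow`). At time
`d ^ e` alignment is reached (`aligned_at_end`), so there is an earliest such time by compactness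
(`exists_isLeast_of_continuousOn`).
-/

noncomputable section

namespace Contrastive

open Set Filter Topology

set_option linter.unusedSectionVars false

/-! ### Continuous induction and differential inequalities -/

/-- Continuous induction: if finitely many continuous functions start negative and cannot reach
`0` from below at any time, they stay negative. -/
theorem forall_neg_of_propagates {ι : Type*} [Finite ι] {b : ℝ} {f : ι → ℝ → ℝ}
    (hc : ∀ i, ContinuousOn (f i) (Icc 0 b)) (h0 : ∀ i, f i 0 < 0)
    (step : ∀ T ∈ Ioc 0 b, (∀ s ∈ Ico 0 T, ∀ i, f i s < 0) → (∀ i, f i T ≤ 0) → ∀ i, f i T < 0) :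
    ∀ t ∈ Icc 0 b, ∀ i, f i t < 0 := by
  set S := {t | t ∈ Icc 0 b ∧ ¬ ∀ i, f i t < 0} with hS
  have hclosed : IsClosed S := by
    have : S = ⋃ i, {t | t ∈ Icc 0 b ∧ 0 ≤ f i t} := by
      ext t; simp [hS]
    rw [this]
    exact isClosed_iUnion_of_finite fun i =>
      (hc i).preimage_isClosed_of_isClosed isClosed_Icc isClosed_Ici
  by_contra! h
  obtain ⟨t, ht, hGt⟩ := h
  have hne : S.Nonempty := ⟨t, ht, by simpa using hGt⟩
  have hbdd : BddBelow S := ⟨0, fun s hs => hs.1.1⟩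
  obtain ⟨hT, hTneg⟩ := hclosed.csInf_mem hne hbdd
  set T := sInf S
  have hbefore : ∀ s ∈ Ico 0 T, ∀ i, f i s < 0 := by
    intro s hs
    by_contra hGs
    exact absurd (csInf_le hbdd (show s ∈ S from ⟨⟨hs.1, hs.2.le.trans hT.2⟩, hGs⟩))
      (not_le.2 hs.2)
  rcases hT.1.eq_or_lt with h | hpos
  · exact hTneg (h ▸ h0)
  refine hTneg (step T ⟨hpos, hT.2⟩ hbefore fun i => ?_)
  have hd : Tendsto (f i) (𝓝[Ico 0 T] T) (𝓝 (f i T)) :=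
    (hc i T hT).mono fun s hs => ⟨hs.1, hs.2.le.trans hT.2⟩
  have : (𝓝[Ico 0 T] T).NeBot := by
    rw [← mem_closure_iff_nhdsWithin_neBot, closure_Ico hpos.ne]
    exact right_mem_Icc.2 hpos.le
  exact le_of_tendsto hd (eventually_mem_nhdsWithin.mono fun s hs => (hbefore s hs i).le)

/-- At the first zero of a function that was negative before, its derivative is nonnegative. -/
theorem deriv_nonneg_of_neg_before {f : ℝ → ℝ} {f' t : ℝ} (ht : 0 < t) (hf : HasDerivAt f f' t)
    (h0 : f t = 0) (hneg : ∀ s ∈ Ico 0 t, f s < 0) : 0 ≤ f' := by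
  have h1 : Tendsto (slope f t) (𝓝[<] t) (𝓝 f') :=
    (hasDerivAt_iff_tendsto_slope.1 hf).mono_left
      (nhdsWithin_mono _ fun x hx => ne_of_lt hx)
  refine ge_of_tendsto h1 ?_
  filter_upwards [Ico_mem_nhdsLT ht] with s hs
  rw [slope_def_field, h0]
  exact div_nonneg_of_nonpos (by linarith [hneg s hs]) (by linarith [hs.2])

/-- A maximum principle for finitely many functions: if each of them is decreasing whenever it
vanishes while all the others are nonpositive, then all stay negative. -/
theorem finite_max_principle {ι : Type*} [Finite ι] {b : ℝ} {f f' : ι → ℝ → ℝ}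
    (hc : ∀ i, ContinuousOn (f i) (Icc 0 b))
    (hf : ∀ i, ∀ t ∈ Ioc 0 b, HasDerivAt (f i) (f' i t) t)
    (h0 : ∀ i, f i 0 < 0)
    (touch : ∀ i, ∀ t ∈ Ioc 0 b, (∀ j, f j t ≤ 0) → f i t = 0 → f' i t < 0) :
    ∀ t ∈ Icc 0 b, ∀ i, f i t < 0 := by
  refine forall_neg_of_propagates hc h0 fun T hT hs hle i => lt_of_le_of_ne (hle i) fun heq => ?_
  exact absurd (deriv_nonneg_of_neg_before hT.1 (hf i T hT) heq fun s hs' => hs s hs' i)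
    (not_le.2 (touch i T hT hle heq))

theorem le_of_hasDerivAt_le {b : ℝ} {f g f' g' : ℝ → ℝ}
    (hf : ∀ t ∈ Icc 0 b, HasDerivAt f (f' t) t) (hg : ∀ t ∈ Icc 0 b, HasDerivAt g (g' t) t)
    (h0 : f 0 ≤ g 0) (h : ∀ t ∈ Icc 0 b, f' t ≤ g' t) : ∀ t ∈ Icc 0 b, f t ≤ g t := fun _ ht =>
  image_le_of_deriv_right_le_deriv_boundary
    (fun s hs => (hf s hs).continuousAt.continuousWithinAt)
    (fun s hs => (hf s (Ico_subset_Icc_self hs)).hasDerivWithinAt) h0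
    (fun s hs => (hg s hs).continuousAt.continuousWithinAt)
    (fun s hs => (hg s (Ico_subset_Icc_self hs)).hasDerivWithinAt)
    (fun s hs => h s (Ico_subset_Icc_self hs)) ht

theorem exists_primitive {b : ℝ} (hb : 0 ≤ b) {f : ℝ → ℝ} (hf : ContinuousOn f (Icc 0 b)) :
    ∃ F : ℝ → ℝ, F 0 = 0 ∧ ∀ t ∈ Icc 0 b, HasDerivAt F (f t) t := by
  have hc : Continuous (IccExtend hb ((Icc 0 b).domRestrict f)) :=
    (continuousOn_iff_continuous_domRestrict.1 hf).Icc_extend'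
  refine ⟨fun t => ∫ s in (0 : ℝ)..t, IccExtend hb ((Icc 0 b).domRestrict f) s, by simp, ?_⟩
  intro t ht
  have h := intervalIntegral.integral_hasDerivAt_right (hc.intervalIntegrable 0 t)
    (hc.stronglyMeasurableAtFilter _ _) hc.continuousAt
  rwa [IccExtend_of_mem hb _ ht] at h

section Perturbed

variable {E : Type*} [NormedAddCommGroup E] [NormedSpace ℝ E] {b : ℝ} {f f' : ℝ → E}
  {φ φ' ψ ψ' : ℝ → ℝ}

theorem hasDerivWithinAt_exp_neg_smul {t : ℝ} (hφ : HasDerivAt φ (φ' t) t)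
    (hf : HasDerivWithinAt f (f' t) (Ici 0) t) :
    HasDerivWithinAt (fun s => Real.exp (-φ s) • f s) (Real.exp (-φ t) • (f' t - φ' t • f t)) (Ici 0) t := by
  have h1 : HasDerivWithinAt (fun s => Real.exp (-φ s)) (Real.exp (-φ t) * -φ' t) (Ici 0) t :=
    (hφ.neg.exp).hasDerivWithinAt
  have h2 := h1.smul hf
  refine h2.congr_deriv ?_
  module

/-- Variation of constants for `f' ≈ φ' f`: the solution stays within `exp φ · ψ` of
`exp φ · f 0` when `ψ' exp φ` bounds the inhomogeneity. -/
theorem norm_sub_exp_smul_le (hφ : ∀ t ∈ Icc 0 b, HasDerivAt φ (φ' t) t) (hφ0 : φ 0 = 0)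
    (hf : ∀ t ∈ Icc 0 b, HasDerivWithinAt f (f' t) (Ici 0) t)
    (hψ : ∀ t ∈ Icc 0 b, HasDerivAt ψ (ψ' t) t) (hψ0 : ψ 0 = 0)
    (hg : ∀ t ∈ Icc 0 b, ‖f' t - φ' t • f t‖ ≤ Real.exp (φ t) * ψ' t) :
    ∀ t ∈ Icc 0 b, ‖f t - Real.exp (φ t) • f 0‖ ≤ Real.exp (φ t) * ψ t := by
  intro t ht
  have hz : ∀ s ∈ Icc 0 b, HasDerivWithinAt (fun s => Real.exp (-φ s) • f s - f 0)
      (Real.exp (-φ s) • (f' s - φ' s • f s)) (Ici 0) s := fun s hs =>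
    (hasDerivWithinAt_exp_neg_smul (hφ s hs) (hf s hs)).sub_const _
  have key := image_norm_le_of_norm_deriv_right_le_deriv_boundary'
    (f := fun s => Real.exp (-φ s) • f s - f 0) (a := 0) (b := b)
    (fun s hs => ((hz s hs).continuousWithinAt).mono Icc_subset_Ici_self)
    (fun s hs => (hz s (Ico_subset_Icc_self hs)).mono (Ici_subset_Ici.2 hs.1))
    (B := ψ) (B' := ψ') (by simp [hφ0, hψ0])
    (fun s hs => (hψ s hs).continuousAt.continuousWithinAt)
    (fun s hs => (hψ s (Ico_subset_Icc_self hs)).hasDerivWithinAt)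
    (fun s hs => by
      rw [norm_smul, Real.norm_eq_abs, Real.abs_exp, Real.exp_neg, inv_mul_le_iff₀ (Real.exp_pos _)]
      exact hg s (Ico_subset_Icc_self hs)) ht
  have e : f t - Real.exp (φ t) • f 0 = Real.exp (φ t) • (Real.exp (-φ t) • f t - f 0) := by
    rw [smul_sub, smul_smul, ← Real.exp_add]; simp
  rw [e, norm_smul, Real.norm_eq_abs, Real.abs_exp]
  exact mul_le_mul_of_nonneg_left key (Real.exp_pos _).le

/-- Variation of constants with an inhomogeneity that is small relative to the solution. -/
theorem norm_sub_exp_smul_le_of_relative (hφ : ∀ t ∈ Icc 0 b, HasDerivAt φ (φ' t) t) (hφ0 : φ 0 = 0)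
    (hf : ∀ t ∈ Icc 0 b, HasDerivWithinAt f (f' t) (Ici 0) t)
    (hψ : ∀ t ∈ Icc 0 b, HasDerivAt ψ (ψ' t) t) (hψ0 : ψ 0 = 0) (hψ' : ∀ t ∈ Icc 0 b, 0 < ψ' t)
    (hf0 : f 0 ≠ 0) (hg : ∀ t ∈ Icc 0 b, 2 * ‖f' t - φ' t • f t‖ ≤ ψ' t * ‖f t‖) :
    ∀ t ∈ Icc 0 b,
      ‖f t - Real.exp (φ t) • f 0‖ ≤ Real.exp (φ t) * ((Real.exp (ψ t) - 1) * ‖f 0‖) := by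
  intro t ht
  have hpos : 0 < ‖f 0‖ := norm_pos_iff.2 hf0
  have hz : ∀ s ∈ Icc 0 b, HasDerivWithinAt (fun s => Real.exp (-φ s) • f s - f 0)
      (Real.exp (-φ s) • (f' s - φ' s • f s)) (Ici 0) s := fun s hs =>
    (hasDerivWithinAt_exp_neg_smul (hφ s hs) (hf s hs)).sub_const _
  have hB : ∀ s ∈ Icc 0 b, HasDerivAt (fun s => (Real.exp (ψ s) - 1) * ‖f 0‖)
      (Real.exp (ψ s) * ψ' s * ‖f 0‖) s := fun s hs =>
    (((hψ s hs).exp).sub_const 1).mul_const _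
  have key := image_norm_le_of_norm_deriv_right_lt_deriv_boundary'
    (f := fun s => Real.exp (-φ s) • f s - f 0) (a := 0) (b := b)
    (fun s hs => ((hz s hs).continuousWithinAt).mono Icc_subset_Ici_self)
    (fun s hs => (hz s (Ico_subset_Icc_self hs)).mono (Ici_subset_Ici.2 hs.1))
    (B := fun s => (Real.exp (ψ s) - 1) * ‖f 0‖) (B' := fun s => Real.exp (ψ s) * ψ' s * ‖f 0‖)
    (by simp [hφ0, hψ0])
    (fun s hs => (hB s hs).continuousAt.continuousWithinAt)
    (fun s hs => (hB s (Ico_subset_Icc_self hs)).hasDerivWithinAt)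
    (fun s hs heq => by
      have hs' := Ico_subset_Icc_self hs
      have h1 : ‖Real.exp (-φ s) • f s‖ ≤ Real.exp (ψ s) * ‖f 0‖ := by
        have := norm_add_le (Real.exp (-φ s) • f s - f 0) (f 0)
        rw [sub_add_cancel] at this
        calc _ ≤ _ := this
          _ = _ := by rw [heq]; ring
      have h2 := hg s hs'
      have h3 := hψ' s hs'
      rw [norm_smul, Real.norm_eq_abs, Real.abs_exp] at h1 ⊢
      have h4 := mul_le_mul_of_nonneg_left h2 (Real.exp_pos (-φ s)).le
      have h5 := mul_le_mul_of_nonneg_left h1 h3.le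
      have h6 : 0 < Real.exp (ψ s) * ψ' s * ‖f 0‖ := by positivity
      nlinarith) ht
  have e : f t - Real.exp (φ t) • f 0 = Real.exp (φ t) • (Real.exp (-φ t) • f t - f 0) := by
    rw [smul_sub, smul_smul, ← Real.exp_add]; simp
  rw [e, norm_smul, Real.norm_eq_abs, Real.abs_exp]
  exact mul_le_mul_of_nonneg_left key (Real.exp_pos _).le

end Perturbed

/-! ### Trajectories of the columns -/

/-- Trajectories of the columns of `K_A`, `K_B` (signal: `a`, `b`) and of `K_{A,ξ}`, `K_{B,ξ}`
(noise: `x`, `y`), with their velocities, the squared singular values `lam`, `lamx` of the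
encoders and the step size factor `η`. -/
structure Flow (P Q E : Type*) where
  a : P → ℝ → E
  b : P → ℝ → E
  x : Q → ℝ → E
  y : Q → ℝ → E
  a' : P → ℝ → E
  b' : P → ℝ → E
  x' : Q → ℝ → E
  y' : Q → ℝ → E
  lam : P → ℝ
  lamx : ℝ
  η : ℝ

namespace Flow

variable {P Q E : Type*} [Fintype P] [Fintype Q] [NormedAddCommGroup E] [InnerProductSpace ℝ E]

/-- The Frobenius norm of all columns on the `A` side. -/
def nA (F : Flow P Q E) (t : ℝ) : ℝ := √(∑ p, ‖F.a p t‖ ^ 2 + ∑ q, ‖F.x q t‖ ^ 2)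

/-- The Frobenius norm of all columns on the `B` side. -/
def nB (F : Flow P Q E) (t : ℝ) : ℝ := √(∑ p, ‖F.b p t‖ ^ 2 + ∑ q, ‖F.y q t‖ ^ 2)

/-- The speed at which `b` attracts `a` and vice versa. -/
def α (F : Flow P Q E) (t : ℝ) : ℝ := F.η / (F.nA t * F.nB t)

/-- The normalized correlation of the positive pairs. -/
def ρ (F : Flow P Q E) (t : ℝ) : ℝ := (∑ p, inner ℝ (F.a p t) (F.b p t)) / (F.nA t * F.nB t)

/-- The same trajectories with the roles of `A` and `B` exchanged. -/
def swap (F : Flow P Q E) : Flow P Q E :=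
  ⟨F.b, F.a, F.y, F.x, F.b', F.a', F.y', F.x', F.lam, F.lamx, F.η⟩

@[simp] theorem swap_nA (F : Flow P Q E) (t : ℝ) : F.swap.nA t = F.nB t := rfl
@[simp] theorem swap_nB (F : Flow P Q E) (t : ℝ) : F.swap.nB t = F.nA t := rfl
@[simp] theorem swap_α (F : Flow P Q E) (t : ℝ) : F.swap.α t = F.α t := by
  simp [α, swap, nA, nB, mul_comm]
@[simp] theorem swap_ρ (F : Flow P Q E) (t : ℝ) : F.swap.ρ t = F.ρ t := by
  simp [ρ, swap, nA, nB, mul_comm, real_inner_comm]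

/-- The columns follow the infinite-temperature gradient flow up to an error `ε`. On the noise
columns the error is relative to the column itself: these columns may become superpolynomially
small. -/
structure IsPerturbed (F : Flow P Q E) (ε : ℝ) : Prop where
  hasDeriv_a : ∀ p t, 0 ≤ t → HasDerivWithinAt (F.a p) (F.a' p t) (Ici 0) t
  hasDeriv_b : ∀ p t, 0 ≤ t → HasDerivWithinAt (F.b p) (F.b' p t) (Ici 0) t
  hasDeriv_x : ∀ q t, 0 ≤ t → HasDerivWithinAt (F.x q) (F.x' q t) (Ici 0) t
  hasDeriv_y : ∀ q t, 0 ≤ t → HasDerivWithinAt (F.y q) (F.y' q t) (Ici 0) t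
  err_a : ∀ p t, 0 ≤ t → 0 < F.nA t → 0 < F.nB t →
    ‖F.a' p t - F.lam p • (F.α t • F.b p t - (F.α t * F.ρ t * (F.nB t / F.nA t)) • F.a p t)‖ ≤
      F.lam p * (ε * F.α t * F.nB t)
  err_b : ∀ p t, 0 ≤ t → 0 < F.nA t → 0 < F.nB t →
    ‖F.b' p t - F.lam p • (F.α t • F.a p t - (F.α t * F.ρ t * (F.nA t / F.nB t)) • F.b p t)‖ ≤
      F.lam p * (ε * F.α t * F.nA t)
  err_x : ∀ q t, 0 ≤ t → 0 < F.nA t → 0 < F.nB t →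
    ‖F.x' q t - F.lamx • (-(F.α t * F.ρ t * (F.nB t / F.nA t)) • F.x q t)‖ ≤
      F.lamx * (ε * F.α t * (F.nB t / F.nA t) * ‖F.x q t‖)
  err_y : ∀ q t, 0 ≤ t → 0 < F.nA t → 0 < F.nB t →
    ‖F.y' q t - F.lamx • (-(F.α t * F.ρ t * (F.nA t / F.nB t)) • F.y q t)‖ ≤
      F.lamx * (ε * F.α t * (F.nA t / F.nB t) * ‖F.y q t‖)

theorem IsPerturbed.swap {F : Flow P Q E} {ε : ℝ} (h : F.IsPerturbed ε) : F.swap.IsPerturbed ε where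
  hasDeriv_a := h.hasDeriv_b
  hasDeriv_b := h.hasDeriv_a
  hasDeriv_x := h.hasDeriv_y
  hasDeriv_y := h.hasDeriv_x
  err_a p t ht hA hB := by
    simp only [swap_α, swap_ρ, swap_nA, swap_nB]
    exact h.err_b p t ht hB hA
  err_b p t ht hA hB := by
    simp only [swap_α, swap_ρ, swap_nA, swap_nB]
    exact h.err_a p t ht hB hA
  err_x q t ht hA hB := by
    simp only [swap_α, swap_ρ, swap_nA, swap_nB]
    exact h.err_y q t ht hB hA
  err_y q t ht hA hB := by
    simp only [swap_α, swap_ρ, swap_nA, swap_nB]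
    exact h.err_x q t ht hB hA

/-- The initial columns are orthogonal with squared norms `lam`, `lamx`, up to `ε`. -/
structure NearOrthogonal (F : Flow P Q E) (ε : ℝ) : Prop where
  norm_a : ∀ p, |‖F.a p 0‖ ^ 2 - F.lam p| ≤ ε
  norm_b : ∀ p, |‖F.b p 0‖ ^ 2 - F.lam p| ≤ ε
  norm_x : ∀ q, |‖F.x q 0‖ ^ 2 - F.lamx| ≤ ε
  norm_y : ∀ q, |‖F.y q 0‖ ^ 2 - F.lamx| ≤ ε
  aa : ∀ p p', p ≠ p' → |inner ℝ (F.a p 0) (F.a p' 0)| ≤ ε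
  bb : ∀ p p', p ≠ p' → |inner ℝ (F.b p 0) (F.b p' 0)| ≤ ε
  ab : ∀ p p', |inner ℝ (F.a p 0) (F.b p' 0)| ≤ ε
  ax : ∀ p q, |inner ℝ (F.a p 0) (F.x q 0)| ≤ ε
  ay : ∀ p q, |inner ℝ (F.a p 0) (F.y q 0)| ≤ ε
  bx : ∀ p q, |inner ℝ (F.b p 0) (F.x q 0)| ≤ ε
  bt : ∀ p q, |inner ℝ (F.b p 0) (F.y q 0)| ≤ ε
  xy : ∀ q q', |inner ℝ (F.x q 0) (F.y q' 0)| ≤ ε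

theorem NearOrthogonal.swap {F : Flow P Q E} {ε : ℝ} (h : F.NearOrthogonal ε) :
    F.swap.NearOrthogonal ε where
  norm_a := h.norm_b
  norm_b := h.norm_a
  norm_x := h.norm_y
  norm_y := h.norm_x
  aa := h.bb
  bb := h.aa
  ab p p' := by rw [real_inner_comm]; exact h.ab p' p
  ax := h.bt
  ay := h.bx
  bx := h.ay
  bt := h.ax
  xy q q' := by rw [real_inner_comm]; exact h.xy q' q

/-- The quantitative regime. `κ` bounds the ratio of the squared singular values, `M` the ratio of
noise to signal, `H` is the a priori bound on the total norm, `Tend` the time horizon and `g` a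
small number that beats all of these; all errors are powers of `g`. -/
structure Regime (F : Flow P Q E) (κ M H g Tend : ℝ) : Prop where
  one_le_lam : ∀ p, 1 ≤ F.lam p
  lam_le : ∀ p, F.lam p ≤ κ
  one_le_lamx : 1 ≤ F.lamx
  lamx_le : F.lamx ≤ κ
  one_le_M : 1 ≤ M
  one_le_card : (1 : ℝ) ≤ Fintype.card P
  noise_le : Fintype.card Q * F.lamx ≤ M * Fintype.card P
  η_pos : 0 < F.η
  η_le : F.η ≤ 2
  g_pos : 0 < g
  g_le : g ≤ 1 / 1000
  κ_le : κ * g ≤ 1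
  H_pos : 1 ≤ H
  H_le : H * g ≤ 1
  Tend_nonneg : 0 ≤ Tend
  Tend_le : 32 * Tend * g ≤ 1
  exp_le : Real.exp (256 * κ * M) * g ≤ 1
  lt_H : 20 * M * Fintype.card P * κ * Real.exp (112 * κ * M) < H ^ 2
  perturbed : F.IsPerturbed (g ^ 18)
  initial : F.NearOrthogonal (g ^ 18)

variable {F : Flow P Q E} {κ M H g Tend : ℝ}

theorem Regime.swap (h : F.Regime κ M H g Tend) : F.swap.Regime κ M H g Tend :=
  { h with perturbed := h.perturbed.swap, initial := h.initial.swap }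

/-- The a priori control at time `t`: total norms of polynomial size, and nearly equal column
norms on the two sides. -/
structure Controlled (F : Flow P Q E) (H g : ℝ) (t : ℝ) : Prop where
  nA_ge : 1 / 4 ≤ F.nA t
  nB_ge : 1 / 4 ≤ F.nB t
  nA_le : F.nA t ≤ H
  nB_le : F.nB t ≤ H
  ab : ∀ p, ‖F.a p t‖ ^ 2 ≤ (1 + g ^ 8) * ‖F.b p t‖ ^ 2
  ba : ∀ p, ‖F.b p t‖ ^ 2 ≤ (1 + g ^ 8) * ‖F.a p t‖ ^ 2
  xy : ∀ q, ‖F.x q t‖ ^ 2 ≤ (1 + g ^ 8) * ‖F.y q t‖ ^ 2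
  yx : ∀ q, ‖F.y q t‖ ^ 2 ≤ (1 + g ^ 8) * ‖F.x q t‖ ^ 2

theorem Controlled.swap {t : ℝ} (h : F.Controlled H g t) : F.swap.Controlled H g t :=
  ⟨h.nB_ge, h.nA_ge, h.nB_le, h.nA_le, h.ba, h.ab, h.yx, h.xy⟩

theorem nA_sq (F : Flow P Q E) (t : ℝ) :
    F.nA t ^ 2 = ∑ p, ‖F.a p t‖ ^ 2 + ∑ q, ‖F.x q t‖ ^ 2 :=
  Real.sq_sqrt (by positivity)

theorem nB_sq (F : Flow P Q E) (t : ℝ) :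
    F.nB t ^ 2 = ∑ p, ‖F.b p t‖ ^ 2 + ∑ q, ‖F.y q t‖ ^ 2 := F.swap.nA_sq t

theorem norm_a_le (F : Flow P Q E) (p : P) (t : ℝ) : ‖F.a p t‖ ≤ F.nA t := by
  refine Real.le_sqrt_of_sq_le ?_
  have h1 := Finset.single_le_sum (f := fun p => ‖F.a p t‖ ^ 2) (fun i _ => sq_nonneg _)
    (Finset.mem_univ p)
  have h2 : 0 ≤ ∑ q, ‖F.x q t‖ ^ 2 := by positivity
  linarith

theorem abs_ρ_le (F : Flow P Q E) (t : ℝ) : |F.ρ t| ≤ 1 := by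
  rw [ρ, abs_div, abs_of_nonneg (mul_nonneg (Real.sqrt_nonneg _) (Real.sqrt_nonneg _) :
    0 ≤ F.nA t * F.nB t)]
  refine div_le_one_of_le₀ ?_ (mul_nonneg (Real.sqrt_nonneg _) (Real.sqrt_nonneg _))
  calc |∑ p, inner ℝ (F.a p t) (F.b p t)| ≤ ∑ p, ‖F.a p t‖ * ‖F.b p t‖ :=
        (Finset.abs_sum_le_sum_abs _ _).trans
          (Finset.sum_le_sum fun p _ => abs_real_inner_le_norm _ _)
    _ ≤ √(∑ p, ‖F.a p t‖ ^ 2) * √(∑ p, ‖F.b p t‖ ^ 2) := Real.sum_mul_le_sqrt_mul_sqrt _ _ _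
    _ ≤ F.nA t * F.nB t := by
        refine mul_le_mul (Real.sqrt_le_sqrt ?_) (Real.sqrt_le_sqrt ?_) (Real.sqrt_nonneg _)
          (Real.sqrt_nonneg _)
        · exact le_add_of_nonneg_right (by positivity)
        · exact le_add_of_nonneg_right (by positivity)

section Controlled

variable {t : ℝ}

theorem nB_le_nA_mul (hc : F.Controlled H g t) (hg : 0 < g) : F.nB t ≤ (1 + g ^ 8) * F.nA t := by
  have h1 : F.nB t ^ 2 ≤ (1 + g ^ 8) * F.nA t ^ 2 := by
    rw [nA_sq, nB_sq, mul_add, Finset.mul_sum, Finset.mul_sum]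
    exact add_le_add (Finset.sum_le_sum fun p _ => hc.ba p) (Finset.sum_le_sum fun q _ => hc.yx q)
  have h2 : 0 < g ^ 8 := by positivity
  refine le_of_sq_le_sq (h1.trans ?_) (by have := hc.nA_ge; positivity)
  rw [mul_pow]
  refine mul_le_mul_of_nonneg_right ?_ (sq_nonneg _)
  nlinarith

theorem abs_ratio_sub_one_le (hc : F.Controlled H g t) (hg : 0 < g) (hg1 : g ≤ 1 / 1000) :
    |F.nB t / F.nA t - 1| ≤ g ^ 8 := by
  have h1 := nB_le_nA_mul hc hg
  have h2 := nB_le_nA_mul hc.swap hg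
  simp only [swap_nA, swap_nB] at h2
  have hA : 0 < F.nA t := by linarith [hc.nA_ge]
  have hB : 0 < F.nB t := by linarith [hc.nB_ge]
  have h3 : 0 < g ^ 8 := by positivity
  rw [abs_le]
  constructor
  · rw [le_sub_iff_add_le, le_div_iff₀ hA]
    have : (1 - g ^ 8) * ((1 + g ^ 8) * F.nB t) ≤ F.nB t := by
      have : 0 ≤ (g ^ 8) ^ 2 * F.nB t := by positivity
      nlinarith
    have h4 : g ^ 8 ≤ 1 := pow_le_one₀ hg.le (by linarith)
    nlinarith [mul_le_mul_of_nonneg_left h2 (by linarith : 0 ≤ 1 - g ^ 8)]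
  · rw [sub_le_iff_le_add, div_le_iff₀ hA]
    linarith

theorem α_pos (hr : F.Regime κ M H g Tend) (hc : F.Controlled H g t) : 0 < F.α t :=
  div_pos hr.η_pos (mul_pos (by linarith [hc.nA_ge]) (by linarith [hc.nB_ge]))

theorem α_le (hr : F.Regime κ M H g Tend) (hc : F.Controlled H g t) : F.α t ≤ 32 := by
  have hA := hc.nA_ge
  have hB := hc.nB_ge
  have h : 1 / 16 ≤ F.nA t * F.nB t := by nlinarith
  rw [α, div_le_iff₀ (by linarith)]
  linarith [hr.η_le]

theorem α_ge (hr : F.Regime κ M H g Tend) (hc : F.Controlled H g t) : F.η / H ^ 2 ≤ F.α t := by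
  have hA := hc.nA_ge
  have hB := hc.nB_ge
  refine div_le_div_of_nonneg_left hr.η_pos.le (by positivity) ?_
  nlinarith [hc.nA_le, hc.nB_le]

theorem Regime.pow_le (hr : F.Regime κ M H g Tend) (m n : ℕ) (h : n ≤ m) : g ^ m ≤ g ^ n :=
  pow_le_pow_of_le_one hr.g_pos.le (by linarith [hr.g_le]) h

theorem Regime.one_le_κ (hr : F.Regime κ M H g Tend) : 1 ≤ κ := hr.one_le_lamx.trans hr.lamx_le

/-- With the two sides nearly balanced, `a` is driven by `α b - α ρ a`. -/
theorem norm_a'_sub_le (hr : F.Regime κ M H g Tend) (ht : 0 ≤ t) (hc : F.Controlled H g t) (p : P) :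
    ‖F.a' p t - F.lam p • (F.α t • F.b p t - (F.α t * F.ρ t) • F.a p t)‖ ≤ 2 * g ^ 6 * F.α t := by
  have hA : 0 < F.nA t := by linarith [hc.nA_ge]
  have hB : 0 < F.nB t := by linarith [hc.nB_ge]
  have hα := α_pos hr hc
  have hlam := hr.one_le_lam p
  have h1 := hr.perturbed.err_a p t ht hA hB
  have h2 : F.a' p t - F.lam p • (F.α t • F.b p t - (F.α t * F.ρ t) • F.a p t) =
      (F.a' p t - F.lam p •
        (F.α t • F.b p t - (F.α t * F.ρ t * (F.nB t / F.nA t)) • F.a p t)) -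
      (F.lam p * (F.α t * F.ρ t * (F.nB t / F.nA t - 1))) • F.a p t := by module
  rw [h2]
  refine (norm_sub_le _ _).trans ?_
  have h3 : ‖(F.lam p * (F.α t * F.ρ t * (F.nB t / F.nA t - 1))) • F.a p t‖ ≤
      κ * (F.α t * 1 * g ^ 8) * H := by
    rw [norm_smul, Real.norm_eq_abs, abs_mul, abs_mul, abs_mul, abs_of_pos hα,
      abs_of_pos (by linarith : 0 < F.lam p)]
    have := abs_ratio_sub_one_le hc hr.g_pos hr.g_le
    have := F.abs_ρ_le t
    have := (F.norm_a_le p t).trans hc.nA_le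
    have := hr.lam_le p
    have := hr.one_le_κ
    gcongr
  have h4 : F.lam p * (g ^ 18 * F.α t * F.nB t) ≤ κ * (g ^ 8 * F.α t * H) := by
    have := hr.lam_le p
    have := hc.nB_le
    have := hr.pow_le 18 8 (by norm_num)
    have := hr.g_pos
    have := hr.one_le_κ
    gcongr
  have h5 : κ * (g ^ 8 * F.α t * H) ≤ g ^ 6 * F.α t := by
    have e : κ * (g ^ 8 * F.α t * H) = (κ * g) * (H * g) * (g ^ 6 * F.α t) := by ring
    rw [e]
    have hg := hr.g_pos
    have : (κ * g) * (H * g) ≤ 1 :=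
      mul_le_one₀ hr.κ_le (mul_nonneg (by linarith [hr.H_pos]) hg.le) hr.H_le
    nlinarith [show 0 < g ^ 6 * F.α t by positivity]
  calc _ ≤ _ := add_le_add (h1.trans h4) h3
    _ ≤ _ := by nlinarith

theorem norm_b'_sub_le (hr : F.Regime κ M H g Tend) (ht : 0 ≤ t) (hc : F.Controlled H g t) (p : P) :
    ‖F.b' p t - F.lam p • (F.α t • F.a p t - (F.α t * F.ρ t) • F.b p t)‖ ≤ 2 * g ^ 6 * F.α t := by
  have h := norm_a'_sub_le hr.swap ht hc.swap p
  simp only [swap_α, swap_ρ] at h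
  exact h

theorem norm_x'_sub_le (hr : F.Regime κ M H g Tend) (ht : 0 ≤ t) (hc : F.Controlled H g t) (q : Q) :
    ‖F.x' q t - (-(F.lamx * (F.α t * F.ρ t))) • F.x q t‖ ≤ 3 * g ^ 7 * F.α t * ‖F.x q t‖ := by
  have hA : 0 < F.nA t := by linarith [hc.nA_ge]
  have hB : 0 < F.nB t := by linarith [hc.nB_ge]
  have hα := α_pos hr hc
  have hlam := hr.one_le_lamx
  have h1 := hr.perturbed.err_x q t ht hA hB
  have hrat := abs_ratio_sub_one_le hc hr.g_pos hr.g_le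
  have hg := hr.g_pos
  have hg8 : g ^ 8 ≤ 1 := pow_le_one₀ hg.le (by linarith [hr.g_le])
  have hκ := hr.one_le_κ
  have h2 : F.x' q t - (-(F.lamx * (F.α t * F.ρ t))) • F.x q t =
      (F.x' q t - F.lamx • (-(F.α t * F.ρ t * (F.nB t / F.nA t)) • F.x q t)) -
      (F.lamx * (F.α t * F.ρ t * (F.nB t / F.nA t - 1))) • F.x q t := by module
  rw [h2]
  refine (norm_sub_le _ _).trans ?_
  have h3 : ‖(F.lamx * (F.α t * F.ρ t * (F.nB t / F.nA t - 1))) • F.x q t‖ ≤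
      κ * (F.α t * 1 * g ^ 8) * ‖F.x q t‖ := by
    rw [norm_smul, Real.norm_eq_abs, abs_mul, abs_mul, abs_mul, abs_of_pos hα,
      abs_of_pos (by linarith : 0 < F.lamx)]
    have := F.abs_ρ_le t
    have := hr.lamx_le
    gcongr
  have h4 : F.lamx * (g ^ 18 * F.α t * (F.nB t / F.nA t) * ‖F.x q t‖) ≤
      κ * (g ^ 8 * F.α t * 2 * ‖F.x q t‖) := by
    have := hr.lamx_le
    have := hr.pow_le 18 8 (by norm_num)
    have : F.nB t / F.nA t ≤ 2 := by linarith [(abs_le.1 hrat).2]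
    gcongr
  calc _ ≤ _ := add_le_add (h1.trans h4) h3
    _ = (κ * g) * (3 * g ^ 7 * F.α t * ‖F.x q t‖) := by ring
    _ ≤ _ := mul_le_of_le_one_left (by positivity) hr.κ_le

end Controlled

/-- At time `t` the columns are close to the explicit solution of the limiting system with clocks
`θ = ∫ α` and `w = ∫ α ρ`: `a + b` has grown by `exp (lam (θ - w))`, `a - b` has decayed by
`exp (-lam (θ + w))` and the noise by `exp (-lamx w)`. -/
structure Approx (F : Flow P Q E) (g θ w t : ℝ) : Prop where
  add : ∀ p, ‖(F.a p t + F.b p t) - Real.exp (F.lam p * (θ - w)) • (F.a p 0 + F.b p 0)‖ ≤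
    Real.exp (F.lam p * (θ - w)) * g ^ 4
  sub : ∀ p, ‖(F.a p t - F.b p t) - Real.exp (-(F.lam p * (θ + w))) • (F.a p 0 - F.b p 0)‖ ≤ g ^ 4
  x : ∀ q, ‖F.x q t - Real.exp (-(F.lamx * w)) • F.x q 0‖ ≤
    Real.exp (-(F.lamx * w)) * (g ^ 4 * ‖F.x q 0‖)
  y : ∀ q, ‖F.y q t - Real.exp (-(F.lamx * w)) • F.y q 0‖ ≤
    Real.exp (-(F.lamx * w)) * (g ^ 4 * ‖F.y q 0‖)
  u_nonneg : 0 ≤ θ - w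
  v_nonneg : 0 ≤ θ + w
  θ_le : θ * g ≤ 1

theorem Approx.swap {θ w t : ℝ} (h : F.Approx g θ w t) : F.swap.Approx g θ w t where
  add p := by
    have := h.add p
    rwa [add_comm (F.a p t), add_comm (F.a p 0)] at this
  sub p := by
    have h1 := h.sub p
    rw [← norm_neg] at h1
    refine (congrArg norm ?_).trans_le h1
    change (F.b p t - F.a p t) - Real.exp (-(F.lam p * (θ + w))) • (F.b p 0 - F.a p 0) = _
    module
  x := h.y
  y := h.x
  u_nonneg := h.u_nonneg
  v_nonneg := h.v_nonneg
  θ_le := h.θ_le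

theorem Approx.θ_nonneg {θ w t : ℝ} (h : F.Approx g θ w t) : 0 ≤ θ := by
  linarith [h.u_nonneg, h.v_nonneg]

theorem continuousOn_nA (h : F.IsPerturbed (g ^ 18)) : ContinuousOn F.nA (Ici 0) := by
  refine ContinuousOn.sqrt (ContinuousOn.add ?_ ?_)
  · exact continuousOn_finsetSum _ fun p _ =>
      (ContinuousOn.norm fun t ht => (h.hasDeriv_a p t ht).continuousWithinAt).pow 2
  · exact continuousOn_finsetSum _ fun q _ =>
      (ContinuousOn.norm fun t ht => (h.hasDeriv_x q t ht).continuousWithinAt).pow 2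

theorem x_zero_ne (hr : F.Regime κ M H g Tend) (q : Q) : F.x q 0 ≠ 0 := by
  have h1 := hr.initial.norm_x q
  have h2 := hr.one_le_lamx
  have h3 : g ^ 18 ≤ g := by simpa using hr.pow_le 18 1 (by norm_num)
  have h4 := hr.g_le
  intro h
  rw [h, abs_le] at h1
  simp at h1
  linarith

/-- `θ = ∫ α` and `w = ∫ α ρ` on `[0, T]`, and the columns follow the explicit solution in terms of
these clocks. -/
structure Clocks (F : Flow P Q E) (g T : ℝ) (θ w : ℝ → ℝ) : Prop where
  θ_zero : θ 0 = 0
  w_zero : w 0 = 0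
  hasDeriv_θ : ∀ t ∈ Icc 0 T, HasDerivAt θ (F.α t) t
  hasDeriv_w : ∀ t ∈ Icc 0 T, HasDerivAt w (F.α t * F.ρ t) t
  approx : ∀ t ∈ Icc 0 T, F.Approx g (θ t) (w t) t

theorem Clocks.swap {T : ℝ} {θ w : ℝ → ℝ} (h : F.Clocks g T θ w) : F.swap.Clocks g T θ w where
  θ_zero := h.θ_zero
  w_zero := h.w_zero
  hasDeriv_θ t ht := by simpa using h.hasDeriv_θ t ht
  hasDeriv_w t ht := by simpa using h.hasDeriv_w t ht
  approx t ht := (h.approx t ht).swap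

/-- Up to a time up to which the a priori control holds, the clocks exist and the columns follow
the explicit solution. -/
theorem exists_clocks (hr : F.Regime κ M H g Tend) {T : ℝ} (hT : T ∈ Icc 0 Tend)
    (hc : ∀ t ∈ Icc 0 T, F.Controlled H g t) :
    ∃ θ w : ℝ → ℝ, F.Clocks g T θ w := by
  have hsub : Icc 0 T ⊆ Ici 0 := Icc_subset_Ici_self
  have hnA := (continuousOn_nA hr.perturbed).mono hsub
  have hnB := (continuousOn_nA hr.swap.perturbed).mono hsub
  have hne : ∀ t ∈ Icc 0 T, F.nA t * F.nB t ≠ 0 := fun t ht =>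
    (mul_pos (by linarith [(hc t ht).nA_ge]) (by linarith [(hc t ht).nB_ge])).ne'
  have hα : ContinuousOn F.α (Icc 0 T) := continuousOn_const.div (hnA.mul hnB) hne
  have hρ : ContinuousOn F.ρ (Icc 0 T) := by
    refine ContinuousOn.div (continuousOn_finsetSum _ fun p _ => ?_)
      (hnA.mul hnB) hne
    exact fun t ht =>
      ((hr.perturbed.hasDeriv_a p t (hsub ht)).continuousWithinAt.mono hsub).inner
        ((hr.perturbed.hasDeriv_b p t (hsub ht)).continuousWithinAt.mono hsub)
  obtain ⟨θ, hθ0, hθ⟩ := exists_primitive hT.1 hα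
  obtain ⟨w, hw0, hw⟩ := exists_primitive (f := fun t => F.α t * F.ρ t) hT.1 (hα.mul hρ)
  have hg := hr.g_pos
  have hg1 := hr.g_le
  have hθpos : ∀ t ∈ Icc 0 T, 0 ≤ θ t := fun t ht => by
    have := le_of_hasDerivAt_le (f := fun _ => 0) (f' := fun _ => 0)
      (fun s _ => hasDerivAt_const _ _) hθ (by simp [hθ0]) (fun s hs => (α_pos hr (hc s hs)).le) t ht
    simpa using this
  have hθle : ∀ t ∈ Icc 0 T, θ t * g ≤ 1 := fun t ht => by
    have := le_of_hasDerivAt_le (g := fun s => 32 * s) (g' := fun _ => 32) hθ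
      (fun s _ => by simpa using (hasDerivAt_id s).const_mul 32) (by simp [hθ0])
      (fun s hs => α_le hr (hc s hs)) t ht
    have h1 := ht.2.trans hT.2
    have := hr.Tend_le
    nlinarith
  have hu : ∀ t ∈ Icc 0 T, 0 ≤ θ t - w t := fun t ht => by
    have := le_of_hasDerivAt_le hw hθ (by simp [hθ0, hw0]) (fun s hs => by
      nlinarith [(abs_le.1 (F.abs_ρ_le s)).2, α_pos hr (hc s hs)]) t ht
    linarith
  have hv : ∀ t ∈ Icc 0 T, 0 ≤ θ t + w t := fun t ht => by
    have := le_of_hasDerivAt_le (f := fun s => -w s) (fun s hs => (hw s hs).neg) hθ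
      (by simp [hθ0, hw0]) (fun s hs => by
      nlinarith [(abs_le.1 (F.abs_ρ_le s)).1, α_pos hr (hc s hs)]) t ht
    linarith
  refine ⟨θ, w, hθ0, hw0, hθ, hw, ?_⟩
  have hpow : ∀ t ∈ Icc 0 T, 4 * g ^ 6 * θ t ≤ g ^ 4 := fun t ht => by
    have h1 := hθle t ht
    have : 4 * g ^ 6 * θ t = (4 * g) * (θ t * g) * g ^ 4 := by ring
    rw [this]
    refine mul_le_of_le_one_left (by positivity) ?_
    exact mul_le_one₀ (by linarith) (mul_nonneg (hθpos t ht) hg.le) h1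
  -- the noise columns are treated alike on both sides
  have noise : ∀ (F' : Flow P Q E), F'.Regime κ M H g Tend → F'.lamx = F.lamx →
      (∀ t, F'.α t = F.α t) → (∀ t, F'.ρ t = F.ρ t) →
      (∀ t ∈ Icc 0 T, F'.Controlled H g t) → ∀ q, ∀ t ∈ Icc 0 T,
      ‖F'.x q t - Real.exp (-(F.lamx * w t)) • F'.x q 0‖ ≤
        Real.exp (-(F.lamx * w t)) * (g ^ 4 * ‖F'.x q 0‖) := by
    intro F' hr' hl hα' hρ' hc' q t ht
    have h := norm_sub_exp_smul_le_of_relative (f := F'.x q) (f' := F'.x' q) (b := T)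
      (φ := fun t => -(F.lamx * w t)) (φ' := fun t => -(F.lamx * (F.α t * F.ρ t)))
      (ψ := fun t => 6 * g ^ 7 * θ t) (ψ' := fun t => 6 * g ^ 7 * F.α t)
      (fun s hs => ((hw s hs).const_mul _).neg) (by simp [hw0])
      (fun s hs => hr'.perturbed.hasDeriv_x q s hs.1)
      (fun s hs => (hθ s hs).const_mul _) (by simp [hθ0])
      (fun s hs => by have := α_pos hr (hc s hs); positivity)
      (x_zero_ne hr' q)
      (fun s hs => by
        have := norm_x'_sub_le hr' hs.1 (hc' s hs) q
        rw [hl, hα', hρ'] at this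
        linarith) t ht
    refine h.trans ?_
    have h1 : Real.exp (6 * g ^ 7 * θ t) - 1 ≤ g ^ 4 := by
      have h2 : 6 * g ^ 7 * θ t ≤ g ^ 4 / 2 := by
        have := hpow t ht
        have : 0 ≤ g ^ 6 * θ t := mul_nonneg (by positivity) (hθpos t ht)
        have e : 6 * g ^ 7 * θ t = 6 * g * (g ^ 6 * θ t) := by ring
        nlinarith
      have h3 : 0 ≤ 6 * g ^ 7 * θ t := mul_nonneg (by positivity) (hθpos t ht)
      have h4 : g ^ 4 ≤ 1 := pow_le_one₀ hg.le (by linarith)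
      have h5 := Real.abs_exp_sub_one_le (x := 6 * g ^ 7 * θ t)
        (by rw [abs_of_nonneg h3]; linarith)
      rw [abs_of_nonneg h3] at h5
      linarith [le_abs_self (Real.exp (6 * g ^ 7 * θ t) - 1)]
    gcongr
  intro t ht
  refine ⟨fun p => ?_, fun p => ?_, fun q => noise F hr rfl (fun _ => rfl) (fun _ => rfl) hc q t ht,
    fun q => noise F.swap hr.swap rfl (by simp) (by simp) (fun s hs => (hc s hs).swap) q t ht,
    hu t ht, hv t ht, hθle t ht⟩
  · have h := norm_sub_exp_smul_le (f := fun s => F.a p s + F.b p s)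
      (f' := fun s => F.a' p s + F.b' p s) (b := T)
      (φ := fun t => F.lam p * (θ t - w t)) (φ' := fun t => F.lam p * (F.α t - F.α t * F.ρ t))
      (ψ := fun t => 4 * g ^ 6 * θ t) (ψ' := fun t => 4 * g ^ 6 * F.α t)
      (fun s hs => ((hθ s hs).sub (hw s hs)).const_mul _) (by simp [hw0, hθ0])
      (fun s hs => (hr.perturbed.hasDeriv_a p s hs.1).add (hr.perturbed.hasDeriv_b p s hs.1))
      (fun s hs => (hθ s hs).const_mul _) (by simp [hθ0])
      (fun s hs => by
        have h1 := norm_a'_sub_le hr hs.1 (hc s hs) p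
        have h2 := norm_b'_sub_le hr hs.1 (hc s hs) p
        have h3 := norm_add_le_of_le h1 h2
        have h4 : 1 ≤ Real.exp (F.lam p * (θ s - w s)) :=
          Real.one_le_exp (mul_nonneg (by linarith [hr.one_le_lam p]) (hu s hs))
        have h5 : 0 ≤ 4 * g ^ 6 * F.α s := by have := α_pos hr (hc s hs); positivity
        refine le_trans (le_of_eq_of_le ?_ h3) (by nlinarith)
        congr 1
        module) t ht
    refine h.trans ?_
    have := hpow t ht
    gcongr
  · have h := norm_sub_exp_smul_le (f := fun s => F.a p s - F.b p s)
      (f' := fun s => F.a' p s - F.b' p s) (b := T)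
      (φ := fun t => -(F.lam p * (θ t + w t)))
      (φ' := fun t => -(F.lam p * (F.α t + F.α t * F.ρ t)))
      (ψ := fun t => Real.exp (F.lam p * (θ t + w t)) * (4 * g ^ 6 * θ t))
      (ψ' := fun t => Real.exp (F.lam p * (θ t + w t)) *
        (F.lam p * (F.α t + F.α t * F.ρ t)) * (4 * g ^ 6 * θ t) +
        Real.exp (F.lam p * (θ t + w t)) * (4 * g ^ 6 * F.α t))
      (fun s hs => (((hθ s hs).add (hw s hs)).const_mul _).neg) (by simp [hw0, hθ0])
      (fun s hs => (hr.perturbed.hasDeriv_a p s hs.1).sub (hr.perturbed.hasDeriv_b p s hs.1))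
      (fun s hs => ((((hθ s hs).add (hw s hs)).const_mul _).exp).mul ((hθ s hs).const_mul _))
      (by simp [hθ0])
      (fun s hs => by
        have h1 := norm_a'_sub_le hr hs.1 (hc s hs) p
        have h2 := norm_b'_sub_le hr hs.1 (hc s hs) p
        have h3 := norm_sub_le_of_le h1 h2
        have h4 : 0 ≤ F.lam p * (F.α s + F.α s * F.ρ s) * (4 * g ^ 6 * θ s) := by
          have := (abs_le.1 (F.abs_ρ_le s)).1
          have := α_pos hr (hc s hs)
          have := hθpos s hs
          have := hr.one_le_lam p
          have : 0 ≤ F.α s + F.α s * F.ρ s := by nlinarith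
          positivity
        rw [mul_assoc (Real.exp _), ← mul_add, ← mul_assoc, ← Real.exp_add]
        simp only [neg_add_cancel, Real.exp_zero, one_mul]
        refine le_trans (le_of_eq_of_le ?_ h3) (by linarith)
        congr 1
        module) t ht
    refine h.trans ?_
    rw [← mul_assoc, ← Real.exp_add]
    simpa using hpow t ht

end Flow

namespace Flow

variable {P Q E : Type*} [Fintype P] [Fintype Q] [NormedAddCommGroup E] [InnerProductSpace ℝ E]
  {F : Flow P Q E} {κ M H g Tend θ w t : ℝ}

/-! ### Estimates at a fixed time -/

/-- The squared norm of the `p`-th signal columns predicted by the explicit solution, up to the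
decayed difference `a - b`. -/
def S (F : Flow P Q E) (u : ℝ) (p : P) : ℝ := F.lam p * Real.exp (F.lam p * u) ^ 2 / 2

theorem Regime.lam_pos (hr : F.Regime κ M H g Tend) (p : P) : 0 < F.lam p := by
  linarith [hr.one_le_lam p]

theorem Regime.S_ge (hr : F.Regime κ M H g Tend) {u : ℝ} (hu : 0 ≤ u) (p : P) :
    1 / 2 ≤ F.S u p := by
  have h1 : 1 ≤ Real.exp (F.lam p * u) := Real.one_le_exp (mul_nonneg (hr.lam_pos p).le hu)
  have h2 := hr.one_le_lam p
  unfold S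
  nlinarith

theorem Regime.g4_le (hr : F.Regime κ M H g Tend) : g ^ 4 ≤ 1 / 1000000 := by
  have h0 := hr.g_pos
  have h1 := hr.g_le
  calc g ^ 4 ≤ (1 / 1000) ^ 4 := by gcongr
    _ ≤ _ := by norm_num

theorem Regime.g8_le (hr : F.Regime κ M H g Tend) : g ^ 8 ≤ g ^ 4 / 1000 := by
  have h0 := hr.g_pos
  have h1 := hr.g_le
  have h2 := hr.g4_le
  have h3 : 0 < g ^ 4 := by positivity
  calc g ^ 8 = g ^ 4 * g ^ 4 := by ring
    _ ≤ _ := by nlinarith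

theorem Regime.g18_le (hr : F.Regime κ M H g Tend) : g ^ 18 ≤ g ^ 4 / 1000 :=
  (hr.pow_le 18 8 (by norm_num)).trans hr.g8_le

theorem norm_add_zero_sq (hr : F.Regime κ M H g Tend) (p : P) :
    |‖F.a p 0 + F.b p 0‖ ^ 2 - 2 * F.lam p| ≤ g ^ 4 * F.lam p := by
  have h1 := abs_le.1 (hr.initial.norm_a p)
  have h2 := abs_le.1 (hr.initial.norm_b p)
  have h3 := abs_le.1 (hr.initial.ab p p)
  have h4 := hr.g18_le
  have h5 := hr.one_le_lam p
  have h6 : 0 < g ^ 4 := by have := hr.g_pos; positivity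
  rw [norm_add_sq_real, abs_le]
  constructor <;> nlinarith

theorem norm_sub_zero_sq (hr : F.Regime κ M H g Tend) (p : P) :
    |‖F.a p 0 - F.b p 0‖ ^ 2 - 2 * F.lam p| ≤ g ^ 4 * F.lam p := by
  have h1 := abs_le.1 (hr.initial.norm_a p)
  have h2 := abs_le.1 (hr.initial.norm_b p)
  have h3 := abs_le.1 (hr.initial.ab p p)
  have h4 := hr.g18_le
  have h5 := hr.one_le_lam p
  have h6 : 0 < g ^ 4 := by have := hr.g_pos; positivity
  rw [norm_sub_sq_real, abs_le]
  constructor <;> nlinarith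

theorem le_two_mul_of_sq {l n z : ℝ} (hl : 1 ≤ l) (hz : z ≤ 1 / 1000000) (h : |n ^ 2 - 2 * l| ≤ z * l) :
    n ≤ 2 * l := by
  refine le_of_sq_le_sq ?_ (by linarith)
  nlinarith [(abs_le.1 h).2]

/-- The sum `a + b` carries the squared norm `4 S`, which grows with the exponent `θ - w`. -/
theorem add_sq_ge (hr : F.Regime κ M H g Tend) (ha : F.Approx g θ w t) (p : P) :
    F.S (θ - w) p * (1 - 3 * g ^ 4) ≤ ‖F.a p t + F.b p t‖ ^ 2 / 4 := by
  have h0 := norm_add_zero_sq hr p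
  have hz := hr.g4_le
  have hl := hr.one_le_lam p
  have h1 := le_two_mul_of_sq hl hz h0
  have h2 := ha.add p
  have hz0 : 0 < g ^ 4 := by have := hr.g_pos; positivity
  set e := Real.exp (F.lam p * (θ - w)) with he
  have he0 : 0 < e := Real.exp_pos _
  set n0 := ‖F.a p 0 + F.b p 0‖
  have h3 : e * (n0 - g ^ 4) ≤ ‖F.a p t + F.b p t‖ := by
    have := norm_sub_norm_le (e • (F.a p 0 + F.b p 0)) (F.a p t + F.b p t)
    rw [norm_smul, Real.norm_eq_abs, abs_of_pos he0, norm_sub_rev] at this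
    linarith
  have h4 : g ^ 4 ≤ n0 := by
    refine le_of_sq_le_sq ?_ (norm_nonneg _)
    nlinarith [(abs_le.1 h0).1]
  have h5 : (e * (n0 - g ^ 4)) ^ 2 ≤ ‖F.a p t + F.b p t‖ ^ 2 :=
    pow_le_pow_left₀ (mul_nonneg he0.le (by linarith)) h3 2
  have h6 : F.lam p * (2 - 6 * g ^ 4) ≤ (n0 - g ^ 4) ^ 2 := by
    nlinarith [(abs_le.1 h0).1, mul_le_mul_of_nonneg_left h1 hz0.le, sq_nonneg (g ^ 4)]
  unfold S
  rw [← he]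
  have h7 := mul_le_mul_of_nonneg_left h6 (sq_nonneg e)
  rw [mul_pow] at h5
  nlinarith

theorem add_sq_le (hr : F.Regime κ M H g Tend) (ha : F.Approx g θ w t) (p : P) :
    ‖F.a p t + F.b p t‖ ^ 2 / 4 ≤ F.S (θ - w) p * (1 + 3 * g ^ 4) := by
  have h0 := norm_add_zero_sq hr p
  have hz := hr.g4_le
  have hl := hr.one_le_lam p
  have h1 := le_two_mul_of_sq hl hz h0
  have h2 := ha.add p
  have hz0 : 0 < g ^ 4 := by have := hr.g_pos; positivity
  set e := Real.exp (F.lam p * (θ - w)) with he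
  have he0 : 0 < e := Real.exp_pos _
  set n0 := ‖F.a p 0 + F.b p 0‖
  have h3 : ‖F.a p t + F.b p t‖ ≤ e * (n0 + g ^ 4) := by
    have := norm_sub_norm_le (F.a p t + F.b p t) (e • (F.a p 0 + F.b p 0))
    rw [norm_smul, Real.norm_eq_abs, abs_of_pos he0] at this
    linarith
  have h5 := pow_le_pow_left₀ (norm_nonneg _) h3 2
  have h6 : (n0 + g ^ 4) ^ 2 ≤ F.lam p * (2 + 6 * g ^ 4) := by
    nlinarith [(abs_le.1 h0).2, mul_le_mul_of_nonneg_left h1 hz0.le]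
  unfold S
  rw [← he]
  have h7 := mul_le_mul_of_nonneg_left h6 (sq_nonneg e)
  rw [mul_pow] at h5
  nlinarith

/-- The difference `a - b` is smaller than the sum `a + b` by the factor `exp (-2 lam θ)`; as
`1 ≤ lam`, the relative size of its square is at most `exp (-4 θ)`. -/
theorem sub_sq_le (hr : F.Regime κ M H g Tend) (ha : F.Approx g θ w t) (p : P) :
    ‖F.a p t - F.b p t‖ ^ 2 / 4 ≤ F.S (θ - w) p * (Real.exp (-(4 * θ)) + 3 * g ^ 4) := by
  have h0 := norm_sub_zero_sq hr p
  have hz := hr.g4_le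
  have hl := hr.one_le_lam p
  have h1 := le_two_mul_of_sq hl hz h0
  have h2 := ha.sub p
  have hz0 : 0 < g ^ 4 := by have := hr.g_pos; positivity
  have hθ := ha.θ_nonneg
  set e := Real.exp (F.lam p * (θ - w)) with he
  set f := Real.exp (-(F.lam p * (θ + w))) with hf
  have hf0 : 0 < f := Real.exp_pos _
  have hf1 : f ≤ 1 := Real.exp_le_one_iff.2
    (neg_nonpos.2 (mul_nonneg (hr.lam_pos p).le ha.v_nonneg))
  have he1 : 1 ≤ e := Real.one_le_exp (mul_nonneg (hr.lam_pos p).le ha.u_nonneg)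
  have hfe : f ^ 2 ≤ e ^ 2 * Real.exp (-(4 * θ)) := by
    rw [hf, he, ← Real.exp_nat_mul, ← Real.exp_nat_mul, ← Real.exp_add]
    refine Real.exp_le_exp.2 ?_
    push_cast
    nlinarith
  set n0 := ‖F.a p 0 - F.b p 0‖
  have h3 : ‖F.a p t - F.b p t‖ ≤ f * n0 + g ^ 4 := by
    have := norm_sub_norm_le (F.a p t - F.b p t) (f • (F.a p 0 - F.b p 0))
    rw [norm_smul, Real.norm_eq_abs, abs_of_pos hf0] at this
    linarith
  have h5 := pow_le_pow_left₀ (norm_nonneg _) h3 2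
  have h6 : (f * n0 + g ^ 4) ^ 2 ≤ F.lam p * (2 * f ^ 2 + 6 * g ^ 4) := by
    have a1 : f ^ 2 * n0 ^ 2 ≤ f ^ 2 * (2 * F.lam p) + g ^ 4 * F.lam p := by
      have := (abs_le.1 h0).2
      have b1 := mul_le_mul_of_nonneg_left (show n0 ^ 2 ≤ 2 * F.lam p + g ^ 4 * F.lam p by linarith)
        (sq_nonneg f)
      have b2 : f ^ 2 ≤ 1 := pow_le_one₀ hf0.le hf1
      nlinarith [mul_pos hz0 (hr.lam_pos p)]
    have a2 : f * n0 ≤ 2 * F.lam p := (mul_le_of_le_one_left (norm_nonneg _) hf1).trans h1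
    nlinarith [mul_le_mul_of_nonneg_left a2 hz0.le]
  unfold S
  rw [← he]
  have he2 : 1 ≤ e ^ 2 := one_le_pow₀ he1
  have h8 : F.lam p * (2 * f ^ 2 + 6 * g ^ 4) ≤
      F.lam p * (2 * (e ^ 2 * Real.exp (-(4 * θ))) + e ^ 2 * (6 * g ^ 4)) := by
    refine mul_le_mul_of_nonneg_left ?_ (hr.lam_pos p).le
    nlinarith
  linarith

theorem inner_eq_quarter (v z : E) : inner ℝ v z = ‖v + z‖ ^ 2 / 4 - ‖v - z‖ ^ 2 / 4 := by
  rw [norm_add_sq_real, norm_sub_sq_real]; ring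

theorem sq_add_sq_eq (v z : E) : ‖v‖ ^ 2 + ‖z‖ ^ 2 = (‖v + z‖ ^ 2 / 4 + ‖v - z‖ ^ 2 / 4) * 2 := by
  rw [norm_add_sq_real, norm_sub_sq_real]; ring

theorem inner_ab_ge (hr : F.Regime κ M H g Tend) (ha : F.Approx g θ w t) (p : P) :
    F.S (θ - w) p * (1 - Real.exp (-(4 * θ)) - 6 * g ^ 4) ≤ inner ℝ (F.a p t) (F.b p t) := by
  rw [inner_eq_quarter]
  linarith [add_sq_ge hr ha p, sub_sq_le hr ha p]

/-- As the norms of `a` and `b` nearly agree, each is at least about half that of `a + b`. -/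
theorem norm_a_sq_ge (hr : F.Regime κ M H g Tend) (ha : F.Approx g θ w t)
    (hc : F.Controlled H g t) (p : P) : F.S (θ - w) p * (1 - 4 * g ^ 4) ≤ ‖F.a p t‖ ^ 2 := by
  have h1 := add_sq_ge hr ha p
  have h2 := sq_add_sq_eq (F.a p t) (F.b p t)
  have h3 := hc.ba p
  have h4 := hr.g8_le
  have h5 : 0 ≤ ‖F.a p t - F.b p t‖ ^ 2 := sq_nonneg _
  have hz := hr.g4_le
  have hz0 : 0 < g ^ 4 := by have := hr.g_pos; positivity
  have hS := hr.S_ge ha.u_nonneg p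
  have h6 : F.S (θ - w) p * (1 - 3 * g ^ 4) * 2 ≤ (2 + g ^ 4 / 1000) * ‖F.a p t‖ ^ 2 := by
    nlinarith [sq_nonneg ‖F.a p t‖]
  by_contra! h7
  nlinarith [mul_pos hz0 (by linarith : 0 < F.S (θ - w) p)]

theorem norm_a_sq_le (hr : F.Regime κ M H g Tend) (ha : F.Approx g θ w t) (p : P) :
    ‖F.a p t‖ ^ 2 ≤ 5 * F.S (θ - w) p := by
  have h1 := add_sq_le hr ha p
  have h2 := sq_add_sq_eq (F.a p t) (F.b p t)
  have h3 := sub_sq_le hr ha p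
  have hz := hr.g4_le
  have hS := hr.S_ge ha.u_nonneg p
  have hE : Real.exp (-(4 * θ)) ≤ 1 := Real.exp_le_one_iff.2 (by linarith [ha.θ_nonneg])
  nlinarith [sq_nonneg ‖F.b p t‖]

theorem norm_x_sq_le (hr : F.Regime κ M H g Tend) (ha : F.Approx g θ w t) (q : Q) :
    ‖F.x q t‖ ^ 2 ≤ 2 * F.lamx * Real.exp (-(F.lamx * w)) ^ 2 := by
  have h1 := (abs_le.1 (hr.initial.norm_x q)).2
  have h2 := ha.x q
  have h3 := hr.g18_le
  have hz := hr.g4_le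
  have hz0 : 0 < g ^ 4 := by have := hr.g_pos; positivity
  have hl := hr.one_le_lamx
  set f := Real.exp (-(F.lamx * w))
  have hf0 : 0 < f := Real.exp_pos _
  have h4 : ‖F.x q t‖ ≤ f * ((1 + g ^ 4) * ‖F.x q 0‖) := by
    have := norm_sub_norm_le (F.x q t) (f • F.x q 0)
    rw [norm_smul, Real.norm_eq_abs, abs_of_pos hf0] at this
    linarith
  have h5 := pow_le_pow_left₀ (norm_nonneg _) h4 2
  have h6 : ((1 + g ^ 4) * ‖F.x q 0‖) ^ 2 ≤ 2 * F.lamx := by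
    rw [mul_pow]
    have : (1 + g ^ 4) ^ 2 ≤ 1.1 := by nlinarith
    have : ‖F.x q 0‖ ^ 2 ≤ 1.1 * F.lamx := by linarith
    nlinarith [sq_nonneg ‖F.x q 0‖]
  rw [mul_pow] at h5
  nlinarith [mul_le_mul_of_nonneg_left h6 (sq_nonneg f)]

theorem Regime.sum_S_ge (hr : F.Regime κ M H g Tend) {u : ℝ} (hu : 0 ≤ u) :
    (Fintype.card P : ℝ) / 2 ≤ ∑ p, F.S u p := by
  have := Finset.card_nsmul_le_sum Finset.univ (F.S u) (1 / 2) (fun p _ => hr.S_ge hu p)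
  rw [nsmul_eq_mul, Finset.card_univ] at this
  linarith

theorem Regime.sum_S_pos (hr : F.Regime κ M H g Tend) {u : ℝ} (hu : 0 ≤ u) :
    0 < ∑ p, F.S u p := by
  linarith [hr.sum_S_ge hu, hr.one_le_card]

theorem nA_sq_ge (hr : F.Regime κ M H g Tend) (ha : F.Approx g θ w t) (hc : F.Controlled H g t) :
    (∑ p, F.S (θ - w) p) * (1 - 4 * g ^ 4) ≤ F.nA t ^ 2 := by
  rw [nA_sq, Finset.sum_mul]
  exact le_add_of_le_of_nonneg (Finset.sum_le_sum fun p _ => norm_a_sq_ge hr ha hc p) (by positivity)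

/-- The noise-to-signal bound `4 M S exp (-2 lamx w)` on the total noise. -/
theorem sum_x_sq_le (hr : F.Regime κ M H g Tend) (ha : F.Approx g θ w t) :
    ∑ q, ‖F.x q t‖ ^ 2 ≤ 4 * M * (∑ p, F.S (θ - w) p) * Real.exp (-(F.lamx * w)) ^ 2 := by
  have h1 : ∑ q, ‖F.x q t‖ ^ 2 ≤
      Fintype.card Q * (2 * F.lamx * Real.exp (-(F.lamx * w)) ^ 2) := by
    have := Finset.sum_le_card_nsmul Finset.univ (fun q => ‖F.x q t‖ ^ 2) _
      (fun q _ => norm_x_sq_le hr ha q)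
    rwa [nsmul_eq_mul, Finset.card_univ] at this
  have h2 := hr.sum_S_ge ha.u_nonneg
  have h3 := hr.noise_le
  have h4 : (Fintype.card Q : ℝ) * F.lamx ≤ M * (2 * ∑ p, F.S (θ - w) p) :=
    h3.trans (mul_le_mul_of_nonneg_left (by linarith) (by linarith [hr.one_le_M]))
  have h5 := mul_le_mul_of_nonneg_right h4 (sq_nonneg (Real.exp (-(F.lamx * w))))
  linarith

section Balanced

variable (hr : F.Regime κ M H g Tend) (ha : F.Approx g θ w t) (hc : F.Controlled H g t)
include hr ha hc

theorem nAnB_ge : (∑ p, F.S (θ - w) p) * (1 - 4 * g ^ 4) ≤ F.nA t * F.nB t := by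
  have h1 := nA_sq_ge hr ha hc
  have h2 := nA_sq_ge hr.swap ha.swap hc.swap
  have hA : 0 ≤ F.nA t := by linarith [hc.nA_ge]
  have hB : 0 ≤ F.nB t := by linarith [hc.nB_ge]
  have hS := hr.sum_S_pos ha.u_nonneg
  have hz := hr.g4_le
  have h3 : 0 ≤ (∑ p, F.S (θ - w) p) * (1 - 4 * g ^ 4) := mul_nonneg hS.le (by linarith)
  refine le_of_sq_le_sq ?_ (mul_nonneg hA hB)
  rw [mul_pow (F.nA t), sq ((∑ p, F.S (θ - w) p) * _)]
  exact mul_le_mul h1 h2 h3 (sq_nonneg _)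

theorem nAnB_pos : 0 < F.nA t * F.nB t :=
  mul_pos (by linarith [hc.nA_ge]) (by linarith [hc.nB_ge])

theorem S_div_le_two : (∑ p, F.S (θ - w) p) / (F.nA t * F.nB t) ≤ 2 := by
  rw [div_le_iff₀ (nAnB_pos hr ha hc)]
  have := nAnB_ge hr ha hc
  have hS := hr.sum_S_pos ha.u_nonneg
  have hz := hr.g4_le
  nlinarith

/-- The share of the signal in the total norm is at most `ρ`, up to the remaining misalignment. -/
theorem ρ_ge : (∑ p, F.S (θ - w) p) / (F.nA t * F.nB t) ≤
    F.ρ t + 2 * (Real.exp (-(4 * θ)) + 9 * g ^ 4) := by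
  have h1 : (∑ p, F.S (θ - w) p) * (1 - Real.exp (-(4 * θ)) - 6 * g ^ 4) ≤
      ∑ p, inner ℝ (F.a p t) (F.b p t) := by
    rw [Finset.sum_mul]
    exact Finset.sum_le_sum fun p _ => inner_ab_ge hr ha p
  have h2 := div_le_div_of_nonneg_right h1 (nAnB_pos hr ha hc).le
  have h3 := S_div_le_two hr ha hc
  have hE := Real.exp_pos (-(4 * θ))
  have hz0 : 0 < g ^ 4 := by have := hr.g_pos; positivity
  rw [mul_div_right_comm] at h2
  unfold ρ
  nlinarith

/-- The correlation is never significantly negative, even before the columns are aligned. -/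
theorem ρ_ge_neg : -(18 * g ^ 4) ≤ F.ρ t := by
  have h1 : (∑ p, F.S (θ - w) p) * (1 - Real.exp (-(4 * θ)) - 6 * g ^ 4) ≤
      ∑ p, inner ℝ (F.a p t) (F.b p t) := by
    rw [Finset.sum_mul]
    exact Finset.sum_le_sum fun p _ => inner_ab_ge hr ha p
  have h2 := div_le_div_of_nonneg_right h1 (nAnB_pos hr ha hc).le
  have h3 := S_div_le_two hr ha hc
  have h4 : 0 < (∑ p, F.S (θ - w) p) / (F.nA t * F.nB t) :=
    div_pos (hr.sum_S_pos ha.u_nonneg) (nAnB_pos hr ha hc)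
  have hE : Real.exp (-(4 * θ)) ≤ 1 := Real.exp_le_one_iff.2 (by linarith [ha.θ_nonneg])
  have hz0 : 0 < g ^ 4 := by have := hr.g_pos; positivity
  rw [mul_div_right_comm] at h2
  unfold ρ
  nlinarith

/-- The deficit `1 - ρ` that drives the growth of the signal is due to the remaining misalignment
and to the noise. -/
theorem one_sub_ρ_le : 1 - F.ρ t ≤ 4 * (Real.exp (-(4 * θ)) + 9 * g ^ 4) +
    4 * M * ((∑ p, F.S (θ - w) p) / (F.nA t * F.nB t)) * Real.exp (-(F.lamx * w)) ^ 2 := by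
  have hn := nAnB_pos hr ha hc
  have h1 : F.nA t * F.nB t - ∑ p, inner ℝ (F.a p t) (F.b p t) ≤
      2 * ((∑ p, F.S (θ - w) p) * (Real.exp (-(4 * θ)) + 3 * g ^ 4)) +
      4 * M * (∑ p, F.S (θ - w) p) * Real.exp (-(F.lamx * w)) ^ 2 := by
    have a1 : F.nA t * F.nB t ≤ (F.nA t ^ 2 + F.nB t ^ 2) / 2 := by
      nlinarith [sq_nonneg (F.nA t - F.nB t)]
    have a2 := sum_x_sq_le hr ha
    have a3 : ∑ q, ‖F.y q t‖ ^ 2 ≤ _ := sum_x_sq_le hr.swap ha.swap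
    have a4 : ∑ p, ((‖F.a p t‖ ^ 2 + ‖F.b p t‖ ^ 2) / 2 - inner ℝ (F.a p t) (F.b p t)) ≤
        ∑ p, 2 * (F.S (θ - w) p * (Real.exp (-(4 * θ)) + 3 * g ^ 4)) := by
      refine Finset.sum_le_sum fun p _ => ?_
      have := sub_sq_le hr ha p
      rw [sq_add_sq_eq, inner_eq_quarter]
      linarith
    rw [Finset.sum_sub_distrib, ← Finset.sum_div, Finset.sum_add_distrib, ← Finset.mul_sum,
      ← Finset.sum_mul] at a4
    rw [nA_sq, nB_sq] at a1
    change ∑ q, ‖F.y q t‖ ^ 2 ≤ 4 * M * (∑ p, F.S (θ - w) p) * Real.exp (-(F.lamx * w)) ^ 2 at a3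
    linarith
  have h2 : 1 - F.ρ t = (F.nA t * F.nB t - ∑ p, inner ℝ (F.a p t) (F.b p t)) /
      (F.nA t * F.nB t) := by
    unfold ρ; rw [sub_div, div_self hn.ne']
  have h3 := S_div_le_two hr ha hc
  have h4 : 0 < Real.exp (-(4 * θ)) + 3 * g ^ 4 := by have := hr.g_pos; positivity
  rw [h2]
  calc _ ≤ _ := div_le_div_of_nonneg_right h1 hn.le
    _ = 2 * ((∑ p, F.S (θ - w) p) / (F.nA t * F.nB t)) * (Real.exp (-(4 * θ)) + 3 * g ^ 4) +
        4 * M * ((∑ p, F.S (θ - w) p) / (F.nA t * F.nB t)) * Real.exp (-(F.lamx * w)) ^ 2 := by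
          field_simp
    _ ≤ _ := by nlinarith [show 0 < g ^ 4 by have := hr.g_pos; positivity]

theorem norm_a_ge (p : P) : 1 / 2 ≤ ‖F.a p t‖ := by
  have h1 := norm_a_sq_ge hr ha hc p
  have hS := hr.S_ge ha.u_nonneg p
  have hz := hr.g4_le
  refine le_of_sq_le_sq ?_ (norm_nonneg _)
  nlinarith

/-- The cosine of the angle between `a` and `b` is at least `1 - 4 exp (-4 θ)`, up to an error of
order `g ^ 4`. -/
theorem inner_ab_ge_mul_norm (p : P) :
    (1 - 4 * (Real.exp (-(4 * θ)) + 9 * g ^ 4)) * (‖F.a p t‖ * ‖F.b p t‖) ≤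
      inner ℝ (F.a p t) (F.b p t) := by
  have h1 := norm_a_sq_ge hr ha hc p
  have h2 : F.S (θ - w) p * (1 - 4 * g ^ 4) ≤ ‖F.b p t‖ ^ 2 :=
    norm_a_sq_ge hr.swap ha.swap hc.swap p
  have hS := hr.S_ge ha.u_nonneg p
  have hz := hr.g4_le
  have h3 : F.S (θ - w) p * (1 - 4 * g ^ 4) ≤ ‖F.a p t‖ * ‖F.b p t‖ := by
    refine le_of_sq_le_sq ?_ (by positivity)
    rw [mul_pow ‖F.a p t‖, sq (F.S (θ - w) p * _)]
    exact mul_le_mul h1 h2 (mul_nonneg (by linarith) (by linarith)) (sq_nonneg _)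
  have h4 := sub_sq_le hr ha p
  have h5 := sq_add_sq_eq (F.a p t) (F.b p t)
  have h6 := inner_eq_quarter (F.a p t) (F.b p t)
  have h7 : ‖F.a p t‖ * ‖F.b p t‖ - inner ℝ (F.a p t) (F.b p t) ≤
      2 * (F.S (θ - w) p * (Real.exp (-(4 * θ)) + 3 * g ^ 4)) := by
    nlinarith [sq_nonneg (‖F.a p t‖ - ‖F.b p t‖)]
  have hE : 0 < Real.exp (-(4 * θ)) + 3 * g ^ 4 := by have := hr.g_pos; positivity
  have h8 : F.S (θ - w) p ≤ 2 * (‖F.a p t‖ * ‖F.b p t‖) := by nlinarith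
  have h9 := mul_le_mul_of_nonneg_right h8 hE.le
  have h10 : 0 ≤ g ^ 4 * (‖F.a p t‖ * ‖F.b p t‖) := by have := hr.g_pos; positivity
  nlinarith

end Balanced

end Flow

namespace Flow

variable {P Q E : Type*} [Fintype P] [Fintype Q] [NormedAddCommGroup E] [InnerProductSpace ℝ E]
  {F : Flow P Q E} {κ M H g Tend : ℝ}

/-! ### Bounded growth of the signal -/

/-- A potential whose growth dominates the decay of the noise and of the misalignment, and which
stays bounded. -/
def potential (F : Flow P Q E) (g θ w : ℝ) : ℝ :=
  (1 - Real.exp (-(F.lamx * w))) / F.lamx + 2 * (1 - Real.exp (-(4 * θ))) + 72 * g ^ 4 * θ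

/-- The rate of change of `potential` at time `t`. -/
def potentialRate (F : Flow P Q E) (g θ w t : ℝ) : ℝ :=
  F.α t * F.ρ t * Real.exp (-(F.lamx * w)) + 8 * F.α t * (Real.exp (-(4 * θ)) + 9 * g ^ 4)

section Clocks

variable {T : ℝ} {θ w : ℝ → ℝ}

theorem hasDerivAt_potential (hr : F.Regime κ M H g Tend) (hk : F.Clocks g T θ w) {t : ℝ}
    (ht : t ∈ Icc 0 T) :
    HasDerivAt (fun s => F.potential g (θ s) (w s)) (F.potentialRate g (θ t) (w t) t) t := by
  have hw := hk.hasDeriv_w t ht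
  have hθ := hk.hasDeriv_θ t ht
  have h1 := ((((hw.const_mul F.lamx).neg.exp).const_sub 1).div_const F.lamx)
  have h2 := (((hθ.const_mul 4).neg.exp).const_sub 1).const_mul 2
  have h3 := hθ.const_mul (72 * g ^ 4)
  refine ((h1.add h2).add h3).congr_deriv ?_
  have := hr.one_le_lamx
  simp only [potentialRate, Pi.neg_apply]
  field_simp
  ring

variable (hr : F.Regime κ M H g Tend) (hk : F.Clocks g T θ w)
  (hc : ∀ t ∈ Icc 0 T, F.Controlled H g t)
include hr hk hc

/-- The noise essentially never grows, since `ρ` is never significantly negative. -/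
theorem neg_half_le_lamx_mul_w {t : ℝ} (ht : t ∈ Icc 0 T) : -(1 / 2) ≤ F.lamx * w t := by
  have h1 := le_of_hasDerivAt_le (f := fun s => -(18 * g ^ 4) * θ s)
    (fun s hs => (hk.hasDeriv_θ s hs).const_mul (-(18 * g ^ 4))) hk.hasDeriv_w
    (by simp [hk.θ_zero, hk.w_zero]) (fun s hs => by
      have := ρ_ge_neg hr (hk.approx s hs) (hc s hs)
      have := α_pos hr (hc s hs)
      nlinarith) t ht
  have ha := hk.approx t ht
  have hg := hr.g_pos
  have hl := hr.one_le_lamx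
  have h2 : F.lamx * g ≤ 1 := (mul_le_mul_of_nonneg_right hr.lamx_le hg.le).trans hr.κ_le
  have h3 : (F.lamx * g) * (θ t * g) ≤ 1 :=
    mul_le_one₀ h2 (mul_nonneg ha.θ_nonneg hg.le) ha.θ_le
  have h4 : g ^ 2 ≤ 1 / 100 := by nlinarith [hr.g_le]
  have h5 := mul_le_mul_of_nonneg_left h1 (by linarith : 0 ≤ F.lamx)
  have h6 := mul_le_mul_of_nonneg_left h3 (sq_nonneg g)
  have e : F.lamx * (-(18 * g ^ 4) * θ t) = -18 * (g ^ 2 * (F.lamx * g * (θ t * g))) := by ring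
  rw [e] at h5
  linarith

theorem exp_neg_lamx_mul_w_le {t : ℝ} (ht : t ∈ Icc 0 T) : Real.exp (-(F.lamx * w t)) ^ 2 ≤ 3 := by
  have h := neg_half_le_lamx_mul_w hr hk hc ht
  rw [← Real.exp_nat_mul]
  calc _ ≤ Real.exp 1 := Real.exp_le_exp.2 (by push_cast; linarith)
    _ ≤ 3 := by linarith [Real.exp_one_lt_d9]

/-- The potential grows at least as fast as the share of the signal, weighted by the decay of the
noise, plus twice the misalignment. -/
theorem potentialRate_ge {t : ℝ} (ht : t ∈ Icc 0 T) :
    Real.exp (-(F.lamx * w t)) * (F.α t * ((∑ p, F.S (θ t - w t) p) / (F.nA t * F.nB t))) +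
      2 * (F.α t * (Real.exp (-(4 * θ t)) + 9 * g ^ 4)) ≤ F.potentialRate g (θ t) (w t) t := by
  have h1 := ρ_ge hr (hk.approx t ht) (hc t ht)
  have h2 := exp_neg_lamx_mul_w_le hr hk hc ht
  have hα := α_pos hr (hc t ht)
  set f := Real.exp (-(F.lamx * w t))
  have hf : 0 < f := Real.exp_pos _
  have hf3 : f ≤ 3 := by nlinarith
  have hE : 0 < Real.exp (-(4 * θ t)) + 9 * g ^ 4 := by have := hr.g_pos; positivity
  have h3 := mul_le_mul_of_nonneg_left h1 (mul_pos hf hα).le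
  have h4 : f * (F.α t * (Real.exp (-(4 * θ t)) + 9 * g ^ 4)) ≤
      3 * (F.α t * (Real.exp (-(4 * θ t)) + 9 * g ^ 4)) :=
    mul_le_mul_of_nonneg_right hf3 (mul_pos hα hE).le
  unfold potentialRate
  linarith

theorem misalignment_pos {t : ℝ} (ht : t ∈ Icc 0 T) :
    0 < F.α t * (Real.exp (-(4 * θ t)) + 9 * g ^ 4) := by
  have hα := α_pos hr (hc t ht)
  have := hr.g_pos
  positivity

theorem signal_share_pos {t : ℝ} (ht : t ∈ Icc 0 T) :
    0 < Real.exp (-(F.lamx * w t)) *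
      (F.α t * ((∑ p, F.S (θ t - w t) p) / (F.nA t * F.nB t))) :=
  mul_pos (Real.exp_pos _) (mul_pos (α_pos hr (hc t ht))
    (div_pos (hr.sum_S_pos (hk.approx t ht).u_nonneg) (nAnB_pos hr (hk.approx t ht) (hc t ht))))

theorem potential_nonneg_le {t : ℝ} (ht : t ∈ Icc 0 T) :
    0 ≤ F.potential g (θ t) (w t) ∧ F.potential g (θ t) (w t) ≤ 4 := by
  constructor
  · have h := le_of_hasDerivAt_le (f := fun _ => 0) (f' := fun _ => 0)
      (fun s _ => hasDerivAt_const _ _) (fun s hs => hasDerivAt_potential hr hk hs)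
      (by simp [potential, hk.θ_zero, hk.w_zero])
      (fun s hs => by
        linarith [potentialRate_ge hr hk hc hs, signal_share_pos hr hk hc hs,
          misalignment_pos hr hk hc hs]) t ht
    simpa using h
  · have ha := hk.approx t ht
    have hg := hr.g_pos
    have hl := hr.one_le_lamx
    have h1 : (1 - Real.exp (-(F.lamx * w t))) / F.lamx ≤ 1 := by
      rw [div_le_one (by linarith)]
      linarith [Real.exp_pos (-(F.lamx * w t))]
    have h2 := Real.exp_pos (-(4 * θ t))
    have h3 : 72 * g ^ 4 * θ t ≤ 1 := by
      have e : 72 * g ^ 4 * θ t = (72 * g ^ 3) * (θ t * g) := by ring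
      rw [e]
      refine mul_le_one₀ ?_ (mul_nonneg ha.θ_nonneg hg.le) ha.θ_le
      have : g ^ 3 ≤ (1 / 1000) ^ 3 := pow_le_pow_left₀ hg.le hr.g_le 3
      linarith
    unfold potential
    linarith

/-- The growth exponent `θ - w` of the signal stays bounded for all times: the growth is paid for
by the decay of the noise. -/
theorem growth_le {t : ℝ} (ht : t ∈ Icc 0 T) : θ t - w t ≤ 48 * M := by
  have h := le_of_hasDerivAt_le (f := fun s => θ s - w s)
    (fun s hs => (hk.hasDeriv_θ s hs).sub (hk.hasDeriv_w s hs))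
    (fun s hs => (hasDerivAt_potential hr hk hs).const_mul (12 * M))
    (by simp [potential, hk.θ_zero, hk.w_zero])
    (fun s hs => by
      have h1 := potentialRate_ge hr hk hc hs
      have h2 := mul_le_mul_of_nonneg_left (one_sub_ρ_le hr (hk.approx s hs) (hc s hs))
        (α_pos hr (hc s hs)).le
      have h3 := misalignment_pos hr hk hc hs
      have h4 := signal_share_pos hr hk hc hs
      have h5 := exp_neg_lamx_mul_w_le hr hk hc hs
      have hM := hr.one_le_M
      set f := Real.exp (-(F.lamx * w s))
      have hf : 0 < f := Real.exp_pos _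
      have hf3 : f ≤ 3 := by nlinarith
      set σ := (∑ p, F.S (θ s - w s) p) / (F.nA s * F.nB s)
      have h6 : F.α s * (4 * M * σ * f ^ 2) ≤ 12 * M * (f * (F.α s * σ)) := by
        have e : F.α s * (4 * M * σ * f ^ 2) = 4 * M * f * (f * (F.α s * σ)) := by ring
        rw [e]
        refine mul_le_mul_of_nonneg_right ?_ h4.le
        nlinarith
      nlinarith [mul_le_mul_of_nonneg_left h1 (by linarith : 0 ≤ 12 * M)]) t ht
  have h2 := (potential_nonneg_le hr hk hc ht).2
  nlinarith [hr.one_le_M]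

theorem exp_growth_le {t : ℝ} (ht : t ∈ Icc 0 T) (p : P) :
    Real.exp (F.lam p * (θ t - w t)) ^ 2 ≤ Real.exp (112 * κ * M) := by
  have h1 := growth_le hr hk hc ht
  have h2 := (hk.approx t ht).u_nonneg
  have hκ := hr.one_le_κ
  have hM := hr.one_le_M
  rw [← Real.exp_nat_mul]
  refine Real.exp_le_exp.2 ?_
  have h3 : F.lam p * (θ t - w t) ≤ κ * (48 * M) :=
    mul_le_mul (hr.lam_le p) h1 h2 (by linarith)
  push_cast
  nlinarith [mul_pos (by linarith : 0 < κ) (by linarith : 0 < M)]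

theorem S_le {t : ℝ} (ht : t ∈ Icc 0 T) (p : P) :
    F.S (θ t - w t) p ≤ κ * Real.exp (112 * κ * M) / 2 := by
  unfold S
  have := exp_growth_le hr hk hc ht p
  have := hr.lam_le p
  have := hr.lam_pos p
  gcongr
  linarith

/-- A strict improvement of the a priori upper bound on the total norm. -/
theorem nA_lt {t : ℝ} (ht : t ∈ Icc 0 T) : F.nA t < H := by
  have ha := hk.approx t ht
  have h1 : ∑ p, ‖F.a p t‖ ^ 2 ≤ 5 * ∑ p, F.S (θ t - w t) p := by
    rw [Finset.mul_sum]
    exact Finset.sum_le_sum fun p _ => norm_a_sq_le hr ha p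
  have h2 := sum_x_sq_le hr ha
  have h3 := exp_neg_lamx_mul_w_le hr hk hc ht
  have h4 : ∑ p, F.S (θ t - w t) p ≤ Fintype.card P * (κ * Real.exp (112 * κ * M) / 2) := by
    have := Finset.sum_le_card_nsmul Finset.univ (fun p => F.S (θ t - w t) p) _
      (fun p _ => S_le hr hk hc ht p)
    rwa [nsmul_eq_mul, Finset.card_univ] at this
  have hS := hr.sum_S_pos ha.u_nonneg
  have hM := hr.one_le_M
  have h5 : F.nA t ^ 2 ≤ 17 * M * ∑ p, F.S (θ t - w t) p := by
    rw [nA_sq]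
    have h6 : 4 * M * (∑ p, F.S (θ t - w t) p) * Real.exp (-(F.lamx * w t)) ^ 2 ≤
        4 * M * (∑ p, F.S (θ t - w t) p) * 3 :=
      mul_le_mul_of_nonneg_left h3 (mul_nonneg (by linarith) hS.le)
    nlinarith
  have h7 := mul_le_mul_of_nonneg_left h4 (by linarith : 0 ≤ 17 * M)
  have h8 := hr.lt_H
  have h9 : 0 < M * Fintype.card P * κ * Real.exp (112 * κ * M) := by
    have := hr.one_le_κ
    have := hr.one_le_card
    positivity
  refine lt_of_pow_lt_pow_left₀ 2 (by linarith [hr.H_pos]) ?_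
  linarith

/-- A strict improvement of the a priori lower bound on the total norm. -/
theorem nA_gt {t : ℝ} (ht : t ∈ Icc 0 T) : 1 / 4 < F.nA t := by
  have ha := hk.approx t ht
  have h1 := nA_sq_ge hr ha (hc t ht)
  have h2 := hr.sum_S_ge ha.u_nonneg
  have h3 := hr.one_le_card
  have h4 := hr.g4_le
  refine lt_of_pow_lt_pow_left₀ 2 (Real.sqrt_nonneg _) ?_
  nlinarith

end Clocks

/-! ### The two sides stay balanced -/

theorem abs_inner_signal_le {v z e : E} {α l β ε : ℝ}
    (h : ‖e - l • (α • z - β • v)‖ ≤ l * ε) :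
    |inner ℝ v e - l * (α * inner ℝ v z - β * ‖v‖ ^ 2)| ≤ l * (ε * ‖v‖) := by
  have h1 := abs_real_inner_le_norm v (e - l • (α • z - β • v))
  rw [inner_sub_right, real_inner_smul_right, inner_sub_right, real_inner_smul_right,
    real_inner_smul_right, real_inner_self_eq_norm_sq] at h1
  refine h1.trans ?_
  have := mul_le_mul_of_nonneg_left h (norm_nonneg v)
  linarith

theorem abs_inner_noise_le {v e : E} {l β ε : ℝ}
    (h : ‖e - l • (-β • v)‖ ≤ l * (ε * ‖v‖)) :
    |inner ℝ v e + l * (β * ‖v‖ ^ 2)| ≤ l * (ε * ‖v‖ ^ 2) := by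
  have h1 := abs_real_inner_le_norm v (e - l • (-β • v))
  rw [inner_sub_right, real_inner_smul_right, real_inner_smul_right,
    real_inner_self_eq_norm_sq] at h1
  have e1 : inner ℝ v e + l * (β * ‖v‖ ^ 2) = inner ℝ v e - l * (-β * ‖v‖ ^ 2) := by ring
  rw [e1]
  refine h1.trans ?_
  have := mul_le_mul_of_nonneg_left h (norm_nonneg v)
  linarith

theorem imbalance_mul_le {B₁ B N z z' : ℝ} (hB₁ : 0 ≤ B₁) (hN : 0 ≤ N) (hB : 0 ≤ B) (hBz : B ≤ z')
    (hz' : z' ≤ z / 1000) (hz : z ≤ 1 / 1000000) :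
    ((1 + z') * B₁ + N) * (1 + B) ≤ B₁ + z / 100 * B₁ + 3 / 2 * N := by
  have h1 : (1 + z') * (1 + B) ≤ 1 + z / 100 := by nlinarith
  nlinarith [mul_le_mul_of_nonneg_right h1 hB₁]

/-- The error of the gradient is negligible compared to the tolerated imbalance. -/
theorem signal_error_le {t B₁ na nb : ℝ} (hr : F.Regime κ M H g Tend) (hc : F.Controlled H g t)
    (hB₁ : g ^ 12 ≤ B₁) (hB₁' : B₁ ≤ 1) (hna0 : 0 ≤ na) (hab : na ≤ 2 * nb) (hb : 1 / 2 ≤ nb) :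
    g ^ 18 * F.α t * F.nB t * na + (1 + B₁) * (g ^ 18 * F.α t * F.nA t * nb) ≤
      F.α t * (g ^ 4 * B₁ * nb ^ 2) := by
  have hA : 0 < F.nA t := by linarith [hc.nA_ge]
  have hB : 0 < F.nB t := by linarith [hc.nB_ge]
  have hα := α_pos hr hc
  have hg := hr.g_pos
  have hB₁0 : 0 < B₁ := lt_of_lt_of_le (by positivity) hB₁
  have a1 : g ^ 18 * F.nB t ≤ g ^ 17 := by
    calc g ^ 18 * F.nB t ≤ g ^ 18 * H := by have := hc.nB_le; gcongr
      _ = g ^ 17 * (H * g) := by ring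
      _ ≤ _ := mul_le_of_le_one_right (by positivity) hr.H_le
  have a2 : g ^ 18 * F.nA t ≤ g ^ 17 := by
    calc g ^ 18 * F.nA t ≤ g ^ 18 * H := by have := hc.nA_le; gcongr
      _ = g ^ 17 * (H * g) := by ring
      _ ≤ _ := mul_le_of_le_one_right (by positivity) hr.H_le
  have a3 : g ^ 17 * 8 ≤ g ^ 4 * B₁ := by
    calc g ^ 17 * 8 = g ^ 4 * (g ^ 12 * (8 * g)) := by ring
      _ ≤ g ^ 4 * (g ^ 12 * 1) := by have := hr.g_le; gcongr; linarith
      _ ≤ _ := by rw [mul_one]; gcongr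
  have b1 : g ^ 18 * F.nB t * na ≤ g ^ 17 * (2 * nb) := mul_le_mul a1 hab hna0 (by positivity)
  have b2 : (1 + B₁) * (g ^ 18 * F.nA t * nb) ≤ 2 * (g ^ 17 * nb) :=
    mul_le_mul (by linarith) (mul_le_mul_of_nonneg_right a2 (by linarith)) (by positivity)
      (by norm_num)
  have b3 : g ^ 17 * (4 * nb) ≤ g ^ 4 * B₁ * nb ^ 2 := by
    have c1 : 4 * nb ≤ 8 * nb ^ 2 := by nlinarith
    have c2 := mul_le_mul_of_nonneg_left c1 (by positivity : 0 ≤ g ^ 17)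
    have c3 := mul_le_mul_of_nonneg_right a3 (sq_nonneg nb)
    linarith only [c2, c3]
  have := mul_le_mul_of_nonneg_left (show g ^ 18 * F.nB t * na + (1 + B₁) *
    (g ^ 18 * F.nA t * nb) ≤ g ^ 4 * B₁ * nb ^ 2 by linarith only [b1, b2, b3]) hα.le
  linarith only [this]

section Touch

variable {θ w t B₁ B₂ B' ν : ℝ}

/-- The imbalance of the total norms in terms of the imbalances `B₁` of the signal and `B₂` of the
noise columns, the latter weighted by the share `ν` of the noise. -/
theorem abs_imbalance_le (hr : F.Regime κ M H g Tend) (hc : F.Controlled H g t) (hB₁ : 0 ≤ B₁)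
    (hB₂ : 0 ≤ B₂)
    (hνx : ∑ q, ‖F.x q t‖ ^ 2 ≤ ν * (F.nA t * F.nB t))
    (hνy : ∑ q, ‖F.y q t‖ ^ 2 ≤ ν * (F.nA t * F.nB t))
    (hab : ∀ p, ‖F.a p t‖ ^ 2 ≤ (1 + B₁) * ‖F.b p t‖ ^ 2)
    (hba : ∀ p, ‖F.b p t‖ ^ 2 ≤ (1 + B₁) * ‖F.a p t‖ ^ 2)
    (hxy : ∀ q, ‖F.x q t‖ ^ 2 ≤ (1 + B₂) * ‖F.y q t‖ ^ 2)
    (hyx : ∀ q, ‖F.y q t‖ ^ 2 ≤ (1 + B₂) * ‖F.x q t‖ ^ 2) :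
    |F.nA t / F.nB t - F.nB t / F.nA t| ≤ (1 + g ^ 8) * B₁ + ν * B₂ := by
  have hA : 0 < F.nA t := by linarith [hc.nA_ge]
  have hB : 0 < F.nB t := by linarith [hc.nB_ge]
  have one_side : ∀ F' : Flow P Q E, F'.Controlled H g t →
      ∑ q, ‖F'.y q t‖ ^ 2 ≤ ν * (F'.nA t * F'.nB t) →
      (∀ p, ‖F'.a p t‖ ^ 2 ≤ (1 + B₁) * ‖F'.b p t‖ ^ 2) →
      (∀ q, ‖F'.x q t‖ ^ 2 ≤ (1 + B₂) * ‖F'.y q t‖ ^ 2) →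
      F'.nA t ^ 2 - F'.nB t ^ 2 ≤ ((1 + g ^ 8) * B₁ + ν * B₂) * (F'.nA t * F'.nB t) := by
    intro F' hc' hν' hab' hxy'
    have h1 : ∑ p, ‖F'.a p t‖ ^ 2 ≤ (1 + B₁) * ∑ p, ‖F'.b p t‖ ^ 2 := by
      rw [Finset.mul_sum]; exact Finset.sum_le_sum fun p _ => hab' p
    have h2 : ∑ q, ‖F'.x q t‖ ^ 2 ≤ (1 + B₂) * ∑ q, ‖F'.y q t‖ ^ 2 := by
      rw [Finset.mul_sum]; exact Finset.sum_le_sum fun p _ => hxy' p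
    have h3 : ∑ p, ‖F'.b p t‖ ^ 2 ≤ F'.nB t ^ 2 := by
      rw [nB_sq]; exact le_add_of_nonneg_right (by positivity)
    have h4 : F'.nB t ^ 2 ≤ (1 + g ^ 8) * (F'.nA t * F'.nB t) := by
      have := mul_le_mul_of_nonneg_right (nB_le_nA_mul hc' hr.g_pos)
        (by linarith [hc'.nB_ge] : 0 ≤ F'.nB t)
      nlinarith
    have h5 := mul_le_mul_of_nonneg_left (h3.trans h4) hB₁
    have h6 := mul_le_mul_of_nonneg_left hν' hB₂
    have h7 := F'.nA_sq t
    have h8 := F'.nB_sq t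
    nlinarith
  have h1 := one_side F hc hνy hab hxy
  have h2 := one_side F.swap hc.swap (by rw [swap_nA, swap_nB, mul_comm (F.nB t)]; exact hνx)
    hba hyx
  rw [swap_nA, swap_nB, mul_comm (F.nB t)] at h2
  have e : F.nA t / F.nB t - F.nB t / F.nA t = (F.nA t ^ 2 - F.nB t ^ 2) / (F.nA t * F.nB t) := by
    field_simp
  rw [e, abs_le]
  constructor
  · rw [le_div_iff₀ (mul_pos hA hB)]; linarith
  · rw [div_le_iff₀ (mul_pos hA hB)]; linarith

variable (hr : F.Regime κ M H g Tend) (hc : F.Controlled H g t) (ha : F.Approx g θ w t)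
  (hB₁ : g ^ 12 ≤ B₁) (hB₁' : B₁ ≤ g ^ 8) (hB₂ : 0 ≤ B₂) (hB₂' : B₂ ≤ g ^ 8) (hν : 0 ≤ ν)
  (himb : |F.nA t / F.nB t - F.nB t / F.nA t| ≤ (1 + g ^ 8) * B₁ + ν * B₂)
include hr hc ha hB₁ hB₁' hB₂ hB₂' hν himb

set_option maxHeartbeats 800000 in
/-- When the bound `‖a‖² ≤ (1 + B₁) ‖b‖²` is attained, it is about to improve: the attraction
between `a` and `b`, which are nearly aligned, makes up for the imbalance of the total norms. -/
theorem signal_touch (ht : 0 ≤ t) (p : P) (heq : ‖F.a p t‖ ^ 2 = (1 + B₁) * ‖F.b p t‖ ^ 2)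
    (hB' : 2 * κ * (F.α t * (9 * (Real.exp (-(4 * θ)) + 9 * g ^ 4) * B₁ + 2 * ν * B₂)) < B') :
    2 * inner ℝ (F.a p t) (F.a' p t) -
      (B' * ‖F.b p t‖ ^ 2 + (1 + B₁) * (2 * inner ℝ (F.b p t) (F.b' p t))) < 0 := by
  have hA : 0 < F.nA t := by linarith [hc.nA_ge]
  have hB : 0 < F.nB t := by linarith [hc.nB_ge]
  have hα := α_pos hr hc
  have hg := hr.g_pos
  have hg8 := hr.g8_le
  have hz := hr.g4_le
  have hz0 : 0 < g ^ 4 := by positivity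
  have hlam := hr.lam_pos p
  have hB₁0 : 0 < B₁ := lt_of_lt_of_le (by positivity) hB₁
  have hb := norm_a_ge hr.swap ha.swap hc.swap p
  change 1 / 2 ≤ ‖F.b p t‖ at hb
  set na := ‖F.a p t‖
  set nb := ‖F.b p t‖
  have hna0 : 0 ≤ na := norm_nonneg _
  have hba : nb ≤ na := le_of_sq_le_sq (by nlinarith [sq_nonneg nb]) hna0
  have hab : na ≤ 2 * nb := le_of_sq_le_sq (by nlinarith [sq_nonneg nb]) (by linarith)
  set c := inner ℝ (F.a p t) (F.b p t) with hcdef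
  have h1 := (abs_le.1 (abs_inner_signal_le (hr.perturbed.err_a p t ht hA hB))).2
  have h2 := (abs_le.1 (abs_inner_signal_le (hr.perturbed.err_b p t ht hA hB))).1
  rw [real_inner_comm (F.a p t) (F.b p t)] at h2
  -- the perturbation is negligible compared to `B₁`
  have h3 : g ^ 18 * F.α t * F.nB t * na + (1 + B₁) * (g ^ 18 * F.α t * F.nA t * nb) ≤
      F.α t * (g ^ 4 * B₁ * nb ^ 2) :=
    signal_error_le hr hc hB₁ (by linarith [hB₁', hg8, hz]) hna0 hab hb
  -- the imbalance of the total norms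
  have h4 : F.ρ t * (F.nA t / F.nB t - F.nB t / F.nA t) * na ^ 2 ≤
      (B₁ + g ^ 4 * B₁ + 2 * ν * B₂) * nb ^ 2 := by
    have a1 : F.ρ t * (F.nA t / F.nB t - F.nB t / F.nA t) ≤ (1 + g ^ 8) * B₁ + ν * B₂ := by
      refine (le_abs_self _).trans ?_
      rw [abs_mul]
      calc _ ≤ 1 * _ := mul_le_mul (F.abs_ρ_le t) himb (abs_nonneg _) zero_le_one
        _ = _ := one_mul _
    rw [heq, ← mul_assoc]
    refine mul_le_mul_of_nonneg_right ?_ (sq_nonneg nb)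
    have a2 := mul_le_mul_of_nonneg_right a1 (by linarith : 0 ≤ 1 + B₁)
    have a3 : 0 ≤ ν * B₂ := mul_nonneg hν hB₂
    have a4 := imbalance_mul_le hB₁0.le a3 hB₁0.le hB₁' hg8 hz
    have a5 : 0 ≤ g ^ 4 * B₁ := by positivity
    linarith only [a2, a3, a4, a5]
  -- the attraction between the two sides
  have h5 : -(B₁ * c) ≤ (-B₁ + 8 * (Real.exp (-(4 * θ)) + 9 * g ^ 4) * B₁) * nb ^ 2 := by
    have a1 := inner_ab_ge_mul_norm hr ha hc p
    have hE : 0 < Real.exp (-(4 * θ)) + 9 * g ^ 4 := by positivity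
    have a2 : nb ^ 2 ≤ na * nb := by nlinarith
    have a3 : na * nb ≤ 2 * nb ^ 2 := by nlinarith
    have a4 := mul_le_mul_of_nonneg_left a3 hE.le
    have a5 : -c ≤ (-1 + 8 * (Real.exp (-(4 * θ)) + 9 * g ^ 4)) * nb ^ 2 := by
      linarith only [a1, a2, a4]
    have := mul_le_mul_of_nonneg_left a5 hB₁0.le
    linarith only [this]
  have hnb2 : 0 < nb ^ 2 := by positivity
  have h6 : 2 * F.lam p * (F.α t * ((9 * (Real.exp (-(4 * θ)) + 9 * g ^ 4) * B₁ + 2 * ν * B₂) *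
      nb ^ 2)) < B' * nb ^ 2 := by
    have a0 : 0 ≤ F.α t * (9 * (Real.exp (-(4 * θ)) + 9 * g ^ 4) * B₁ + 2 * ν * B₂) := by
      positivity
    have a1 : 2 * F.lam p * (F.α t * (9 * (Real.exp (-(4 * θ)) + 9 * g ^ 4) * B₁ + 2 * ν * B₂)) <
        B' := lt_of_le_of_lt (mul_le_mul_of_nonneg_right (by linarith [hr.lam_le p]) a0) hB'
    nlinarith
  have h7 : F.α t * (-(B₁ * c) + F.ρ t * (F.nA t / F.nB t - F.nB t / F.nA t) * na ^ 2 +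
      g ^ 4 * B₁ * nb ^ 2) ≤ F.α t * ((9 * (Real.exp (-(4 * θ)) + 9 * g ^ 4) * B₁ + 2 * ν * B₂) *
      nb ^ 2) := by
    refine mul_le_mul_of_nonneg_left ?_ hα.le
    have hE := Real.exp_pos (-(4 * θ))
    have : 0 ≤ g ^ 4 * B₁ * nb ^ 2 := by positivity
    have : 0 ≤ Real.exp (-(4 * θ)) * B₁ * nb ^ 2 := by positivity
    linarith only [this, ‹0 ≤ g ^ 4 * B₁ * nb ^ 2›, h4, h5]
  have h8 := mul_le_mul_of_nonneg_left h7 (by linarith : 0 ≤ 2 * F.lam p)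
  have h9 := mul_le_mul_of_nonneg_left h3 (by linarith : 0 ≤ 2 * F.lam p)
  have h10 := mul_le_mul_of_nonneg_left h2 (by linarith : 0 ≤ 1 + B₁)
  have e : F.lam p * (F.α t * F.ρ t * (F.nA t / F.nB t)) * na ^ 2 =
    F.lam p * (F.α t * F.ρ t * (F.nA t / F.nB t)) * ((1 + B₁) * nb ^ 2) := by rw [heq]
  linarith only [h1, h6, h8, h9, h10, e]

/-- When the bound `‖x‖² ≤ (1 + B₂) ‖y‖²` is attained, it is about to improve. -/
theorem noise_touch (ht : 0 ≤ t) (q : Q) (heq : ‖F.x q t‖ ^ 2 = (1 + B₂) * ‖F.y q t‖ ^ 2)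
    (hy : 0 < ‖F.y q t‖)
    (hB' : 2 * F.lamx * (F.α t * F.ρ t) * B₁ +
      2 * κ * (F.α t * (5 * (Real.exp (-(4 * θ)) + 9 * g ^ 4) * B₁ + 4 * ν * B₂)) < B') :
    2 * inner ℝ (F.x q t) (F.x' q t) -
      (B' * ‖F.y q t‖ ^ 2 + (1 + B₂) * (2 * inner ℝ (F.y q t) (F.y' q t))) < 0 := by
  have hA : 0 < F.nA t := by linarith [hc.nA_ge]
  have hB : 0 < F.nB t := by linarith [hc.nB_ge]
  have hα := α_pos hr hc
  have hg := hr.g_pos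
  have hg8 := hr.g8_le
  have hz := hr.g4_le
  have hz0 : 0 < g ^ 4 := by positivity
  have hlam := hr.one_le_lamx
  have hB₁0 : 0 < B₁ := lt_of_lt_of_le (by positivity) hB₁
  set nx := ‖F.x q t‖
  set ny := ‖F.y q t‖
  have h1 := (abs_le.1 (abs_inner_noise_le (hr.perturbed.err_x q t ht hA hB))).2
  have h2 := (abs_le.1 (abs_inner_noise_le (hr.perturbed.err_y q t ht hA hB))).1
  have hrat1 : F.nB t / F.nA t ≤ 2 := by
    have := (abs_le.1 (abs_ratio_sub_one_le hc hr.g_pos hr.g_le)).2; linarith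
  have hrat2 : F.nA t / F.nB t ≤ 2 := by
    have h := (abs_le.1 (abs_ratio_sub_one_le hc.swap hr.g_pos hr.g_le)).2
    rw [swap_nA, swap_nB] at h
    linarith
  have hnx : nx ^ 2 ≤ 2 * ny ^ 2 := by nlinarith [sq_nonneg ny]
  have h3 : g ^ 18 * F.α t * (F.nB t / F.nA t) * nx ^ 2 +
      (1 + B₂) * (g ^ 18 * F.α t * (F.nA t / F.nB t) * ny ^ 2) ≤ F.α t * (g ^ 4 * B₁ * ny ^ 2) := by
    have a1 : (F.nB t / F.nA t) * nx ^ 2 ≤ 2 * (2 * ny ^ 2) :=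
      mul_le_mul hrat1 hnx (sq_nonneg _) (by norm_num)
    have a2 : (1 + B₂) * ((F.nA t / F.nB t) * ny ^ 2) ≤ 2 * (2 * ny ^ 2) :=
      mul_le_mul (by linarith) (mul_le_mul_of_nonneg_right hrat2 (sq_nonneg _)) (by positivity)
        (by norm_num)
    have a3 : g ^ 18 * 8 ≤ g ^ 4 * B₁ := by
      calc g ^ 18 * 8 = g ^ 4 * (g ^ 12 * (8 * g * g)) := by ring
        _ ≤ g ^ 4 * (g ^ 12 * 1) := by have := hr.g_le; gcongr; nlinarith
        _ ≤ _ := by rw [mul_one]; gcongr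
    have a4 := mul_le_mul_of_nonneg_left (add_le_add a1 a2) (by positivity : 0 ≤ g ^ 18 * F.α t)
    have a5 := mul_le_mul_of_nonneg_right a3 (by positivity : 0 ≤ F.α t * ny ^ 2)
    linarith only [a4, a5]
  -- the imbalance of the total norms; `ρ` may be slightly negative
  have h4 : F.ρ t * (F.nA t / F.nB t - F.nB t / F.nA t) * nx ^ 2 ≤
      (F.ρ t * B₁ + 37 * g ^ 4 * B₁ + 4 * ν * B₂) * ny ^ 2 := by
    have hρ := ρ_ge_neg hr ha hc
    have hρ1 := (abs_le.1 (F.abs_ρ_le t)).2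
    have a0 : |F.ρ t| ≤ F.ρ t + 36 * g ^ 4 := by
      rw [abs_le]; constructor <;> linarith
    have a1 : F.ρ t * (F.nA t / F.nB t - F.nB t / F.nA t) ≤
        (F.ρ t + 36 * g ^ 4) * ((1 + g ^ 8) * B₁ + ν * B₂) := by
      refine (le_abs_self _).trans ?_
      rw [abs_mul]
      exact mul_le_mul a0 himb (abs_nonneg _) (by linarith)
    rw [heq, ← mul_assoc]
    refine mul_le_mul_of_nonneg_right ?_ (sq_nonneg ny)
    have a2 := mul_le_mul_of_nonneg_right a1 (by linarith : 0 ≤ 1 + B₂)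
    refine a2.trans ?_
    have a3 : 0 ≤ ν * B₂ := mul_nonneg hν hB₂
    have a4 := imbalance_mul_le hB₁0.le a3 hB₂ hB₂' hg8 hz
    have a5 : (F.ρ t + 36 * g ^ 4) * (((1 + g ^ 8) * B₁ + ν * B₂) * (1 + B₂)) ≤
      (F.ρ t + 36 * g ^ 4) * (B₁ + g ^ 4 / 100 * B₁ + 3 / 2 * (ν * B₂)) :=
      mul_le_mul_of_nonneg_left a4 (by linarith)
    have a6 : (F.ρ t + 36 * g ^ 4) * (g ^ 4 / 100 * B₁ + 3 / 2 * (ν * B₂)) ≤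
        2 * (g ^ 4 / 100 * B₁ + 3 / 2 * (ν * B₂)) :=
      mul_le_mul_of_nonneg_right (by linarith) (by positivity)
    have a7 : 0 ≤ g ^ 4 * B₁ := by positivity
    linarith only [a3, a5, a6, a7]
  have hny2 : 0 < ny ^ 2 := by positivity
  have h6 : (2 * F.lamx * (F.α t * F.ρ t) * B₁ + 2 * F.lamx * (F.α t *
      (5 * (Real.exp (-(4 * θ)) + 9 * g ^ 4) * B₁ + 4 * ν * B₂))) * ny ^ 2 < B' * ny ^ 2 := by
    have a0 : 0 ≤ F.α t * (5 * (Real.exp (-(4 * θ)) + 9 * g ^ 4) * B₁ + 4 * ν * B₂) := by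
      positivity
    refine mul_lt_mul_of_pos_right (lt_of_le_of_lt ?_ hB') hny2
    have := mul_le_mul_of_nonneg_right (by linarith [hr.lamx_le] : 2 * F.lamx ≤ 2 * κ) a0
    linarith
  have h7 : F.α t * (F.ρ t * (F.nA t / F.nB t - F.nB t / F.nA t) * nx ^ 2 +
      g ^ 4 * B₁ * ny ^ 2) ≤ F.α t * ((F.ρ t * B₁ + (5 * (Real.exp (-(4 * θ)) + 9 * g ^ 4) * B₁ +
      4 * ν * B₂)) * ny ^ 2) := by
    refine mul_le_mul_of_nonneg_left ?_ hα.le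
    have hE := Real.exp_pos (-(4 * θ))
    have : 0 ≤ g ^ 4 * B₁ * ny ^ 2 := by positivity
    have : 0 ≤ Real.exp (-(4 * θ)) * B₁ * ny ^ 2 := by positivity
    linarith only [this, ‹0 ≤ g ^ 4 * B₁ * ny ^ 2›, h4]
  have h8 := mul_le_mul_of_nonneg_left h7 (by linarith : 0 ≤ 2 * F.lamx)
  have h9 := mul_le_mul_of_nonneg_left h3 (by linarith : 0 ≤ 2 * F.lamx)
  have h10 := mul_le_mul_of_nonneg_left h2 (by linarith : 0 ≤ 1 + B₂)
  have e : F.lamx * (F.α t * F.ρ t * (F.nA t / F.nB t)) * nx ^ 2 =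
    F.lamx * (F.α t * F.ρ t * (F.nA t / F.nB t)) * ((1 + B₂) * ny ^ 2) := by rw [heq]
  linarith only [h1, h6, h8, h9, h10, e]

end Touch

end Flow

namespace Flow

variable {P Q E : Type*} [Fintype P] [Fintype Q] [NormedAddCommGroup E] [InnerProductSpace ℝ E]
  {F : Flow P Q E} {κ M H g Tend : ℝ}

/-! ### Tolerances for the imbalance -/

/-- The tolerated imbalance of the signal columns. It grows with the potential, whose growth
dominates everything that drives the imbalance, and stays bounded because the potential does. -/
def signalTol (F : Flow P Q E) (κ M g θ w : ℝ) : ℝ :=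
  g ^ 12 * Real.exp (64 * κ * M * F.potential g θ w)

/-- The tolerated imbalance of the noise columns; it grows linearly in the decay exponent of the
noise relative to that of the signal columns. -/
def noiseTol (F : Flow P Q E) (κ M g θ w : ℝ) : ℝ :=
  (2 + 2 * (F.lamx * w)) * F.signalTol κ M g θ w

theorem sq_imbalance_neg {n n' l B ε : ℝ} (hn : |n - l| ≤ ε) (hn' : |n' - l| ≤ ε)
    (hl : 1 ≤ l) (hB : 0 ≤ B) (hε : 6 * ε ≤ B) (hε' : 0 < ε) (hε1 : ε ≤ 1 / 2) :
    n - (1 + B) * n' < 0 := by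
  have h1 := (abs_le.1 hn).2
  have h2 := (abs_le.1 hn').1
  nlinarith

section Clocks

variable {T : ℝ} {θ w : ℝ → ℝ} (hr : F.Regime κ M H g Tend) (hk : F.Clocks g T θ w)
  (hc : ∀ t ∈ Icc 0 T, F.Controlled H g t)
include hr hk hc

/-- The potential is bounded, so the tolerances stay below the a priori bound `g ^ 8`. The signal
tolerance also stays above the errors of the gradient, which are of order `g ^ 17` at most. -/
theorem tol_bounds {t : ℝ} (ht : t ∈ Icc 0 T) :
    g ^ 12 ≤ F.signalTol κ M g (θ t) (w t) ∧ F.signalTol κ M g (θ t) (w t) ≤ g ^ 8 ∧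
      0 ≤ F.noiseTol κ M g (θ t) (w t) ∧ F.noiseTol κ M g (θ t) (w t) ≤ g ^ 8 := by
  obtain ⟨h0, h4⟩ := potential_nonneg_le hr hk hc ht
  have hg := hr.g_pos
  have hκ := hr.one_le_κ
  have hM := hr.one_le_M
  have ha := hk.approx t ht
  have hX := neg_half_le_lamx_mul_w hr hk hc ht
  have h1 : g ^ 12 ≤ F.signalTol κ M g (θ t) (w t) :=
    le_mul_of_one_le_right (by positivity) (Real.one_le_exp (by positivity))
  have h2 : F.signalTol κ M g (θ t) (w t) ≤ g ^ 11 := by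
    have : Real.exp (64 * κ * M * F.potential g (θ t) (w t)) ≤ Real.exp (256 * κ * M) := by
      refine Real.exp_le_exp.2 ?_
      nlinarith [mul_pos (by linarith : 0 < κ) (by linarith : 0 < M)]
    calc _ ≤ g ^ 12 * Real.exp (256 * κ * M) := mul_le_mul_of_nonneg_left this (by positivity)
      _ = g ^ 11 * (Real.exp (256 * κ * M) * g) := by ring
      _ ≤ _ := mul_le_of_le_one_right (by positivity) hr.exp_le
  have h3 : (2 + 2 * (F.lamx * w t)) * g ^ 2 ≤ 3 := by
    have hwθ : w t ≤ θ t := by linarith [ha.u_nonneg]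
    have a1 : F.lamx * w t ≤ κ * θ t := by
      calc F.lamx * w t ≤ F.lamx * θ t :=
            mul_le_mul_of_nonneg_left hwθ (by linarith [hr.one_le_lamx])
        _ ≤ _ := mul_le_mul_of_nonneg_right hr.lamx_le ha.θ_nonneg
    have a2 : κ * g * (θ t * g) ≤ 1 :=
      mul_le_one₀ hr.κ_le (mul_nonneg ha.θ_nonneg hg.le) ha.θ_le
    have a3 := mul_le_mul_of_nonneg_right a1 (sq_nonneg g)
    nlinarith [hr.g_le]
  have h5 : 0 < F.signalTol κ M g (θ t) (w t) := lt_of_lt_of_le (by positivity) h1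
  refine ⟨h1, h2.trans (hr.pow_le 11 8 (by norm_num)), mul_nonneg (by linarith) h5.le, ?_⟩
  calc F.noiseTol κ M g (θ t) (w t) ≤ (2 + 2 * (F.lamx * w t)) * g ^ 11 :=
        mul_le_mul_of_nonneg_left h2 (by linarith)
    _ = ((2 + 2 * (F.lamx * w t)) * g ^ 2) * g * g ^ 8 := by ring
    _ ≤ 1 * g ^ 8 := by
        refine mul_le_mul_of_nonneg_right ?_ (by positivity)
        nlinarith [hr.g_le]
    _ = g ^ 8 := one_mul _

/-- The noise share, weighted by the noise tolerance, is integrable against the clock: the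
exponential decay of the noise beats the linear growth of the tolerance. -/
theorem share_mul_noiseTol_le {t : ℝ} (ht : t ∈ Icc 0 T) :
    F.α t * ((4 * M * ((∑ p, F.S (θ t - w t) p) / (F.nA t * F.nB t)) *
      Real.exp (-(F.lamx * w t)) ^ 2) * F.noiseTol κ M g (θ t) (w t)) ≤
    8 * M * (F.potentialRate g (θ t) (w t) t -
      2 * (F.α t * (Real.exp (-(4 * θ t)) + 9 * g ^ 4))) * F.signalTol κ M g (θ t) (w t) := by
  have h1 := potentialRate_ge hr hk hc ht
  have h2 := signal_share_pos hr hk hc ht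
  have hM := hr.one_le_M
  have hB : 0 < F.signalTol κ M g (θ t) (w t) :=
    lt_of_lt_of_le (by have := hr.g_pos; positivity) (tol_bounds hr hk hc ht).1
  have h3 : Real.exp (-(F.lamx * w t)) * (2 + 2 * (F.lamx * w t)) ≤ 2 := by
    have a1 := Real.add_one_le_exp (F.lamx * w t)
    have a2 : Real.exp (-(F.lamx * w t)) * Real.exp (F.lamx * w t) = 1 := by
      rw [← Real.exp_add]; simp
    nlinarith [Real.exp_pos (-(F.lamx * w t))]
  unfold noiseTol
  set f := Real.exp (-(F.lamx * w t))
  set σ := (∑ p, F.S (θ t - w t) p) / (F.nA t * F.nB t)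
  set B := F.signalTol κ M g (θ t) (w t)
  have e : F.α t * ((4 * M * σ * f ^ 2) * ((2 + 2 * (F.lamx * w t)) * B)) =
      (f * (2 + 2 * (F.lamx * w t))) * (4 * M * (f * (F.α t * σ)) * B) := by ring
  rw [e]
  have h4 : 0 ≤ 4 * M * (f * (F.α t * σ)) * B := by positivity
  calc _ ≤ 2 * (4 * M * (f * (F.α t * σ)) * B) := mul_le_mul_of_nonneg_right h3 h4
    _ = 8 * M * (f * (F.α t * σ)) * B := by ring
    _ ≤ _ := by
      have : f * (F.α t * σ) ≤ F.potentialRate g (θ t) (w t) t -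
        2 * (F.α t * (Real.exp (-(4 * θ t)) + 9 * g ^ 4)) := by linarith
      gcongr

/-- The signal tolerance grows fast enough for `signal_touch`. -/
theorem signal_rate {t : ℝ} (ht : t ∈ Icc 0 T) :
    2 * κ * (F.α t * (9 * (Real.exp (-(4 * θ t)) + 9 * g ^ 4) * F.signalTol κ M g (θ t) (w t) +
      2 * (4 * M * ((∑ p, F.S (θ t - w t) p) / (F.nA t * F.nB t)) *
      Real.exp (-(F.lamx * w t)) ^ 2) * F.noiseTol κ M g (θ t) (w t))) <
    F.signalTol κ M g (θ t) (w t) * (64 * κ * M * F.potentialRate g (θ t) (w t) t) := by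
  have h1 := share_mul_noiseTol_le hr hk hc ht
  have hκ := hr.one_le_κ
  have hM := hr.one_le_M
  have hY := misalignment_pos hr hk hc ht
  have hr1 := potentialRate_ge hr hk hc ht
  have hs := signal_share_pos hr hk hc ht
  have hB : 0 < F.signalTol κ M g (θ t) (w t) :=
    lt_of_lt_of_le (by have := hr.g_pos; positivity) (tol_bounds hr hk hc ht).1
  set B := F.signalTol κ M g (θ t) (w t)
  set Φ' := F.potentialRate g (θ t) (w t) t
  set Y := F.α t * (Real.exp (-(4 * θ t)) + 9 * g ^ 4)
  have h2 := mul_le_mul_of_nonneg_left h1 (by linarith : 0 ≤ 4 * κ)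
  have hΦ : 2 * Y ≤ Φ' := by linarith
  have h3 : 18 * Y < 32 * M * Φ' + 64 * M * Y := by nlinarith
  have h4 := mul_lt_mul_of_pos_left h3 (by positivity : 0 < κ * B)
  have e : 2 * κ * (F.α t * (9 * (Real.exp (-(4 * θ t)) + 9 * g ^ 4) * B +
      2 * (4 * M * ((∑ p, F.S (θ t - w t) p) / (F.nA t * F.nB t)) *
      Real.exp (-(F.lamx * w t)) ^ 2) * F.noiseTol κ M g (θ t) (w t))) = 18 * κ * Y * B + 4 * κ *
      (F.α t * ((4 * M * ((∑ p, F.S (θ t - w t) p) / (F.nA t * F.nB t)) *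
      Real.exp (-(F.lamx * w t)) ^ 2) * F.noiseTol κ M g (θ t) (w t))) := by simp only [Y]; ring
  rw [e]
  linarith

/-- The noise tolerance grows fast enough for `noise_touch`: its linear factor accounts for the
effect of the signal imbalance on the noise columns. -/
theorem noise_rate {t : ℝ} (ht : t ∈ Icc 0 T) :
    2 * F.lamx * (F.α t * F.ρ t) * F.signalTol κ M g (θ t) (w t) +
    2 * κ * (F.α t * (5 * (Real.exp (-(4 * θ t)) + 9 * g ^ 4) * F.signalTol κ M g (θ t) (w t) +
      4 * (4 * M * ((∑ p, F.S (θ t - w t) p) / (F.nA t * F.nB t)) *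
      Real.exp (-(F.lamx * w t)) ^ 2) * F.noiseTol κ M g (θ t) (w t))) <
    2 * (F.lamx * (F.α t * F.ρ t)) * F.signalTol κ M g (θ t) (w t) + (2 + 2 * (F.lamx * w t)) *
      (F.signalTol κ M g (θ t) (w t) * (64 * κ * M * F.potentialRate g (θ t) (w t) t)) := by
  have h1 := share_mul_noiseTol_le hr hk hc ht
  have hκ := hr.one_le_κ
  have hM := hr.one_le_M
  have hY := misalignment_pos hr hk hc ht
  have hr1 := potentialRate_ge hr hk hc ht
  have hs := signal_share_pos hr hk hc ht
  have hX := neg_half_le_lamx_mul_w hr hk hc ht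
  have hB : 0 < F.signalTol κ M g (θ t) (w t) :=
    lt_of_lt_of_le (by have := hr.g_pos; positivity) (tol_bounds hr hk hc ht).1
  set B := F.signalTol κ M g (θ t) (w t)
  set Φ' := F.potentialRate g (θ t) (w t) t
  set Y := F.α t * (Real.exp (-(4 * θ t)) + 9 * g ^ 4)
  have h2 := mul_le_mul_of_nonneg_left h1 (by linarith : 0 ≤ 8 * κ)
  have hΦ : 2 * Y ≤ Φ' := by linarith
  have h3 : 10 * Y < 128 * M * Y := by nlinarith
  have h4 := mul_lt_mul_of_pos_left h3 (by positivity : 0 < κ * B)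
  have h5 : B * (64 * κ * M * Φ') ≤ (2 + 2 * (F.lamx * w t)) * (B * (64 * κ * M * Φ')) :=
    le_mul_of_one_le_left
      (mul_nonneg hB.le (mul_nonneg (by positivity) (by linarith : 0 ≤ Φ'))) (by linarith)
  have e : 2 * κ * (F.α t * (5 * (Real.exp (-(4 * θ t)) + 9 * g ^ 4) * B +
      4 * (4 * M * ((∑ p, F.S (θ t - w t) p) / (F.nA t * F.nB t)) *
      Real.exp (-(F.lamx * w t)) ^ 2) * F.noiseTol κ M g (θ t) (w t))) = 10 * κ * Y * B + 8 * κ *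
      (F.α t * ((4 * M * ((∑ p, F.S (θ t - w t) p) / (F.nA t * F.nB t)) *
      Real.exp (-(F.lamx * w t)) ^ 2) * F.noiseTol κ M g (θ t) (w t))) := by simp only [Y]; ring
  rw [e]
  linarith

end Clocks

/-- The excess of the squared norms of the `A` columns over the tolerated multiple of those of the
`B` columns. -/
def excess (F : Flow P Q E) (B₁ B₂ : ℝ → ℝ) : P ⊕ Q → ℝ → ℝ
  | .inl p, t => ‖F.a p t‖ ^ 2 - (1 + B₁ t) * ‖F.b p t‖ ^ 2
  | .inr q, t => ‖F.x q t‖ ^ 2 - (1 + B₂ t) * ‖F.y q t‖ ^ 2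

/-- The time derivative of `excess`. -/
def excessDeriv (F : Flow P Q E) (B₁ B₁' B₂ B₂' : ℝ → ℝ) : P ⊕ Q → ℝ → ℝ
  | .inl p, t => 2 * inner ℝ (F.a p t) (F.a' p t) -
      (B₁' t * ‖F.b p t‖ ^ 2 + (1 + B₁ t) * (2 * inner ℝ (F.b p t) (F.b' p t)))
  | .inr q, t => 2 * inner ℝ (F.x q t) (F.x' q t) -
      (B₂' t * ‖F.y q t‖ ^ 2 + (1 + B₂ t) * (2 * inner ℝ (F.y q t) (F.y' q t)))

theorem hasDerivAt_excess {ε : ℝ} (hp : F.IsPerturbed ε) {B₁ B₁' B₂ B₂' : ℝ → ℝ} {t : ℝ}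
    (ht : 0 < t) (h₁ : HasDerivAt B₁ (B₁' t) t) (h₂ : HasDerivAt B₂ (B₂' t) t) (i : P ⊕ Q) :
    HasDerivAt (F.excess B₁ B₂ i) (F.excessDeriv B₁ B₁' B₂ B₂' i t) t := by
  have hn := Ici_mem_nhds ht
  rcases i with p | q
  · exact ((hp.hasDeriv_a p t ht.le).hasDerivAt hn).norm_sq.sub
      ((h₁.const_add 1).mul ((hp.hasDeriv_b p t ht.le).hasDerivAt hn).norm_sq)
  · exact ((hp.hasDeriv_x q t ht.le).hasDerivAt hn).norm_sq.sub
      ((h₂.const_add 1).mul ((hp.hasDeriv_y q t ht.le).hasDerivAt hn).norm_sq)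

theorem continuousOn_excess {ε b : ℝ} (hp : F.IsPerturbed ε) {B₁ B₂ : ℝ → ℝ}
    (h₁ : ContinuousOn B₁ (Icc 0 b)) (h₂ : ContinuousOn B₂ (Icc 0 b)) (i : P ⊕ Q) :
    ContinuousOn (F.excess B₁ B₂ i) (Icc 0 b) := by
  have hc : ∀ {f f' : ℝ → E}, (∀ t, 0 ≤ t → HasDerivWithinAt f (f' t) (Ici 0) t) →
      ContinuousOn (fun t => ‖f t‖ ^ 2) (Icc 0 b) := fun h => (ContinuousOn.norm fun t ht =>
    (h t ht.1).continuousWithinAt.mono Icc_subset_Ici_self).pow 2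
  rcases i with p | q
  · exact (hc (hp.hasDeriv_a p)).sub ((continuousOn_const.add h₁).mul (hc (hp.hasDeriv_b p)))
  · exact (hc (hp.hasDeriv_x q)).sub ((continuousOn_const.add h₂).mul (hc (hp.hasDeriv_y q)))

/-- Up to a constant, the noise columns decay no faster than predicted; in particular they never
vanish. -/
theorem norm_y_ge (hr : F.Regime κ M H g Tend) {θ w t : ℝ} (ha : F.Approx g θ w t) (q : Q) :
    Real.exp (-(F.lamx * w)) / 4 ≤ ‖F.y q t‖ := by
  have h1 := (abs_le.1 (hr.initial.norm_y q)).1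
  have h2 := ha.y q
  have h3 := hr.g18_le
  have hz := hr.g4_le
  have hl := hr.one_le_lamx
  set f := Real.exp (-(F.lamx * w))
  have hf0 : 0 < f := Real.exp_pos _
  have h4 : 1 / 2 ≤ ‖F.y q 0‖ := le_of_sq_le_sq (by linarith) (norm_nonneg _)
  have := norm_sub_norm_le (f • F.y q 0) (F.y q t)
  rw [norm_smul, Real.norm_eq_abs, abs_of_pos hf0, norm_sub_rev] at this
  have h5 : f * (1 / 4) ≤ f * ((1 - g ^ 4) * ‖F.y q 0‖) := by
    refine mul_le_mul_of_nonneg_left ?_ hf0.le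
    nlinarith
  linarith

/-- The imbalance stays within the tolerances: where one of them is attained while the others hold,
the excess is decreasing. -/
theorem excess_neg {T : ℝ} {θ w : ℝ → ℝ} (hr : F.Regime κ M H g Tend) (hk : F.Clocks g T θ w)
    (hc : ∀ t ∈ Icc 0 T, F.Controlled H g t) :
    ∀ t ∈ Icc 0 T, ∀ i : Bool × (P ⊕ Q), (if i.1 then F else F.swap).excess
      (fun t => F.signalTol κ M g (θ t) (w t)) (fun t => F.noiseTol κ M g (θ t) (w t)) i.2 t < 0 := by
  set B₁ := fun t => F.signalTol κ M g (θ t) (w t) with hB₁def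
  set B₂ := fun t => F.noiseTol κ M g (θ t) (w t) with hB₂def
  set B₁' := fun t => B₁ t * (64 * κ * M * F.potentialRate g (θ t) (w t) t) with hB₁'
  set B₂' := fun t => 2 * (F.lamx * (F.α t * F.ρ t)) * B₁ t + (2 + 2 * (F.lamx * w t)) * B₁' t
    with hB₂'
  have hd₁ : ∀ t ∈ Icc 0 T, HasDerivAt B₁ (B₁' t) t := fun t ht => by
    refine (((hasDerivAt_potential hr hk ht).const_mul (64 * κ * M)).exp.const_mul
      (g ^ 12)).congr_deriv ?_
    simp only [hB₁', hB₁def, signalTol]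
    ring
  have hd₂ : ∀ t ∈ Icc 0 T, HasDerivAt B₂ (B₂' t) t := fun t ht =>
    ((((hk.hasDeriv_w t ht).const_mul F.lamx).const_mul 2).const_add 2).mul (hd₁ t ht)
  have hg := hr.g_pos
  have hp : ∀ b : Bool, (if b then F else F.swap).IsPerturbed (g ^ 18) := by
    intro b; cases b
    · exact hr.swap.perturbed
    · exact hr.perturbed
  refine finite_max_principle
    (f' := fun i => (if i.1 then F else F.swap).excessDeriv B₁ B₁' B₂ B₂' i.2)
    (fun i => continuousOn_excess (hp i.1)
      (fun t ht => (hd₁ t ht).continuousAt.continuousWithinAt)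
      (fun t ht => (hd₂ t ht).continuousAt.continuousWithinAt) i.2)
    (fun i t ht => hasDerivAt_excess (hp i.1) ht.1 (hd₁ t ⟨ht.1.le, ht.2⟩)
      (hd₂ t ⟨ht.1.le, ht.2⟩) i.2) ?_ ?_
  · have hB0 : B₁ 0 = g ^ 12 := by
      simp [hB₁def, signalTol, potential, hk.θ_zero, hk.w_zero]
    have hB0' : B₂ 0 = 2 * g ^ 12 := by
      simp [hB₂def, noiseTol, signalTol, potential, hk.θ_zero, hk.w_zero]
    have h18 : 6 * g ^ 18 ≤ g ^ 12 := by
      have e : 6 * g ^ 18 = g ^ 12 * (6 * g ^ 6) := by ring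
      rw [e]
      refine mul_le_of_le_one_right (by positivity) ?_
      have := hr.pow_le 6 1 (by norm_num)
      have := hr.g_le
      linarith
    have h18' : g ^ 18 ≤ 1 / 2 := by linarith [hr.g18_le, hr.g4_le]
    have init : ∀ F' : Flow P Q E, F'.Regime κ M H g Tend → ∀ i, F'.excess B₁ B₂ i 0 < 0 := by
      intro F' hr' i
      rcases i with p | q
      · refine sq_imbalance_neg (hr'.initial.norm_a p) (hr'.initial.norm_b p) (hr'.one_le_lam p)
          ?_ ?_ (by positivity) h18'
        · rw [hB0]; positivity
        · rw [hB0]; exact h18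
      · refine sq_imbalance_neg (hr'.initial.norm_x q) (hr'.initial.norm_y q) hr'.one_le_lamx
          ?_ ?_ (by positivity) h18'
        · rw [hB0']; positivity
        · rw [hB0']; linarith [show 0 < g ^ 12 by positivity]
    rintro ⟨b, i⟩
    cases b
    · exact init F.swap hr.swap i
    · exact init F hr i
  · rintro ⟨b, i⟩ t ht' hle heq
    have ht : t ∈ Icc 0 T := ⟨ht'.1.le, ht'.2⟩
    have hct := hc t ht
    have hat := hk.approx t ht
    obtain ⟨hb1, hb2, hb3, hb4⟩ := tol_bounds hr hk hc ht
    have hrate₁ := signal_rate hr hk hc ht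
    have hrate₂ := noise_rate hr hk hc ht
    set ν := 4 * M * ((∑ p, F.S (θ t - w t) p) / (F.nA t * F.nB t)) *
      Real.exp (-(F.lamx * w t)) ^ 2 with hν
    have hn := nAnB_pos hr hat hct
    have hν0 : 0 ≤ ν := by
      have := hr.sum_S_pos hat.u_nonneg
      have := hr.one_le_M
      positivity
    have hνe : 4 * M * (∑ p, F.S (θ t - w t) p) * Real.exp (-(F.lamx * w t)) ^ 2 =
        ν * (F.nA t * F.nB t) := by
      have := div_mul_cancel₀ (∑ p, F.S (θ t - w t) p) hn.ne'
      rw [hν]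
      linear_combination (-(4 * M * Real.exp (-(F.lamx * w t)) ^ 2)) * this
    have hνx := (sum_x_sq_le hr hat).trans_eq hνe
    have hνy : ∑ q, ‖F.y q t‖ ^ 2 ≤ ν * (F.nA t * F.nB t) :=
      (sum_x_sq_le hr.swap hat.swap).trans_eq hνe
    have hab : ∀ p, ‖F.a p t‖ ^ 2 ≤ (1 + B₁ t) * ‖F.b p t‖ ^ 2 := fun p =>
      sub_nonpos.1 (hle (true, .inl p))
    have hba : ∀ p, ‖F.b p t‖ ^ 2 ≤ (1 + B₁ t) * ‖F.a p t‖ ^ 2 := fun p =>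
      sub_nonpos.1 (hle (false, .inl p))
    have hxy : ∀ q, ‖F.x q t‖ ^ 2 ≤ (1 + B₂ t) * ‖F.y q t‖ ^ 2 := fun q =>
      sub_nonpos.1 (hle (true, .inr q))
    have hyx : ∀ q, ‖F.y q t‖ ^ 2 ≤ (1 + B₂ t) * ‖F.x q t‖ ^ 2 := fun q =>
      sub_nonpos.1 (hle (false, .inr q))
    have himb := abs_imbalance_le hr hct (lt_of_lt_of_le (by positivity) hb1).le hb3 hνx hνy
      hab hba hxy hyx
    have himb' : |F.swap.nA t / F.swap.nB t - F.swap.nB t / F.swap.nA t| ≤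
        (1 + g ^ 8) * B₁ t + ν * B₂ t := by
      rw [swap_nA, swap_nB, abs_sub_comm]; exact himb
    have hf0 := Real.exp_pos (-(F.lamx * w t))
    cases b
    · rcases i with p | q
      · exact signal_touch hr.swap hct.swap hat.swap hb1 hb2 hb3 hb4 hν0 himb' ht.1 p
          (sub_eq_zero.1 heq) (by rw [swap_α]; exact hrate₁)
      · refine noise_touch hr.swap hct.swap hat.swap hb1 hb2 hb3 hb4 hν0 himb' ht.1 q
          (sub_eq_zero.1 heq) ?_ (by rw [swap_α, swap_ρ]; exact hrate₂)
        exact lt_of_lt_of_le (by positivity) (norm_y_ge hr.swap hat.swap q)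
    · rcases i with p | q
      · exact signal_touch hr hct hat hb1 hb2 hb3 hb4 hν0 himb ht.1 p (sub_eq_zero.1 heq) hrate₁
      · refine noise_touch hr hct hat hb1 hb2 hb3 hb4 hν0 himb ht.1 q (sub_eq_zero.1 heq) ?_ hrate₂
        exact lt_of_lt_of_le (by positivity) (norm_y_ge hr hat q)

/-! ### The a priori control never fails -/

/-- The functions whose negativity for `F` and `F.swap` is the strict a priori control. -/
def defect (F : Flow P Q E) (H g : ℝ) : Option (Option (P ⊕ Q)) → ℝ → ℝ
  | none, t => 1 / 4 - F.nA t
  | some none, t => F.nA t - H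
  | some (some i), t => F.excess (fun _ => g ^ 8) (fun _ => g ^ 8) i t

theorem controlled_of_defect_nonpos {t : ℝ}
    (h : ∀ i : Bool × Option (Option (P ⊕ Q)), (if i.1 then F else F.swap).defect H g i.2 t ≤ 0) :
    F.Controlled H g t where
  nA_ge := sub_nonpos.1 (h (true, none))
  nB_ge := sub_nonpos.1 (h (false, none))
  nA_le := sub_nonpos.1 (h (true, some none))
  nB_le := sub_nonpos.1 (h (false, some none))
  ab p := sub_nonpos.1 (h (true, some (some (.inl p))))
  ba p := sub_nonpos.1 (h (false, some (some (.inl p))))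
  xy q := sub_nonpos.1 (h (true, some (some (.inr q))))
  yx q := sub_nonpos.1 (h (false, some (some (.inr q))))

theorem defect_neg_zero (hr : F.Regime κ M H g Tend) (i : Option (Option (P ⊕ Q))) :
    F.defect H g i 0 < 0 := by
  have hg := hr.g_pos
  have h18 := hr.g18_le
  have h4 := hr.g4_le
  have h8 : 6 * g ^ 18 ≤ g ^ 8 := by
    have e : 6 * g ^ 18 = g ^ 8 * (6 * g ^ 10) := by ring
    rw [e]
    refine mul_le_of_le_one_right (by positivity) ?_
    have := hr.pow_le 10 1 (by norm_num)
    have := hr.g_le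
    linarith
  have hP := hr.one_le_card
  rcases i with _ | _ | p | q
  · refine sub_neg.2 (lt_of_pow_lt_pow_left₀ 2 (Real.sqrt_nonneg _) ?_)
    rw [nA_sq]
    have := Finset.card_nsmul_le_sum Finset.univ (fun p => ‖F.a p 0‖ ^ 2) (1 / 2) (fun p _ => by
      linarith [(abs_le.1 (hr.initial.norm_a p)).1, hr.one_le_lam p])
    rw [nsmul_eq_mul, Finset.card_univ] at this
    have : 0 ≤ ∑ q, ‖F.x q 0‖ ^ 2 := by positivity
    linarith
  · refine sub_neg.2 (lt_of_pow_lt_pow_left₀ 2 (by linarith [hr.H_pos]) ?_)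
    rw [nA_sq]
    have h1 := Finset.sum_le_card_nsmul Finset.univ (fun p => ‖F.a p 0‖ ^ 2) (2 * κ) (fun p _ => by
      linarith [(abs_le.1 (hr.initial.norm_a p)).2, hr.lam_le p, hr.one_le_κ])
    have h2 := Finset.sum_le_card_nsmul Finset.univ (fun q => ‖F.x q 0‖ ^ 2) (2 * F.lamx)
      (fun q _ => by linarith [(abs_le.1 (hr.initial.norm_x q)).2, hr.one_le_lamx])
    rw [nsmul_eq_mul, Finset.card_univ] at h1 h2
    have h3 := hr.noise_le
    have h5 := hr.lt_H
    have hM := hr.one_le_M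
    have hκ := hr.one_le_κ
    have h6 : 1 ≤ Real.exp (112 * κ * M) := Real.one_le_exp (by positivity)
    have h7 : 20 * M * Fintype.card P * κ ≤
        20 * M * Fintype.card P * κ * Real.exp (112 * κ * M) :=
      le_mul_of_one_le_right (by positivity) h6
    have h8 : Fintype.card P * κ ≤ M * (Fintype.card P * κ) :=
      le_mul_of_one_le_left (by positivity) hM
    have h9 : M * Fintype.card P ≤ M * Fintype.card P * κ :=
      le_mul_of_one_le_right (by positivity) hκ
    have h10 : 0 < M * Fintype.card P * κ := by positivity
    linarith
  · exact sq_imbalance_neg (hr.initial.norm_a p) (hr.initial.norm_b p) (hr.one_le_lam p)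
      (by positivity) h8 (by positivity) (by linarith)
  · exact sq_imbalance_neg (hr.initial.norm_x q) (hr.initial.norm_y q) hr.one_le_lamx
      (by positivity) h8 (by positivity) (by linarith)

theorem continuousOn_defect (hr : F.Regime κ M H g Tend) {b : ℝ} (i : Option (Option (P ⊕ Q))) :
    ContinuousOn (F.defect H g i) (Icc 0 b) := by
  have h := (continuousOn_nA hr.perturbed).mono (Icc_subset_Ici_self : Icc 0 b ⊆ Ici 0)
  rcases i with _ | _ | i
  · exact continuousOn_const.sub h
  · exact h.sub continuousOn_const
  · exact continuousOn_excess hr.perturbed continuousOn_const continuousOn_const i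

/-- On the whole time horizon the a priori control holds. -/
theorem controlled (hr : F.Regime κ M H g Tend) : ∀ t ∈ Icc 0 Tend, F.Controlled H g t := by
  have key := forall_neg_of_propagates (b := Tend)
    (f := fun i : Bool × Option (Option (P ⊕ Q)) => (if i.1 then F else F.swap).defect H g i.2)
    ?_ ?_ ?_
  · exact fun t ht => controlled_of_defect_nonpos fun i => (key t ht i).le
  · rintro ⟨b, i⟩
    cases b
    · exact continuousOn_defect hr.swap i
    · exact continuousOn_defect hr i
  · rintro ⟨b, i⟩
    cases b
    · exact defect_neg_zero hr.swap i
    · exact defect_neg_zero hr i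
  · intro T hT hbefore hle
    have hc : ∀ t ∈ Icc 0 T, F.Controlled H g t := by
      intro t ht
      rcases ht.2.eq_or_lt with rfl | hlt
      · exact controlled_of_defect_nonpos hle
      · exact controlled_of_defect_nonpos fun i => (hbefore t ⟨ht.1, hlt⟩ i).le
    obtain ⟨θ, w, hk⟩ := exists_clocks hr ⟨hT.1.le, hT.2⟩ hc
    have hTm : T ∈ Icc 0 T := ⟨hT.1.le, le_rfl⟩
    have hneg := excess_neg hr hk hc T hTm
    obtain ⟨-, hb2, -, hb4⟩ := tol_bounds hr hk hc hTm
    rintro ⟨b, _ | _ | i⟩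
    · cases b
      · exact sub_neg.2 (nA_gt hr.swap hk.swap (fun t ht => (hc t ht).swap) hTm)
      · exact sub_neg.2 (nA_gt hr hk hc hTm)
    · cases b
      · exact sub_neg.2 (nA_lt hr.swap hk.swap (fun t ht => (hc t ht).swap) hTm)
      · exact sub_neg.2 (nA_lt hr hk hc hTm)
    · refine lt_of_le_of_lt ?_ (hneg (b, i))
      rcases i with p | q
      · exact sub_le_sub_left (mul_le_mul_of_nonneg_right (by linarith) (sq_nonneg _)) _
      · exact sub_le_sub_left (mul_le_mul_of_nonneg_right (by linarith) (sq_nonneg _)) _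

end Flow

namespace Flow

variable {P Q E : Type*} [Fintype P] [Fintype Q] [NormedAddCommGroup E] [InnerProductSpace ℝ E]
  {F : Flow P Q E} {κ M H g Tend : ℝ}

/-! ### Geometry of the columns along the trajectory -/

/-- Vectors close to positive multiples of nearly orthogonal vectors are nearly orthogonal. -/
theorem abs_inner_le_of_near {v z v₀ z₀ : E} {e e' ζ ε R : ℝ} (he : 0 < e) (he' : 0 < e')
    (hv : ‖v - e • v₀‖ ≤ e * ζ) (hz : ‖z - e' • z₀‖ ≤ e' * ζ) (hv' : e / 4 ≤ ‖v‖)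
    (hz' : e' / 4 ≤ ‖z‖) (h : |inner ℝ v₀ z₀| ≤ ε) (hv₀ : ‖v₀‖ ≤ R) (hz₀ : ‖z₀‖ ≤ R)
    (hζ : 0 ≤ ζ) :
    |inner ℝ v z| ≤ 16 * (ε + ζ * (2 * R + ζ)) * (‖v‖ * ‖z‖) := by
  have hR : 0 ≤ R := (norm_nonneg _).trans hv₀
  have hε : 0 ≤ ε := (abs_nonneg _).trans h
  have e1 : inner ℝ v z = inner ℝ (v - e • v₀) z + e * inner ℝ v₀ (z - e' • z₀) +
      e * e' * inner ℝ v₀ z₀ := by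
    rw [inner_sub_left, inner_sub_right, real_inner_smul_left, real_inner_smul_right]
    ring
  have hzn : ‖z‖ ≤ e' * (R + ζ) := by
    have := norm_sub_norm_le z (e' • z₀)
    rw [norm_smul, Real.norm_eq_abs, abs_of_pos he'] at this
    have := mul_le_mul_of_nonneg_left hz₀ he'.le
    linarith
  have a1 : |inner ℝ (v - e • v₀) z| ≤ (e * ζ) * (e' * (R + ζ)) :=
    (abs_real_inner_le_norm _ _).trans (mul_le_mul hv hzn (norm_nonneg _) (by positivity))
  have a2 : |e * inner ℝ v₀ (z - e' • z₀)| ≤ e * (R * (e' * ζ)) := by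
    rw [abs_mul, abs_of_pos he]
    exact mul_le_mul_of_nonneg_left
      ((abs_real_inner_le_norm _ _).trans (mul_le_mul hv₀ hz (norm_nonneg _) hR)) he.le
  have a3 : |e * e' * inner ℝ v₀ z₀| ≤ e * e' * ε := by
    rw [abs_mul, abs_of_pos (mul_pos he he')]
    exact mul_le_mul_of_nonneg_left h (mul_pos he he').le
  have a4 : |inner ℝ v z| ≤ e * e' * (ε + ζ * (2 * R + ζ)) := by
    rw [e1]
    refine (abs_add_three _ _ _).trans ?_
    linarith
  refine a4.trans ?_
  have a5 : e * e' ≤ 16 * (‖v‖ * ‖z‖) := by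
    have := mul_le_mul hv' hz' (by positivity) (norm_nonneg v)
    linarith
  have a6 := mul_le_mul_of_nonneg_right a5 (by positivity : 0 ≤ ε + ζ * (2 * R + ζ))
  linarith

/-- `v` is, up to a positive factor and a small relative error, the vector `v₀`. -/
def NearMultiple (κ g : ℝ) (v v₀ : E) : Prop :=
  ‖v₀‖ ≤ 2 * κ ∧ ∃ e : ℝ, 0 < e ∧ ‖v - e • v₀‖ ≤ e * (2 * κ * g ^ 4) ∧ e / 4 ≤ ‖v‖

theorem NearMultiple.abs_inner_le (hr : F.Regime κ M H g Tend) {v v₀ z z₀ : E}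
    (hv : NearMultiple κ g v v₀) (hz : NearMultiple κ g z z₀) (h : |inner ℝ v₀ z₀| ≤ g ^ 18) :
    |inner ℝ v z| ≤ g * (‖v‖ * ‖z‖) := by
  obtain ⟨hv0, e, he, hv1, hv2⟩ := hv
  obtain ⟨hz0, e', he', hz1, hz2⟩ := hz
  have hg := hr.g_pos
  have hκ := hr.one_le_κ
  refine (abs_inner_le_of_near he he' hv1 hz1 hv2 hz2 h hv0 hz0 (by positivity)).trans ?_
  refine mul_le_mul_of_nonneg_right ?_ (by positivity)
  have h1 : κ * g * (κ * g) ≤ 1 := mul_le_one₀ hr.κ_le (by positivity) hr.κ_le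
  have h2 : g ^ 18 ≤ g ^ 2 := hr.pow_le 18 2 (by norm_num)
  have h3 : 2 * κ * g ^ 4 * (2 * (2 * κ) + 2 * κ * g ^ 4) ≤ 12 * g ^ 2 := by
    have e1 : 2 * κ * g ^ 4 * (2 * (2 * κ) + 2 * κ * g ^ 4) =
        (κ * g * (κ * g)) * (g ^ 2 * (8 + 4 * g ^ 4)) := by ring
    rw [e1]
    have := hr.g4_le
    calc _ ≤ 1 * (g ^ 2 * (8 + 4 * g ^ 4)) := mul_le_mul_of_nonneg_right h1 (by positivity)
      _ ≤ _ := by nlinarith [sq_nonneg g]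
  nlinarith [hr.g_le]

theorem norm_le_of_near_sq {v : E} {l ε : ℝ} (h : |‖v‖ ^ 2 - l| ≤ ε) (hl : 1 ≤ l) (hlκ : l ≤ κ)
    (hε : ε ≤ 1) : ‖v‖ ≤ 2 * κ := by
  refine le_of_sq_le_sq ?_ (by linarith)
  nlinarith [(abs_le.1 h).2]

section Time

variable {θ w t : ℝ} (hr : F.Regime κ M H g Tend) (ha : F.Approx g θ w t)
  (hc : F.Controlled H g t)
include hr ha hc

/-- Up to scaling, the signal columns stay close to convex combinations of the initial ones. -/
theorem nearMultiple_a (p : P) : ∃ c ∈ Icc (0 : ℝ) 1,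
    NearMultiple κ g (F.a p t) (c • F.a p 0 + (1 - c) • F.b p 0) := by
  have hg := hr.g_pos
  have hκ := hr.one_le_κ
  have h18 : g ^ 18 ≤ 1 := by linarith [hr.g18_le, hr.g4_le]
  set e := Real.exp (F.lam p * (θ - w)) with he
  set f := Real.exp (-(F.lam p * (θ + w))) with hf
  have he0 : 0 < e := Real.exp_pos _
  have hf0 : 0 < f := Real.exp_pos _
  have hf1 : f ≤ 1 := Real.exp_le_one_iff.2
    (neg_nonpos.2 (mul_nonneg (hr.lam_pos p).le ha.v_nonneg))
  have he1 : 1 ≤ e := Real.one_le_exp (mul_nonneg (hr.lam_pos p).le ha.u_nonneg)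
  have hfe : f / e ≤ 1 := by rw [div_le_one he0]; linarith
  have hfe0 : 0 < f / e := div_pos hf0 he0
  refine ⟨(1 + f / e) / 2, ⟨by linarith, by linarith⟩, ?_, e, he0, ?_, ?_⟩
  · have h1 := norm_le_of_near_sq (hr.initial.norm_a p) (hr.one_le_lam p) (hr.lam_le p) h18
    have h2 := norm_le_of_near_sq (hr.initial.norm_b p) (hr.one_le_lam p) (hr.lam_le p) h18
    refine (norm_add_le _ _).trans ?_
    rw [norm_smul, norm_smul, Real.norm_eq_abs, Real.norm_eq_abs,
      abs_of_nonneg (by linarith : 0 ≤ (1 + f / e) / 2),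
      abs_of_nonneg (by linarith : 0 ≤ 1 - (1 + f / e) / 2)]
    nlinarith
  · have e1 : F.a p t - e • (((1 + f / e) / 2) • F.a p 0 + (1 - (1 + f / e) / 2) • F.b p 0) =
        (1 / 2 : ℝ) • (((F.a p t + F.b p t) - e • (F.a p 0 + F.b p 0)) +
          ((F.a p t - F.b p t) - f • (F.a p 0 - F.b p 0))) := by
      have e2 : e * ((1 + f / e) / 2) = (e + f) / 2 := by field_simp
      have e3 : e * (1 - (1 + f / e) / 2) = (e - f) / 2 := by field_simp; ring
      rw [smul_add, smul_smul, smul_smul, e2, e3]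
      module
    rw [e1, norm_smul]
    have h1 := norm_add_le_of_le (ha.add p) (ha.sub p)
    have h2 : 0 < g ^ 4 := by positivity
    rw [Real.norm_eq_abs, abs_of_pos (by norm_num : (0 : ℝ) < 1 / 2)]
    have h3 : g ^ 4 ≤ e * g ^ 4 := le_mul_of_one_le_left h2.le he1
    have h4 : e * g ^ 4 ≤ κ * (e * g ^ 4) := le_mul_of_one_le_left (by positivity) hκ
    linarith
  · have h1 := norm_a_sq_ge hr ha hc p
    have hz := hr.g4_le
    have hl := hr.one_le_lam p
    refine le_of_sq_le_sq ?_ (norm_nonneg _)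
    unfold S at h1
    rw [← he] at h1
    have h2 : e ^ 2 ≤ F.lam p * e ^ 2 := le_mul_of_one_le_left (sq_nonneg e) hl
    nlinarith

theorem nearMultiple_b (p : P) : ∃ c ∈ Icc (0 : ℝ) 1,
    NearMultiple κ g (F.b p t) (c • F.a p 0 + (1 - c) • F.b p 0) := by
  obtain ⟨c, hc01, h⟩ := nearMultiple_a hr.swap ha.swap hc.swap p
  refine ⟨1 - c, ⟨by linarith [hc01.2], by linarith [hc01.1]⟩, ?_⟩
  rw [sub_sub_cancel, add_comm]
  exact h

theorem nearMultiple_y (q : Q) : NearMultiple κ g (F.y q t) (F.y q 0) := by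
  have h18 : g ^ 18 ≤ 1 := by linarith [hr.g18_le, hr.g4_le]
  have h1 := norm_le_of_near_sq (hr.initial.norm_y q) hr.one_le_lamx hr.lamx_le h18
  refine ⟨h1, _, Real.exp_pos (-(F.lamx * w)), (ha.y q).trans ?_, norm_y_ge hr ha q⟩
  refine mul_le_mul_of_nonneg_left ?_ (Real.exp_pos _).le
  have := mul_le_mul_of_nonneg_left h1 (by have := hr.g_pos; positivity : 0 ≤ g ^ 4)
  linarith

theorem nearMultiple_x (q : Q) : NearMultiple κ g (F.x q t) (F.x q 0) :=
  nearMultiple_y hr.swap ha.swap hc.swap q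

theorem abs_inner_convex_le {c : ℝ} (hc : c ∈ Icc (0 : ℝ) 1) {v v' z : E} {ε : ℝ}
    (h : |inner ℝ v z| ≤ ε) (h' : |inner ℝ v' z| ≤ ε) :
    |inner ℝ (c • v + (1 - c) • v') z| ≤ ε := by
  rw [inner_add_left, real_inner_smul_left, real_inner_smul_left]
  have h1 := abs_le.1 h
  have h2 := abs_le.1 h'
  have h3 : 0 ≤ 1 - c := by linarith [hc.2]
  rw [abs_le]
  constructor <;> nlinarith [hc.1]

/-- Distinct signal columns stay nearly orthogonal. -/
theorem signal_signal_le {p p' : P} (hp : p ≠ p') {v z : E} (hv : v = F.a p t ∨ v = F.b p t)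
    (hz : z = F.a p' t ∨ z = F.b p' t) : |inner ℝ v z| ≤ g * (‖v‖ * ‖z‖) := by
  have hv' : ∃ c ∈ Icc (0 : ℝ) 1, NearMultiple κ g v (c • F.a p 0 + (1 - c) • F.b p 0) := by
    rcases hv with rfl | rfl
    · exact nearMultiple_a hr ha hc p
    · exact nearMultiple_b hr ha hc p
  have hz' : ∃ c ∈ Icc (0 : ℝ) 1, NearMultiple κ g z (c • F.a p' 0 + (1 - c) • F.b p' 0) := by
    rcases hz with rfl | rfl
    · exact nearMultiple_a hr ha hc p'
    · exact nearMultiple_b hr ha hc p'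
  obtain ⟨c, hc1, hv1⟩ := hv'
  obtain ⟨c', hc1', hz1⟩ := hz'
  refine hv1.abs_inner_le hr hz1 ?_
  refine abs_inner_convex_le hr ha hc hc1 ?_ ?_
  · rw [real_inner_comm]
    refine abs_inner_convex_le hr ha hc hc1' ?_ ?_
    · exact hr.initial.aa _ _ hp.symm
    · rw [real_inner_comm]; exact hr.initial.ab _ _
  · rw [real_inner_comm]
    refine abs_inner_convex_le hr ha hc hc1' ?_ ?_
    · exact hr.initial.ab _ _
    · exact hr.initial.bb _ _ hp.symm

theorem signal_noise_le (p : P) (q : Q) {v z : E} (hv : v = F.a p t ∨ v = F.b p t)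
    (hz : z = F.x q t ∨ z = F.y q t) : |inner ℝ v z| ≤ g * (‖v‖ * ‖z‖) := by
  have hv' : ∃ c ∈ Icc (0 : ℝ) 1, NearMultiple κ g v (c • F.a p 0 + (1 - c) • F.b p 0) := by
    rcases hv with rfl | rfl
    · exact nearMultiple_a hr ha hc p
    · exact nearMultiple_b hr ha hc p
  obtain ⟨c, hc1, hv1⟩ := hv'
  rcases hz with rfl | rfl
  · exact hv1.abs_inner_le hr (nearMultiple_x hr ha hc q)
      (abs_inner_convex_le hr ha hc hc1 (hr.initial.ax p q) (hr.initial.bx p q))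
  · exact hv1.abs_inner_le hr (nearMultiple_y hr ha hc q)
      (abs_inner_convex_le hr ha hc hc1 (hr.initial.ay p q) (hr.initial.bt p q))

theorem noise_noise_le (q q' : Q) :
    |inner ℝ (F.x q t) (F.y q' t)| ≤ g * (‖F.x q t‖ * ‖F.y q' t‖) :=
  (nearMultiple_x hr ha hc q).abs_inner_le hr (nearMultiple_y hr ha hc q') (hr.initial.xy q q')

/-- All noise columns of one side decay by the same factor, with a small relative error. -/
theorem norm_x_le_mul (q q' : Q) : ‖F.x q t‖ ≤ (1 + g) * ‖F.x q' t‖ := by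
  have hg := hr.g_pos
  have hg1 := hr.g_le
  have hz0 : 0 < g ^ 4 := by positivity
  have hz : g ^ 4 ≤ g / 1000 := by
    have : g ^ 3 ≤ 1 / 1000 := by
      have := hr.pow_le 3 1 (by norm_num); linarith
    have e : g ^ 4 = g * g ^ 3 := by ring
    rw [e]; nlinarith
  have h18 := hr.g18_le
  have hl := hr.one_le_lamx
  have h1 := (abs_le.1 (hr.initial.norm_x q)).2
  have h2 := (abs_le.1 (hr.initial.norm_x q')).1
  have h3 := ha.x q
  have h4 := ha.x q'
  set f := Real.exp (-(F.lamx * w))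
  have hf0 : 0 < f := Real.exp_pos _
  have h5 : ‖F.x q t‖ ≤ f * ((1 + g ^ 4) * ‖F.x q 0‖) := by
    have := norm_sub_norm_le (F.x q t) (f • F.x q 0)
    rw [norm_smul, Real.norm_eq_abs, abs_of_pos hf0] at this
    linarith
  have h6 : f * ((1 - g ^ 4) * ‖F.x q' 0‖) ≤ ‖F.x q' t‖ := by
    have := norm_sub_norm_le (f • F.x q' 0) (F.x q' t)
    rw [norm_smul, Real.norm_eq_abs, abs_of_pos hf0, norm_sub_rev] at this
    linarith
  have h7 : (1 + g ^ 4) * ‖F.x q 0‖ ≤ (1 + g) * ((1 - g ^ 4) * ‖F.x q' 0‖) := by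
    have hz1 : g ^ 4 ≤ 1 := by linarith
    refine le_of_sq_le_sq ?_
      (mul_nonneg (by linarith) (mul_nonneg (by linarith) (norm_nonneg _)))
    set ζ := g ^ 4
    rw [mul_pow, mul_pow, mul_pow]
    have b1 : ‖F.x q 0‖ ^ 2 ≤ F.lamx * (1 + ζ) := by nlinarith
    have b2 : F.lamx * (1 - ζ) ≤ ‖F.x q' 0‖ ^ 2 := by nlinarith
    have b3 : (1 + ζ) ^ 2 * (1 + ζ) ≤ 1 + 4 * ζ := by nlinarith [sq_nonneg ζ]
    have b4 : 1 + 4 * ζ ≤ (1 + g) ^ 2 * ((1 - ζ) ^ 2 * (1 - ζ)) := by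
      have c1 : 1 - 3 * ζ ≤ (1 - ζ) ^ 2 * (1 - ζ) := by nlinarith [sq_nonneg ζ]
      have c2 : 1 + 2 * g ≤ (1 + g) ^ 2 := by nlinarith
      have c3 := mul_le_mul c2 c1 (by linarith) (sq_nonneg _)
      nlinarith
    calc (1 + ζ) ^ 2 * ‖F.x q 0‖ ^ 2 ≤ (1 + ζ) ^ 2 * (F.lamx * (1 + ζ)) := by gcongr
      _ = F.lamx * ((1 + ζ) ^ 2 * (1 + ζ)) := by ring
      _ ≤ F.lamx * ((1 + g) ^ 2 * ((1 - ζ) ^ 2 * (1 - ζ))) := by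
          refine mul_le_mul_of_nonneg_left (b3.trans b4) (by linarith)
      _ = (1 + g) ^ 2 * ((1 - ζ) ^ 2 * (F.lamx * (1 - ζ))) := by ring
      _ ≤ _ := by gcongr
  have h8 := mul_le_mul_of_nonneg_left h7 hf0.le
  have h9 := mul_le_mul_of_nonneg_left h6 (by linarith : 0 ≤ 1 + g)
  linarith

theorem noise_ratio_le (q q' : Q) : |1 - ‖F.x q t‖ / ‖F.x q' t‖| ≤ g := by
  have h1 := norm_x_le_mul hr ha hc q q'
  have h2 := norm_x_le_mul hr ha hc q' q
  have hg := hr.g_pos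
  have h3 : 0 < ‖F.x q' t‖ :=
    lt_of_lt_of_le (by positivity) (norm_y_ge hr.swap ha.swap q')
  rw [abs_le]
  constructor
  · rw [neg_le_sub_iff_le_add, div_le_iff₀ h3]; linarith
  · rw [sub_le_comm, le_div_iff₀ h3]
    by_contra! h
    nlinarith [hr.g_le, mul_pos hg h3, norm_nonneg (F.x q t)]

end Time

/-- The signal columns have norms of comparable size. -/
theorem norm_a_sq_le_mul (hr : F.Regime κ M H g Tend) {T : ℝ} {θ w : ℝ → ℝ}
    (hk : F.Clocks g T θ w) (hc : ∀ t ∈ Icc 0 T, F.Controlled H g t) {t : ℝ} (ht : t ∈ Icc 0 T)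
    (p p' : P) : ‖F.a p t‖ ^ 2 ≤ 10 * κ * Real.exp (112 * κ * M) * ‖F.a p' t‖ ^ 2 := by
  have h1 := norm_a_sq_le hr (hk.approx t ht) p
  have h2 := S_le hr hk hc ht p
  have h3 := norm_a_ge hr (hk.approx t ht) (hc t ht) p'
  have h4 : 0 < κ * Real.exp (112 * κ * M) :=
    mul_pos (by linarith [hr.one_le_κ]) (Real.exp_pos _)
  have h5 : 1 / 4 ≤ ‖F.a p' t‖ ^ 2 := by nlinarith
  nlinarith

/-- After a long enough time the signal columns are aligned and the noise has decayed. -/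
theorem aligned_at_end (hr : F.Regime κ M H g Tend) {R : ℝ} (hR : 1 ≤ R) (hRg : R * g ≤ 1)
    (hRκ : κ ≤ R) (hRM : Real.exp (112 * M) ≤ R) (hlong : 2 * Real.log R * H ^ 2 ≤ F.η * Tend) :
    (∀ p, (1 - 8 / R) * (‖F.a p Tend‖ * ‖F.b p Tend‖) ≤ inner ℝ (F.a p Tend) (F.b p Tend)) ∧
    ∀ p q, ‖F.x q Tend‖ ^ 2 ≤ 8 / R ^ 2 * ‖F.a p Tend‖ ^ 2 := by
  have hc := controlled hr
  have hT : Tend ∈ Icc 0 Tend := ⟨hr.Tend_nonneg, le_rfl⟩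
  obtain ⟨θ, w, hk⟩ := exists_clocks hr hT hc
  have ha := hk.approx Tend hT
  have hR0 : 0 < R := by linarith
  have hθ : 2 * Real.log R ≤ θ Tend := by
    have h := le_of_hasDerivAt_le (f := fun s => F.η / H ^ 2 * s) (f' := fun _ => F.η / H ^ 2)
      (fun s _ => by simpa using (hasDerivAt_id s).const_mul (F.η / H ^ 2)) hk.hasDeriv_θ
      (by simp [hk.θ_zero]) (fun s hs => α_ge hr (hc s hs)) Tend hT
    refine le_trans ?_ h
    have hH : 0 < H ^ 2 := by have := hr.H_pos; positivity
    rw [div_mul_eq_mul_div, le_div_iff₀ hH]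
    exact hlong
  have hE : Real.exp (-(2 * θ Tend)) ≤ 1 / R ^ 4 := by
    calc Real.exp (-(2 * θ Tend)) ≤ Real.exp (-(4 * Real.log R)) :=
          Real.exp_le_exp.2 (by linarith)
      _ = 1 / R ^ 4 := by
          rw [Real.exp_neg, one_div]
          congr 1
          rw [show (4 : ℝ) * Real.log R = ((4 : ℕ) : ℝ) * Real.log R by norm_num, Real.exp_nat_mul,
            Real.exp_log hR0]
  have hR1 : 1 / R ≤ 1 := by rw [div_le_one hR0]; exact hR
  have hR4 : 1 / R ^ 4 ≤ 1 / R :=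
    one_div_le_one_div_of_le hR0 (by simpa using pow_le_pow_right₀ hR (by norm_num : 1 ≤ 4))
  constructor
  · intro p
    refine le_trans (mul_le_mul_of_nonneg_right ?_ (by positivity))
      (inner_ab_ge_mul_norm hr ha (hc _ hT) p)
    have h1 : Real.exp (-(4 * θ Tend)) ≤ Real.exp (-(2 * θ Tend)) :=
      Real.exp_le_exp.2 (by linarith [ha.θ_nonneg])
    have h2 : 9 * g ^ 4 ≤ 1 / R := by
      have : g ≤ 1 / R := by rw [le_div_iff₀ hR0]; linarith
      have : g ^ 4 ≤ g ^ 2 := hr.pow_le 4 2 (by norm_num)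
      nlinarith [hr.g_le, hr.g_pos]
    have e : 8 / R = 8 * (1 / R) := by ring
    rw [e]
    linarith
  · intro p q
    have h1 := norm_x_sq_le hr ha q
    have h2 := norm_a_ge hr ha (hc _ hT) p
    have h3 := growth_le hr hk hc hT
    have hf : Real.exp (-(F.lamx * w Tend)) ^ 2 ≤ 1 / R ^ 3 := by
      rw [← Real.exp_nat_mul]
      have h4 : -(F.lamx * w Tend) ≤ -(w Tend) ∨ w Tend < 0 := by
        rcases lt_or_ge (w Tend) 0 with h | h
        · exact Or.inr h
        · exact Or.inl (by nlinarith [hr.one_le_lamx])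
      have hM := hr.one_le_M
      have h5 : Real.exp (-(2 * θ Tend) + 96 * M) ≤ 1 / R ^ 3 := by
        rw [Real.exp_add]
        have : Real.exp (96 * M) ≤ R := le_trans (Real.exp_le_exp.2 (by linarith)) hRM
        calc _ ≤ 1 / R ^ 4 * R := by gcongr
          _ = _ := by field_simp
      rcases h4 with h4 | h4
      · refine le_trans (Real.exp_le_exp.2 ?_) h5
        push_cast
        linarith
      · -- a negative `w` would force `θ ≤ 48 M`, but `2 log R ≤ θ` and `112 M ≤ log R`
        exfalso
        have h6 : 96 * M < 2 * Real.log R := by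
          have : 112 * M ≤ Real.log R := by
            rw [← Real.log_exp (112 * M)]
            exact Real.log_le_log (Real.exp_pos _) hRM
          linarith
        linarith
    have h6 : ‖F.x q Tend‖ ^ 2 ≤ 2 * R * (1 / R ^ 3) := by
      refine h1.trans (mul_le_mul (by linarith [hr.lamx_le]) hf (sq_nonneg _) (by linarith))
    have h7 : 2 * R * (1 / R ^ 3) = 2 / R ^ 2 := by field_simp
    rw [h7] at h6
    refine h6.trans ?_
    have h8 : 1 / 4 ≤ ‖F.a p Tend‖ ^ 2 := by nlinarith
    have h9 : 0 < 1 / R ^ 2 := by positivity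
    have e1 : 2 / R ^ 2 = 2 * (1 / R ^ 2) := by ring
    have e2 : 8 / R ^ 2 = 8 * (1 / R ^ 2) := by ring
    rw [e1, e2]
    nlinarith

end Flow

end Contrastive

end

noncomputable section

namespace Contrastive

set_option linter.unusedSectionVars false

/-! ### Averages over finite probability spaces -/

/-- The average of a vector-valued function on a finite type. -/
def avg {Ω V : Type*} [Fintype Ω] [AddCommGroup V] [Module ℝ V] (f : Ω → V) : V :=
  (Fintype.card Ω : ℝ)⁻¹ • ∑ ω, f ω

section Avg

variable {Ω Ω' V : Type*} [Fintype Ω] [Fintype Ω']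

theorem avg_eq_expect (f : Ω → ℝ) : avg f = 𝔼 ω, f ω := by
  rw [Fintype.expect_eq_sum_div_card, avg, smul_eq_mul, inv_mul_eq_div]

section Module

variable [AddCommGroup V] [Module ℝ V]

theorem avg_add (f f' : Ω → V) : avg (fun ω => f ω + f' ω) = avg f + avg f' := by
  simp only [avg, Finset.sum_add_distrib, smul_add]

theorem avg_sub (f f' : Ω → V) : avg (fun ω => f ω - f' ω) = avg f - avg f' := by
  simp only [avg, Finset.sum_sub_distrib, smul_sub]

theorem avg_neg (f : Ω → V) : avg (fun ω => -f ω) = -avg f := by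
  simp only [avg, Finset.sum_neg_distrib, smul_neg]

theorem avg_smul (c : ℝ) (f : Ω → V) : avg (fun ω => c • f ω) = c • avg f := by
  simp only [avg, ← Finset.smul_sum, smul_comm c]

theorem avg_smul_const (f : Ω → ℝ) (v : V) : avg (fun ω => f ω • v) = avg f • v := by
  simp only [avg, ← Finset.sum_smul, smul_assoc]

theorem avg_const [Nonempty Ω] (v : V) : avg (fun _ : Ω => v) = v := by
  rw [avg, Finset.sum_const, Finset.card_univ, ← Nat.cast_smul_eq_nsmul ℝ, smul_smul,
    inv_mul_cancel₀ (by simp), one_smul]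

theorem avg_sum {ι : Type*} (s : Finset ι) (f : ι → Ω → V) :
    avg (fun ω => ∑ i ∈ s, f i ω) = ∑ i ∈ s, avg (f i) := by
  simp only [avg, Finset.smul_sum]
  exact Finset.sum_comm

theorem avg_equiv (e : Ω ≃ Ω') (f : Ω' → V) : avg (fun ω => f (e ω)) = avg f := by
  simp only [avg, Fintype.card_congr e, e.sum_comp f]

theorem avg_prod (f : Ω × Ω' → V) : avg f = avg fun ω => avg fun ω' => f (ω, ω') := by
  simp only [avg, Fintype.sum_prod_type, Fintype.card_prod, Nat.cast_mul, mul_inv,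
    ← Finset.smul_sum, smul_smul]

theorem avg_prod_symm (f : Ω × Ω' → V) : avg f = avg fun ω' => avg fun ω => f (ω, ω') := by
  rw [← avg_equiv (Equiv.prodComm Ω' Ω), avg_prod]
  rfl

/-- Symmetrization: a function that is close to an odd one has a small average. -/
theorem two_smul_avg (e : Ω ≃ Ω) (f : Ω → V) :
    (2 : ℝ) • avg f = avg fun ω => f ω + f (e ω) := by
  rw [avg_add, avg_equiv e f, two_smul]

/-- A function that changes sign under a symmetry of the sample space has average zero. -/
theorem avg_eq_zero_of_odd (e : Ω ≃ Ω) (f : Ω → V) (h : ∀ ω, f (e ω) = -f ω) : avg f = 0 := by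
  have h2 := two_smul_avg e f
  simp only [h, add_neg_cancel, avg, Finset.sum_const_zero, smul_zero] at h2
  exact (smul_eq_zero.1 h2).resolve_left two_ne_zero

end Module

theorem norm_avg_le [NormedAddCommGroup V] [NormedSpace ℝ V] [Nonempty Ω] {f : Ω → V} {C : ℝ}
    (h : ∀ ω, ‖f ω‖ ≤ C) : ‖avg f‖ ≤ C := by
  rw [avg, norm_smul, norm_inv, Real.norm_natCast, inv_mul_le_iff₀ (by
    exact_mod_cast Fintype.card_pos)]
  refine (norm_sum_le _ _).trans ?_
  refine (Finset.sum_le_card_nsmul _ _ C fun ω _ => h ω).trans_eq ?_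
  rw [nsmul_eq_mul, Finset.card_univ]

theorem avg_mono {f f' : Ω → ℝ} (h : ∀ ω, f ω ≤ f' ω) : avg f ≤ avg f' :=
  smul_le_smul_of_nonneg_left (Finset.sum_le_sum fun ω _ => h ω) (by positivity)

theorem inner_avg [NormedAddCommGroup V] [InnerProductSpace ℝ V] (v : V) (f : Ω → V) :
    inner ℝ v (avg f) = avg fun ω => inner ℝ v (f ω) := by
  simp only [avg, real_inner_smul_right, inner_sum, smul_eq_mul]

theorem avg_inner [NormedAddCommGroup V] [InnerProductSpace ℝ V] (v : V) (f : Ω → V) :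
    inner ℝ (avg f) v = avg fun ω => inner ℝ (f ω) v := by
  simp only [avg, real_inner_smul_left, sum_inner, smul_eq_mul]

theorem HasDerivAt.avg [NormedAddCommGroup V] [NormedSpace ℝ V] {f : Ω → ℝ → V} {f' : Ω → V}
    {s : ℝ} (h : ∀ ω, HasDerivAt (f ω) (f' ω) s) :
    HasDerivAt (fun s => Contrastive.avg fun ω => f ω s) (Contrastive.avg f') s :=
  (HasDerivAt.fun_sum fun ω _ => h ω).const_smul _

end Avg

/-! ### Sign vectors -/

/-- A sample `(z, ξ)` of the latent variables on one side. -/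
abbrev Sample (r n : ℕ) : Type := SignVec r × SignVec n

/-- A sample `(z, ξ_A, ξ_B)` of the latent variables of a positive pair. -/
abbrev PairSample (r n : ℕ) : Type := SignVec r × SignVec n × SignVec n

section Signs

variable {r n : ℕ}

/-- The `A` side of a positive pair. -/
def PairSample.fstSide (ω : PairSample r n) : Sample r n := (ω.1, ω.2.1)

/-- The `B` side of a positive pair. -/
def PairSample.sndSide (ω : PairSample r n) : Sample r n := (ω.1, ω.2.2)

/-- All signs of a sample, as real numbers. -/
def sgn (ω : Sample r n) : Fin r ⊕ Fin n → ℝ :=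
  Sum.elim (fun p => ((ω.1 p : ℤ) : ℝ)) fun q => ((ω.2 q : ℤ) : ℝ)

theorem abs_sgn (ω : Sample r n) (i : Fin r ⊕ Fin n) : |sgn ω i| = 1 := by
  rcases i with p | q
  · rcases Int.units_eq_one_or (ω.1 p) with h | h <;> simp [sgn, h]
  · rcases Int.units_eq_one_or (ω.2 q) with h | h <;> simp [sgn, h]

theorem sgn_mul_self (ω : Sample r n) (i : Fin r ⊕ Fin n) : sgn ω i * sgn ω i = 1 := by
  rw [← abs_mul_abs_self, abs_sgn, one_mul]

/-- Flipping the `i`-th sign. -/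
def flipSign (i : Fin n) : SignVec n ≃ SignVec n :=
  Function.Involutive.toPerm (fun s => Function.update s i (-s i)) fun s => by simp

theorem flipSign_apply (i : Fin n) (s : SignVec n) :
    flipSign i s = Function.update s i (-s i) := rfl

/-- Flipping one sign of a sample. -/
def flipSample : Fin r ⊕ Fin n → (Sample r n ≃ Sample r n)
  | .inl p => (flipSign p).prodCongr (Equiv.refl _)
  | .inr q => (Equiv.refl _).prodCongr (flipSign q)

/-- Flipping one sign on the `A` side of a positive pair; a signal sign is shared by both sides. -/
def flipPair : Fin r ⊕ Fin n → (PairSample r n ≃ PairSample r n)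
  | .inl p => (flipSign p).prodCongr (Equiv.refl _)
  | .inr q => (Equiv.refl _).prodCongr ((flipSign q).prodCongr (Equiv.refl _))

theorem sgn_flipSample (i j : Fin r ⊕ Fin n) (ω : Sample r n) :
    sgn (flipSample i ω) j = if j = i then -sgn ω j else sgn ω j := by
  rcases i with p | q <;> rcases j with p' | q'
  · by_cases h : p' = p
    · subst h; simp [sgn, flipSample, flipSign_apply]
    · simp [sgn, flipSample, flipSign_apply, h]
  · simp [sgn, flipSample]
  · simp [sgn, flipSample]
  · by_cases h : q' = q
    · subst h; simp [sgn, flipSample, flipSign_apply]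
    · simp [sgn, flipSample, flipSign_apply, h]

theorem fstSide_flipPair (i : Fin r ⊕ Fin n) (ω : PairSample r n) :
    (flipPair i ω).fstSide = flipSample i ω.fstSide := by
  rcases i with p | q <;> rfl

theorem sndSide_flipPair_inl (p : Fin r) (ω : PairSample r n) :
    (flipPair (.inl p) ω).sndSide = flipSample (.inl p) ω.sndSide := rfl

theorem sndSide_flipPair_inr (q : Fin n) (ω : PairSample r n) :
    (flipPair (.inr q) ω).sndSide = ω.sndSide := rfl

theorem avg_sgn (i : Fin r ⊕ Fin n) : avg (fun ω : Sample r n => sgn ω i) = 0 :=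
  avg_eq_zero_of_odd (flipSample i) _ fun ω => by simp [sgn_flipSample]

theorem avg_sgn_mul_sgn (i j : Fin r ⊕ Fin n) :
    avg (fun ω : Sample r n => sgn ω i * sgn ω j) = if i = j then 1 else 0 := by
  split_ifs with h
  · subst h; simp only [sgn_mul_self]; exact avg_const _
  · refine avg_eq_zero_of_odd (flipSample i) _ fun ω => ?_
    simp [sgn_flipSample, Ne.symm h]

theorem avg_pair_sgn_fst (i : Fin r ⊕ Fin n) :
    avg (fun ω : PairSample r n => sgn ω.fstSide i) = 0 :=
  avg_eq_zero_of_odd (flipPair i) _ fun ω => by simp [fstSide_flipPair, sgn_flipSample]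

theorem avg_pair_signal (p : Fin r) (j : Fin r ⊕ Fin n) :
    avg (fun ω : PairSample r n => sgn ω.fstSide (.inl p) * sgn ω.sndSide j) =
      if .inl p = j then 1 else 0 := by
  split_ifs with h
  · subst h
    have : ∀ ω : PairSample r n, sgn ω.fstSide (.inl p) * sgn ω.sndSide (.inl p) = 1 :=
      fun ω => sgn_mul_self ω.fstSide (.inl p)
    simp only [this]; exact avg_const _
  · refine avg_eq_zero_of_odd (flipPair (.inl p)) _ fun ω => ?_
    simp [fstSide_flipPair, sndSide_flipPair_inl, sgn_flipSample, Ne.symm h]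

theorem avg_pair_noise (q : Fin n) (j : Fin r ⊕ Fin n) :
    avg (fun ω : PairSample r n => sgn ω.fstSide (.inr q) * sgn ω.sndSide j) = 0 := by
  refine avg_eq_zero_of_odd (flipPair (.inr q)) _ fun ω => ?_
  simp [fstSide_flipPair, sndSide_flipPair_inr, sgn_flipSample]

/-! ### Normalized features -/

section Features

variable {E : Type*} [NormedAddCommGroup E] [InnerProductSpace ℝ E]
  (U : Fin r ⊕ Fin n → E)

/-- The unnormalized output on a sample, up to the factor `1/√d`, in terms of the columns. -/
def lin (ω : Sample r n) : E := ∑ i, sgn ω i • U i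

/-- The Frobenius norm of a family of columns. -/
def frob : ℝ := √(∑ i, ‖U i‖ ^ 2)

/-- The batch-normalized output on a sample, in terms of the columns. -/
def feat (ω : Sample r n) : E := (frob U)⁻¹ • lin U ω

theorem frob_nonneg : 0 ≤ frob U := Real.sqrt_nonneg _

theorem frob_sq : frob U ^ 2 = ∑ i, ‖U i‖ ^ 2 := Real.sq_sqrt (by positivity)

theorem norm_le_frob (i : Fin r ⊕ Fin n) : ‖U i‖ ≤ frob U := by
  refine Real.le_sqrt_of_sq_le ?_
  exact Finset.single_le_sum (f := fun i => ‖U i‖ ^ 2) (fun i _ => sq_nonneg _) (Finset.mem_univ i)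

theorem norm_lin_le (ω : Sample r n) : ‖lin U ω‖ ≤ √(r + n : ℝ) * frob U := by
  calc ‖lin U ω‖ ≤ ∑ i, 1 * ‖U i‖ := by
        refine (norm_sum_le _ _).trans (Finset.sum_le_sum fun i _ => ?_)
        rw [norm_smul, Real.norm_eq_abs, abs_sgn]
    _ ≤ √(∑ _i : Fin r ⊕ Fin n, (1 : ℝ) ^ 2) * √(∑ i, ‖U i‖ ^ 2) :=
        Real.sum_mul_le_sqrt_mul_sqrt _ _ _
    _ = _ := by simp [frob]

theorem norm_feat_le (ω : Sample r n) : ‖feat U ω‖ ≤ √(r + n : ℝ) := by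
  rw [feat, norm_smul, norm_inv, Real.norm_of_nonneg (frob_nonneg U)]
  rcases (frob_nonneg U).eq_or_lt with h | h
  · rw [← h]; simp
  · rw [inv_mul_le_iff₀ h, mul_comm]; exact norm_lin_le U ω

theorem avg_norm_lin_sq : avg (fun ω : Sample r n => ‖lin U ω‖ ^ 2) = ∑ i, ‖U i‖ ^ 2 := by
  have h : ∀ ω : Sample r n, ‖lin U ω‖ ^ 2 =
      ∑ i, ∑ j, (sgn ω i * sgn ω j) • inner ℝ (U i) (U j) := by
    intro ω
    rw [← real_inner_self_eq_norm_sq, lin, sum_inner]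
    simp only [inner_sum, real_inner_smul_left, real_inner_smul_right, smul_eq_mul]
    exact Finset.sum_congr rfl fun i _ => Finset.sum_congr rfl fun j _ => by ring
  simp only [h, avg_sum, avg_smul_const, avg_sgn_mul_sgn]
  simp

theorem avg_lin : avg (lin U) = 0 := by
  change avg (fun ω => ∑ i, sgn ω i • U i) = 0
  rw [avg_sum]
  simp only [avg_smul_const, avg_sgn, zero_smul, Finset.sum_const_zero]

theorem avg_feat : avg (feat U) = 0 := by
  change avg (fun ω => (frob U)⁻¹ • lin U ω) = 0
  rw [avg_smul, avg_lin, smul_zero]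

theorem lin_flipSample (i : Fin r ⊕ Fin n) (ω : Sample r n) :
    lin U (flipSample i ω) = lin U ω - (2 * sgn ω i) • U i := by
  have h : ∀ j, sgn (flipSample i ω) j • U j =
      sgn ω j • U j - if j = i then (2 * sgn ω i) • U i else 0 := by
    intro j
    rw [sgn_flipSample]
    split_ifs with h
    · subst h; module
    · simp
  simp only [lin, h, Finset.sum_sub_distrib, Finset.sum_ite_eq', Finset.mem_univ, if_true]

theorem norm_feat_flip_sub_le (i : Fin r ⊕ Fin n) (ω : Sample r n) :
    ‖feat U (flipSample i ω) - feat U ω‖ ≤ 2 * ‖(frob U)⁻¹ • U i‖ := by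
  have e : feat U (flipSample i ω) - feat U ω = (-(2 * sgn ω i)) • (frob U)⁻¹ • U i := by
    rw [feat, feat, lin_flipSample]; module
  rw [e, norm_smul, Real.norm_eq_abs, abs_neg, abs_mul, abs_sgn]
  norm_num

/-- The signal columns are recovered by averaging the features against their sign. -/
theorem avg_pair_signal_feat (p : Fin r) :
    avg (fun ω : PairSample r n => sgn ω.fstSide (.inl p) • feat U ω.sndSide) =
      (frob U)⁻¹ • U (.inl p) := by
  simp only [feat, lin, Finset.smul_sum, smul_smul]
  rw [avg_sum]
  have : ∀ j (ω : PairSample r n), (sgn ω.fstSide (.inl p) * (frob U)⁻¹ * sgn ω.sndSide j) • U j =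
      (sgn ω.fstSide (.inl p) * sgn ω.sndSide j) • (frob U)⁻¹ • U j := by
    intro j ω; rw [smul_smul]; congr 1; ring
  simp only [mul_assoc] at this
  simp only [this, avg_smul_const, avg_pair_signal]
  simp

theorem avg_pair_inner_feat (V : Fin r ⊕ Fin n → E) :
    avg (fun ω : PairSample r n => inner ℝ (feat U ω.fstSide) (feat V ω.sndSide)) =
      (∑ p, inner ℝ (U (.inl p)) (V (.inl p))) / (frob U * frob V) := by
  have h : ∀ ω : PairSample r n, inner ℝ (feat U ω.fstSide) (feat V ω.sndSide) =
      ∑ i, ∑ j, (sgn ω.fstSide i * sgn ω.sndSide j) •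
        (inner ℝ (U i) (V j) / (frob U * frob V)) := by
    intro ω
    rw [feat, feat, real_inner_smul_left, real_inner_smul_right, lin, lin, sum_inner,
      Finset.mul_sum, Finset.mul_sum]
    refine Finset.sum_congr rfl fun i _ => ?_
    rw [inner_sum, Finset.mul_sum, Finset.mul_sum]
    refine Finset.sum_congr rfl fun j _ => ?_
    rw [real_inner_smul_left, real_inner_smul_right, smul_eq_mul, div_eq_mul_inv, mul_inv]
    ring
  simp only [h, avg_sum, avg_smul_const]
  rw [Fintype.sum_sum_type]
  simp [avg_pair_signal, avg_pair_noise, Finset.sum_div]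

end Features

end Signs

/-! ### Softmax weights -/

section Weights

variable {Ω : Type*} [Fintype Ω] {K : ℝ}

/-- The weight of a negative sample: `K e^{D ω} / (1 + K E e^D)`, where `D` is the difference of the
exponents of the negative and the positive pair. -/
def wt (K : ℝ) (D : Ω → ℝ) (ω : Ω) : ℝ :=
  K * Real.exp (D ω) / (1 + K * avg fun ω' => Real.exp (D ω'))

theorem avg_exp_nonneg (D : Ω → ℝ) : 0 ≤ avg fun ω => Real.exp (D ω) :=
  mul_nonneg (by positivity) (Finset.sum_nonneg fun ω _ => (Real.exp_pos _).le)

theorem wt_den_pos (hK : 0 < K) (D : Ω → ℝ) : 0 < 1 + K * avg fun ω => Real.exp (D ω) := by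
  have := avg_exp_nonneg D
  positivity

theorem wt_pos (hK : 0 < K) (D : Ω → ℝ) (ω : Ω) : 0 < wt K D ω :=
  div_pos (mul_pos hK (Real.exp_pos _)) (wt_den_pos hK D)

theorem wt_zero [Nonempty Ω] (ω : Ω) : wt K (fun _ : Ω => 0) ω = K / (1 + K) := by
  simp only [wt, Real.exp_zero, avg_const, mul_one]

theorem wt_equiv (e : Ω ≃ Ω) (D : Ω → ℝ) (ω : Ω) : wt K D (e ω) = wt K (fun ω => D (e ω)) ω := by
  rw [wt, wt, avg_equiv e fun ω' => Real.exp (D ω')]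

theorem wt_le_exp_mul (hK : 0 < K) {D₁ D₂ : Ω → ℝ} {ϑ : ℝ} (h : ∀ ω, |D₁ ω - D₂ ω| ≤ ϑ) (ω : Ω) :
    wt K D₁ ω ≤ Real.exp (2 * ϑ) * wt K D₂ ω := by
  have hϑ : 0 ≤ ϑ := (abs_nonneg _).trans (h ω)
  have h1 : Real.exp (D₁ ω) ≤ Real.exp ϑ * Real.exp (D₂ ω) := by
    rw [← Real.exp_add]
    exact Real.exp_le_exp.2 (by linarith [(abs_le.1 (h ω)).2])
  have h2 : (avg fun ω => Real.exp (D₂ ω)) ≤ Real.exp ϑ * avg fun ω => Real.exp (D₁ ω) := by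
    rw [← smul_eq_mul, ← avg_smul]
    refine avg_mono fun ω => ?_
    rw [smul_eq_mul, ← Real.exp_add]
    exact Real.exp_le_exp.2 (by linarith [(abs_le.1 (h ω)).1])
  have h3 : 1 + K * (avg fun ω => Real.exp (D₂ ω)) ≤
      Real.exp ϑ * (1 + K * avg fun ω => Real.exp (D₁ ω)) := by
    have := mul_le_mul_of_nonneg_left h2 hK.le
    linarith [Real.one_le_exp hϑ]
  rw [wt, wt, div_le_iff₀ (wt_den_pos hK D₁), mul_div_assoc', div_mul_eq_mul_div,
    le_div_iff₀ (wt_den_pos hK D₂), two_mul, Real.exp_add]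
  calc K * Real.exp (D₁ ω) * (1 + K * avg fun ω => Real.exp (D₂ ω))
      ≤ K * (Real.exp ϑ * Real.exp (D₂ ω)) *
          (Real.exp ϑ * (1 + K * avg fun ω => Real.exp (D₁ ω))) :=
        mul_le_mul (mul_le_mul_of_nonneg_left h1 hK.le) h3 (wt_den_pos hK D₂).le (by positivity)
    _ = _ := by ring

/-- The weights depend on the exponents in a Lipschitz way, relative to their size. -/
theorem abs_wt_sub_le (hK : 0 < K) {D₁ D₂ : Ω → ℝ} {ϑ : ℝ} (h : ∀ ω, |D₁ ω - D₂ ω| ≤ ϑ)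
    (hϑ : 2 * ϑ ≤ 1) (ω : Ω) : |wt K D₁ ω - wt K D₂ ω| ≤ 4 * ϑ * wt K D₂ ω := by
  have h0 : 0 ≤ ϑ := (abs_nonneg _).trans (h ω)
  have h1 := wt_le_exp_mul hK h ω
  have h2 := wt_le_exp_mul hK (fun ω => (abs_sub_comm (D₂ ω) (D₁ ω)).trans_le (h ω)) ω
  have h3 := Real.abs_exp_sub_one_le (x := 2 * ϑ) (by rwa [abs_of_nonneg (by linarith)])
  have h4 : 1 - 2 * ϑ ≤ Real.exp (-(2 * ϑ)) := by linarith [Real.add_one_le_exp (-(2 * ϑ))]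
  rw [abs_of_nonneg (by linarith : 0 ≤ 2 * ϑ)] at h3
  have h5 := (abs_le.1 h3).2
  have hw1 := wt_pos hK D₁ ω
  have hw2 := wt_pos hK D₂ ω
  have h6 : Real.exp (-(2 * ϑ)) * wt K D₂ ω ≤ wt K D₁ ω := by
    calc _ ≤ Real.exp (-(2 * ϑ)) * (Real.exp (2 * ϑ) * wt K D₁ ω) := by gcongr
      _ = wt K D₁ ω := by rw [← mul_assoc, ← Real.exp_add]; simp
  rw [abs_le]
  constructor <;> nlinarith

theorem hasDerivAt_log_one_add_avg_exp (hK : 0 < K) {D : ℝ → Ω → ℝ} {D' : Ω → ℝ} {x : ℝ}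
    (h : ∀ ω, HasDerivAt (fun x => D x ω) (D' ω) x) :
    HasDerivAt (fun x => Real.log (1 + K * avg fun ω => Real.exp (D x ω)))
      (avg fun ω => wt K (D x) ω * D' ω) x := by
  have h1 := ((HasDerivAt.avg fun ω => (h ω).exp).const_mul K).const_add 1
  refine (h1.log (wt_den_pos hK (D x)).ne').congr_deriv ?_
  rw [mul_div_right_comm, ← smul_eq_mul (a := K / _), ← avg_smul]
  refine congrArg avg (funext fun ω => ?_)
  rw [wt, smul_eq_mul]
  ring

end Weights

/-! ### The loss as a function of the columns -/

section Loss

variable {r n : ℕ} {E : Type*} [NormedAddCommGroup E] [InnerProductSpace ℝ E]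

/-- The exponent of a negative `B` sample relative to the positive pair. -/
def expA (U V : Fin r ⊕ Fin n → E) (ω : PairSample r n) (ω' : Sample r n) : ℝ :=
  inner ℝ (feat U ω.fstSide) (feat V ω' - feat V ω.sndSide)

/-- The exponent of a negative `A` sample relative to the positive pair. -/
def expB (U V : Fin r ⊕ Fin n → E) (ω : PairSample r n) (ω' : Sample r n) : ℝ :=
  inner ℝ (feat U ω' - feat U ω.fstSide) (feat V ω.sndSide)

/-- The contrastive loss in terms of the columns `U` of `(K_A, K_{A,ξ})` and `V` of
`(K_B, K_{B,ξ})`, with `s = τ²`. -/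
def colLoss (K s : ℝ) (U V : Fin r ⊕ Fin n → E) : ℝ :=
  avg fun ω : PairSample r n =>
    Real.log (1 + K * avg fun ω' : Sample r n => Real.exp (s * expA U V ω ω')) +
    Real.log (1 + K * avg fun ω' : Sample r n => Real.exp (s * expB U V ω ω'))

/-- Exchanging the noise of the two sides of a positive pair. -/
def swapPair : PairSample r n ≃ PairSample r n :=
  (Equiv.refl _).prodCongr (Equiv.prodComm _ _)

theorem colLoss_swap (K s : ℝ) (U V : Fin r ⊕ Fin n → E) : colLoss K s V U = colLoss K s U V := by
  rw [colLoss, ← avg_equiv swapPair, colLoss]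
  refine congrArg avg (funext fun ω => ?_)
  have h1 : ∀ ω', expA V U (swapPair ω) ω' = expB U V ω ω' := fun ω' => real_inner_comm _ _
  have h2 : ∀ ω', expB V U (swapPair ω) ω' = expA U V ω ω' := fun ω' => real_inner_comm _ _
  simp only [h1, h2]
  exact add_comm _ _

/-- The weight of a negative `B` sample, for a sample of a positive pair and of a negative. -/
def wtA (K s : ℝ) (U V : Fin r ⊕ Fin n → E) (ω : PairSample r n × Sample r n) : ℝ :=
  wt K (fun ω' => s * expA U V ω.1 ω') ω.2

/-- The weight of a negative `A` sample, for a sample of a positive pair and of a negative. -/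
def wtB (K s : ℝ) (U V : Fin r ⊕ Fin n → E) (ω : PairSample r n × Sample r n) : ℝ :=
  wt K (fun ω' => s * expB U V ω.1 ω') ω.2

/-- The part of the gradient in the `j`-th column that ignores the normalization. -/
def gradH (K s : ℝ) (U V : Fin r ⊕ Fin n → E) (j : Fin r ⊕ Fin n) : E :=
  avg fun ω : PairSample r n × Sample r n =>
    (wtA K s U V ω * sgn ω.1.fstSide j) • (feat V ω.2 - feat V ω.1.sndSide) +
    (wtB K s U V ω * (sgn ω.2 j - sgn ω.1.fstSide j)) • feat V ω.1.sndSide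

/-- The coefficient of the part of the gradient that comes from the normalization. -/
def gradR (K s : ℝ) (U V : Fin r ⊕ Fin n → E) : ℝ :=
  avg fun ω : PairSample r n × Sample r n =>
    wtA K s U V ω * expA U V ω.1 ω.2 + wtB K s U V ω * expB U V ω.1 ω.2

/-- The gradient of `colLoss` in the `j`-th column of `U`, divided by `s`. -/
def colGrad (K s : ℝ) (U V : Fin r ⊕ Fin n → E) (j : Fin r ⊕ Fin n) : E :=
  (frob U)⁻¹ • (gradH K s U V j - gradR K s U V • (frob U)⁻¹ • U j)

theorem hasDerivAt_frob (U U' : Fin r ⊕ Fin n → E) (hU : 0 < frob U) :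
    HasDerivAt (fun x : ℝ => frob (U + x • U')) ((frob U)⁻¹ * ∑ i, inner ℝ (U i) (U' i)) 0 := by
  have h1 : ∀ i, HasDerivAt (fun x : ℝ => (U + x • U') i) (U' i) 0 := by
    intro i
    simpa using ((hasDerivAt_id (0 : ℝ)).smul_const (U' i)).const_add (U i)
  have h2 : HasDerivAt (fun x : ℝ => ∑ i, ‖(U + x • U') i‖ ^ 2)
      (∑ i, 2 * inner ℝ (U i) (U' i)) 0 := by
    refine HasDerivAt.fun_sum fun i _ => ?_
    simpa using (h1 i).norm_sq
  have e0 : U + (0 : ℝ) • U' = U := by simp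
  have h3 := h2.sqrt (by rw [e0, ← frob_sq]; positivity)
  refine HasDerivAt.congr_deriv h3 ?_
  have e : √(∑ i, ‖(U + (0 : ℝ) • U') i‖ ^ 2) = frob U := by rw [e0]; rfl
  rw [e, ← Finset.mul_sum]
  field_simp

theorem hasDerivAt_feat (U U' : Fin r ⊕ Fin n → E) (hU : 0 < frob U) (ω : Sample r n) :
    HasDerivAt (fun x : ℝ => feat (U + x • U') ω)
      ((frob U)⁻¹ • (lin U' ω - (∑ i, inner ℝ ((frob U)⁻¹ • U i) (U' i)) • feat U ω)) 0 := by
  have h1 : HasDerivAt (fun x : ℝ => lin (U + x • U') ω) (lin U' ω) 0 := by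
    have e : (fun x : ℝ => lin (U + x • U') ω) = fun x : ℝ => lin U ω + x • lin U' ω := by
      funext x
      simp only [lin, Pi.add_apply, Pi.smul_apply, smul_add, Finset.sum_add_distrib,
        Finset.smul_sum, smul_comm x]
    rw [e]
    simpa using ((hasDerivAt_id (0 : ℝ)).smul_const (lin U' ω)).const_add (lin U ω)
  have e : U + (0 : ℝ) • U' = U := by simp
  have h2 := (hasDerivAt_frob U U' hU).fun_inv (by rw [e]; exact hU.ne')
  refine HasDerivAt.congr_deriv (h2.smul h1) ?_
  rw [e, feat]
  simp only [real_inner_smul_left, ← Finset.mul_sum]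
  rw [smul_sub, smul_smul, smul_smul, sub_eq_add_neg, ← neg_smul]
  congr 2
  field_simp

/-- The directional derivative of the loss in the columns `U`. -/
theorem hasDerivAt_colLoss {K : ℝ} (hK : 0 < K) (s : ℝ) (U V U' : Fin r ⊕ Fin n → E)
    (hU : 0 < frob U) :
    HasDerivAt (fun x : ℝ => colLoss K s (U + x • U') V)
      (s * ∑ j, inner ℝ (colGrad K s U V j) (U' j)) 0 := by
  set β : ℝ := ∑ i, inner ℝ ((frob U)⁻¹ • U i) (U' i) with hβ
  have e0 : U + (0 : ℝ) • U' = U := by simp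
  have hA : ∀ ω ω', HasDerivAt (fun x : ℝ => s * expA (U + x • U') V ω ω')
      (s * inner ℝ ((frob U)⁻¹ • (lin U' ω.fstSide - β • feat U ω.fstSide))
        (feat V ω' - feat V ω.sndSide)) 0 := by
    intro ω ω'
    have h := (hasDerivAt_feat U U' hU ω.fstSide).inner ℝ
      (hasDerivAt_const (0 : ℝ) (feat V ω' - feat V ω.sndSide))
    rw [inner_zero_right, zero_add] at h
    exact h.const_mul s
  have hB : ∀ ω ω', HasDerivAt (fun x : ℝ => s * expB (U + x • U') V ω ω')
      (s * inner ℝ ((frob U)⁻¹ • (lin U' ω' - β • feat U ω') -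
        (frob U)⁻¹ • (lin U' ω.fstSide - β • feat U ω.fstSide)) (feat V ω.sndSide)) 0 := by
    intro ω ω'
    have h := ((hasDerivAt_feat U U' hU ω').sub (hasDerivAt_feat U U' hU ω.fstSide)).inner ℝ
      (hasDerivAt_const (0 : ℝ) (feat V ω.sndSide))
    rw [inner_zero_right, zero_add] at h
    exact h.const_mul s
  have h1 := HasDerivAt.avg fun ω : PairSample r n =>
    (hasDerivAt_log_one_add_avg_exp hK (hA ω)).add (hasDerivAt_log_one_add_avg_exp hK (hB ω))
  refine h1.congr_deriv ?_
  simp only [e0, ← avg_add]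
  have key : ∀ j, inner ℝ (colGrad K s U V j) (U' j) =
      avg fun ω : PairSample r n × Sample r n => (frob U)⁻¹ *
        (wtA K s U V ω * (sgn ω.1.fstSide j *
            inner ℝ (U' j) (feat V ω.2 - feat V ω.1.sndSide)) +
          wtB K s U V ω * ((sgn ω.2 j - sgn ω.1.fstSide j) * inner ℝ (U' j) (feat V ω.1.sndSide)) -
          (wtA K s U V ω * expA U V ω.1 ω.2 + wtB K s U V ω * expB U V ω.1 ω.2) *
            inner ℝ ((frob U)⁻¹ • U j) (U' j)) := by
    intro j
    simp only [← smul_eq_mul (a := (frob U)⁻¹), avg_smul]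
    rw [avg_sub, colGrad, real_inner_smul_left, inner_sub_left, real_inner_smul_left, gradH,
      avg_inner, smul_eq_mul]
    congr 2
    swap
    · exact (avg_smul_const (V := ℝ) _ _).symm
    refine congrArg avg (funext fun ω => ?_)
    rw [inner_add_left, real_inner_smul_left, real_inner_smul_left, real_inner_comm (U' j),
      real_inner_comm (U' j)]
    ring
  simp only [key, ← avg_sum]
  rw [← smul_eq_mul s, ← avg_smul, avg_prod (Ω := PairSample r n) (Ω' := Sample r n)]
  refine congrArg avg (funext fun ω => congrArg avg (funext fun ω' => ?_))
  have hl : ∀ (ω : Sample r n) (v : E), inner ℝ (lin U' ω) v = ∑ j, sgn ω j * inner ℝ (U' j) v := by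
    intro ω v
    simp only [lin, sum_inner, real_inner_smul_left]
  simp only [inner_sub_left, real_inner_smul_left, hl, wtA, wtB, expA, expB, smul_eq_mul,
    ← Finset.mul_sum, Finset.sum_sub_distrib, Finset.sum_add_distrib, sub_mul, mul_sub]
  simp only [hβ, real_inner_smul_left, ← Finset.mul_sum]
  ring

end Loss

/-! ### Expansion of the gradient at infinite temperature -/

section Products

variable {Ω Ω' V : Type*} [Fintype Ω] [Fintype Ω'] [Nonempty Ω] [Nonempty Ω']
  [AddCommGroup V] [Module ℝ V]

theorem avg_comp_fst (f : Ω → V) : avg (fun ω : Ω × Ω' => f ω.1) = avg f := by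
  rw [avg_prod]
  simp only [avg_const]

theorem avg_fst_smul_snd (f : Ω → ℝ) (g : Ω' → V) :
    avg (fun ω : Ω × Ω' => f ω.1 • g ω.2) = avg f • avg g := by
  rw [avg_prod]
  simp only [avg_smul, avg_smul_const]

theorem avg_snd_smul_fst (f : Ω → V) (g : Ω' → ℝ) :
    avg (fun ω : Ω × Ω' => g ω.2 • f ω.1) = avg g • avg f := by
  rw [avg_prod_symm]
  simp only [avg_smul, avg_smul_const]

end Products

/-- A function that nearly changes sign under a symmetry of the sample space has a small average. -/
theorem norm_avg_le_of_odd {Ω V : Type*} [Fintype Ω] [Nonempty Ω] [NormedAddCommGroup V]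
    [NormedSpace ℝ V] (e : Ω ≃ Ω) {f : Ω → V} {C : ℝ} (h : ∀ ω, ‖f ω + f (e ω)‖ ≤ 2 * C) :
    ‖avg f‖ ≤ C := by
  have h1 := norm_avg_le h
  rw [← two_smul_avg, norm_smul, Real.norm_eq_abs, abs_two] at h1
  linarith

section Expansion

variable {r n : ℕ} {E : Type*} [NormedAddCommGroup E] [InnerProductSpace ℝ E]
  (U V : Fin r ⊕ Fin n → E)

/-- The correlation `E ⟨f_A⁺, f_B⁺⟩` of a positive pair. -/
def corr : ℝ := (∑ p, inner ℝ (U (.inl p)) (V (.inl p))) / (frob U * frob V)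

theorem norm_normalized_le (i : Fin r ⊕ Fin n) : ‖(frob U)⁻¹ • U i‖ ≤ 1 := by
  rw [norm_smul, norm_inv, Real.norm_of_nonneg (frob_nonneg U), inv_mul_eq_div]
  exact div_le_one_of_le₀ (norm_le_frob U i) (frob_nonneg U)

theorem norm_feat_sub_le (ω ω' : Sample r n) : ‖feat U ω - feat U ω'‖ ≤ 2 * √(r + n : ℝ) := by
  linarith [norm_sub_le (feat U ω) (feat U ω'), norm_feat_le U ω, norm_feat_le U ω']

theorem abs_expA_le (ω : PairSample r n) (ω' : Sample r n) : |expA U V ω ω'| ≤ 2 * (r + n : ℝ) := by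
  refine (abs_real_inner_le_norm _ _).trans ?_
  calc _ ≤ √(r + n : ℝ) * (2 * √(r + n : ℝ)) :=
        mul_le_mul (norm_feat_le _ _) (norm_feat_sub_le _ _ _) (norm_nonneg _) (Real.sqrt_nonneg _)
    _ = 2 * (√(r + n : ℝ) * √(r + n : ℝ)) := by ring
    _ = _ := by rw [Real.mul_self_sqrt (by positivity)]

theorem abs_expB_le (ω : PairSample r n) (ω' : Sample r n) : |expB U V ω ω'| ≤ 2 * (r + n : ℝ) := by
  refine (abs_real_inner_le_norm _ _).trans ?_
  calc _ ≤ (2 * √(r + n : ℝ)) * √(r + n : ℝ) :=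
        mul_le_mul (norm_feat_sub_le _ _ _) (norm_feat_le _ _) (norm_nonneg _) (by positivity)
    _ = 2 * (√(r + n : ℝ) * √(r + n : ℝ)) := by ring
    _ = _ := by rw [Real.mul_self_sqrt (by positivity)]

/-- For constant weights `c`, only the correlation of the positive pair survives. -/
theorem gradH_const (c : ℝ) (p : Fin r) :
    (avg fun ω : PairSample r n × Sample r n =>
      (c * sgn ω.1.fstSide (.inl p)) • (feat V ω.2 - feat V ω.1.sndSide) +
      (c * (sgn ω.2 (.inl p) - sgn ω.1.fstSide (.inl p))) • feat V ω.1.sndSide) =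
    -((2 * c) • (frob V)⁻¹ • V (.inl p)) := by
  have e : ∀ ω : PairSample r n × Sample r n,
      (c * sgn ω.1.fstSide (.inl p)) • (feat V ω.2 - feat V ω.1.sndSide) +
      (c * (sgn ω.2 (.inl p) - sgn ω.1.fstSide (.inl p))) • feat V ω.1.sndSide =
      c • (sgn ω.1.fstSide (.inl p) • feat V ω.2 + sgn ω.2 (.inl p) • feat V ω.1.sndSide) -
      (2 * c) • (sgn ω.1.fstSide (.inl p) • feat V ω.1.sndSide) := fun ω => by module
  simp only [e]
  rw [avg_sub, avg_smul, avg_smul, avg_add,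
    avg_fst_smul_snd (fun ω : PairSample r n => sgn ω.fstSide (.inl p)),
    avg_snd_smul_fst (fun ω : PairSample r n => feat V ω.sndSide)
      (fun ω : Sample r n => sgn ω (.inl p)),
    avg_comp_fst (fun ω : PairSample r n => sgn ω.fstSide (.inl p) • feat V ω.sndSide),
    avg_pair_signal_feat]
  have h1 : avg (fun ω : PairSample r n => sgn ω.fstSide (.inl p)) = 0 := avg_pair_sgn_fst _
  rw [h1, avg_sgn]
  simp

theorem avg_inner_feat_left (v : E) : avg (fun ω : Sample r n => inner ℝ (feat U ω) v) = 0 := by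
  rw [← avg_inner, avg_feat, inner_zero_left]

theorem avg_inner_feat_right (v : E) : avg (fun ω : Sample r n => inner ℝ v (feat U ω)) = 0 := by
  rw [← inner_avg, avg_feat, inner_zero_right]

theorem gradR_const (c : ℝ) :
    (avg fun ω : PairSample r n × Sample r n => c * expA U V ω.1 ω.2 + c * expB U V ω.1 ω.2) =
    -(2 * c * corr U V) := by
  rw [avg_prod]
  have h : ∀ ω : PairSample r n, (avg fun ω' : Sample r n => c * expA U V ω ω' + c * expB U V ω ω') =
      (-(2 * c)) • inner ℝ (feat U ω.fstSide) (feat V ω.sndSide) := by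
    intro ω
    simp only [expA, expB, inner_sub_left, inner_sub_right, ← mul_add]
    simp only [← smul_eq_mul (a := c)]
    rw [avg_smul, avg_add, avg_sub, avg_sub, avg_inner_feat_left,
      avg_inner_feat_right, avg_const]
    simp only [smul_eq_mul]
    ring
  simp only [h]
  rw [avg_smul, avg_pair_inner_feat, corr, smul_eq_mul]
  ring

variable {K s : ℝ} (hK : 0 < K) (hs : 0 ≤ s) (hN : (1 : ℝ) ≤ r + n) (hsN : 8 * (r + n : ℝ) * s ≤ 1)

include hK hs hN hsN

theorem abs_wtA_sub_le (ω : PairSample r n × Sample r n) :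
    |wtA K s U V ω - K / (1 + K)| ≤ 8 * (r + n) * s * (K / (1 + K)) := by
  have h := abs_wt_sub_le (D₁ := fun ω' => s * expA U V ω.1 ω') (D₂ := fun _ => 0) hK
    (ϑ := s * (2 * (r + n))) (fun ω' => ?_) (by nlinarith) ω.2
  · rw [wt_zero] at h
    exact h.trans_eq (by ring)
  · rw [sub_zero, abs_mul, abs_of_nonneg hs]
    exact mul_le_mul_of_nonneg_left (abs_expA_le U V _ _) hs

theorem abs_wtB_sub_le (ω : PairSample r n × Sample r n) :
    |wtB K s U V ω - K / (1 + K)| ≤ 8 * (r + n) * s * (K / (1 + K)) := by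
  have h := abs_wt_sub_le (D₁ := fun ω' => s * expB U V ω.1 ω') (D₂ := fun _ => 0) hK
    (ϑ := s * (2 * (r + n))) (fun ω' => ?_) (by nlinarith) ω.2
  · rw [wt_zero] at h
    exact h.trans_eq (by ring)
  · rw [sub_zero, abs_mul, abs_of_nonneg hs]
    exact mul_le_mul_of_nonneg_left (abs_expB_le U V _ _) hs

theorem wtA_le (ω : PairSample r n × Sample r n) : wtA K s U V ω ≤ 2 * (K / (1 + K)) := by
  have h := (abs_le.1 (abs_wtA_sub_le U V hK hs hN hsN ω)).2
  have : 0 < K / (1 + K) := by positivity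
  nlinarith

theorem wtB_le (ω : PairSample r n × Sample r n) : wtB K s U V ω ≤ 2 * (K / (1 + K)) := by
  have h := (abs_le.1 (abs_wtB_sub_le U V hK hs hN hsN ω)).2
  have : 0 < K / (1 + K) := by positivity
  nlinarith

theorem norm_gradH_signal_le (p : Fin r) :
    ‖gradH K s U V (.inl p) + (2 * (K / (1 + K))) • (frob V)⁻¹ • V (.inl p)‖ ≤
      32 * (r + n) * s * (K / (1 + K)) * √(r + n : ℝ) := by
  rw [← sub_neg_eq_add, ← gradH_const, gradH, ← avg_sub]
  refine norm_avg_le fun ω => ?_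
  have e : ((wtA K s U V ω * sgn ω.1.fstSide (.inl p)) • (feat V ω.2 - feat V ω.1.sndSide) +
      (wtB K s U V ω * (sgn ω.2 (.inl p) - sgn ω.1.fstSide (.inl p))) • feat V ω.1.sndSide) -
      ((K / (1 + K) * sgn ω.1.fstSide (.inl p)) • (feat V ω.2 - feat V ω.1.sndSide) +
      (K / (1 + K) * (sgn ω.2 (.inl p) - sgn ω.1.fstSide (.inl p))) • feat V ω.1.sndSide) =
      ((wtA K s U V ω - K / (1 + K)) * sgn ω.1.fstSide (.inl p)) •
        (feat V ω.2 - feat V ω.1.sndSide) +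
      ((wtB K s U V ω - K / (1 + K)) * (sgn ω.2 (.inl p) - sgn ω.1.fstSide (.inl p))) •
        feat V ω.1.sndSide := by module
  rw [e]
  refine (norm_add_le _ _).trans ?_
  rw [norm_smul, norm_smul, Real.norm_eq_abs, Real.norm_eq_abs, abs_mul, abs_mul, abs_sgn, mul_one]
  have h1 := abs_wtA_sub_le U V hK hs hN hsN ω
  have h2 := abs_wtB_sub_le U V hK hs hN hsN ω
  have h3 := norm_feat_sub_le V ω.2 ω.1.sndSide
  have h4 := norm_feat_le V ω.1.sndSide
  have h5 : |sgn ω.2 (.inl p) - sgn ω.1.fstSide (.inl p)| ≤ 2 := by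
    refine (abs_sub _ _).trans ?_
    rw [abs_sgn, abs_sgn]
    norm_num
  calc _ ≤ 8 * (r + n) * s * (K / (1 + K)) * (2 * √(r + n : ℝ)) +
        8 * (r + n) * s * (K / (1 + K)) * 2 * √(r + n : ℝ) := by gcongr
    _ = _ := by ring

theorem abs_gradR_add_le :
    |gradR K s U V + 2 * (K / (1 + K)) * corr U V| ≤ 32 * (r + n) ^ 2 * s * (K / (1 + K)) := by
  rw [← sub_neg_eq_add, ← gradR_const, gradR, ← avg_sub, ← Real.norm_eq_abs]
  refine norm_avg_le fun ω => ?_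
  have e : wtA K s U V ω * expA U V ω.1 ω.2 + wtB K s U V ω * expB U V ω.1 ω.2 -
      (K / (1 + K) * expA U V ω.1 ω.2 + K / (1 + K) * expB U V ω.1 ω.2) =
      (wtA K s U V ω - K / (1 + K)) * expA U V ω.1 ω.2 +
      (wtB K s U V ω - K / (1 + K)) * expB U V ω.1 ω.2 := by ring
  rw [e, Real.norm_eq_abs]
  refine (abs_add_le _ _).trans ?_
  rw [abs_mul, abs_mul]
  have h1 := abs_wtA_sub_le U V hK hs hN hsN ω
  have h2 := abs_wtB_sub_le U V hK hs hN hsN ω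
  have h3 := abs_expA_le U V ω.1 ω.2
  have h4 := abs_expB_le U V ω.1 ω.2
  calc _ ≤ 8 * (r + n) * s * (K / (1 + K)) * (2 * (r + n)) +
        8 * (r + n) * s * (K / (1 + K)) * (2 * (r + n)) := by gcongr
    _ = _ := by ring

/-- Flipping a noise sign of the `A` side of the positive pair changes the weights little, in
proportion to the corresponding column. -/
theorem abs_wtA_flip_sub_le (q : Fin n) (ω : PairSample r n × Sample r n) :
    |wtA K s U V (flipPair (.inr q) ω.1, ω.2) - wtA K s U V ω| ≤
      32 * s * √(r + n : ℝ) * ‖(frob U)⁻¹ • U (.inr q)‖ * (K / (1 + K)) := by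
  have hu := norm_normalized_le U (.inr q)
  have hsq : √(r + n : ℝ) ≤ r + n := Real.sqrt_le_self_iff.2 (Or.inr hN)
  have h := abs_wt_sub_le (D₁ := fun ω' => s * expA U V (flipPair (.inr q) ω.1) ω')
    (D₂ := fun ω' => s * expA U V ω.1 ω') hK
    (ϑ := s * ((2 * ‖(frob U)⁻¹ • U (.inr q)‖) * (2 * √(r + n : ℝ)))) (fun ω' => ?_) ?_ ω.2
  · refine h.trans ?_
    have := wtA_le U V hK hs hN hsN ω
    calc _ ≤ 4 * (s * ((2 * ‖(frob U)⁻¹ • U (.inr q)‖) * (2 * √(r + n : ℝ)))) *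
          (2 * (K / (1 + K))) := mul_le_mul_of_nonneg_left this (by positivity)
      _ = _ := by ring
  · rw [← mul_sub, abs_mul, abs_of_nonneg hs]
    refine mul_le_mul_of_nonneg_left ?_ hs
    rw [expA, expA, sndSide_flipPair_inr, ← inner_sub_left, fstSide_flipPair]
    exact (abs_real_inner_le_norm _ _).trans (mul_le_mul (norm_feat_flip_sub_le _ _ _)
      (norm_feat_sub_le _ _ _) (norm_nonneg _) (by positivity))
  · have : s * (‖(frob U)⁻¹ • U (.inr q)‖ * √(r + n : ℝ)) ≤ s * (1 * (r + n)) := by gcongr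
    linarith

theorem abs_wtB_flip_fst_sub_le (q : Fin n) (ω : PairSample r n × Sample r n) :
    |wtB K s U V (flipPair (.inr q) ω.1, ω.2) - wtB K s U V ω| ≤
      16 * s * √(r + n : ℝ) * ‖(frob U)⁻¹ • U (.inr q)‖ * (K / (1 + K)) := by
  have hu := norm_normalized_le U (.inr q)
  have hsq : √(r + n : ℝ) ≤ r + n := Real.sqrt_le_self_iff.2 (Or.inr hN)
  have h := abs_wt_sub_le (D₁ := fun ω' => s * expB U V (flipPair (.inr q) ω.1) ω')
    (D₂ := fun ω' => s * expB U V ω.1 ω') hK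
    (ϑ := s * ((2 * ‖(frob U)⁻¹ • U (.inr q)‖) * √(r + n : ℝ))) (fun ω' => ?_) ?_ ω.2
  · refine h.trans ?_
    have := wtB_le U V hK hs hN hsN ω
    calc _ ≤ 4 * (s * ((2 * ‖(frob U)⁻¹ • U (.inr q)‖) * √(r + n : ℝ))) *
          (2 * (K / (1 + K))) := mul_le_mul_of_nonneg_left this (by positivity)
      _ = _ := by ring
  · rw [← mul_sub, abs_mul, abs_of_nonneg hs]
    refine mul_le_mul_of_nonneg_left ?_ hs
    rw [expB, expB, sndSide_flipPair_inr, ← inner_sub_left, fstSide_flipPair, sub_sub_sub_cancel_left]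
    refine (abs_real_inner_le_norm _ _).trans (mul_le_mul ?_ (norm_feat_le _ _) (norm_nonneg _)
      (by positivity))
    rw [norm_sub_rev]
    exact norm_feat_flip_sub_le _ _ _
  · have : s * (‖(frob U)⁻¹ • U (.inr q)‖ * √(r + n : ℝ)) ≤ s * (1 * (r + n)) := by gcongr
    have : 0 ≤ s * (r + n) := by positivity
    linarith

theorem abs_wtB_flip_snd_sub_le (q : Fin n) (ω : PairSample r n × Sample r n) :
    |wtB K s U V (ω.1, flipSample (.inr q) ω.2) - wtB K s U V ω| ≤
      16 * s * √(r + n : ℝ) * ‖(frob U)⁻¹ • U (.inr q)‖ * (K / (1 + K)) := by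
  have hu := norm_normalized_le U (.inr q)
  have hsq : √(r + n : ℝ) ≤ r + n := Real.sqrt_le_self_iff.2 (Or.inr hN)
  have e : wtB K s U V (ω.1, flipSample (.inr q) ω.2) =
      wt K (fun ω' => s * expB U V ω.1 (flipSample (.inr q) ω')) ω.2 :=
    wt_equiv (flipSample (.inr q)) _ _
  rw [e]
  have h := abs_wt_sub_le (D₁ := fun ω' => s * expB U V ω.1 (flipSample (.inr q) ω'))
    (D₂ := fun ω' => s * expB U V ω.1 ω') hK
    (ϑ := s * ((2 * ‖(frob U)⁻¹ • U (.inr q)‖) * √(r + n : ℝ))) (fun ω' => ?_) ?_ ω.2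
  · refine h.trans ?_
    have := wtB_le U V hK hs hN hsN ω
    calc _ ≤ 4 * (s * ((2 * ‖(frob U)⁻¹ • U (.inr q)‖) * √(r + n : ℝ))) *
          (2 * (K / (1 + K))) := mul_le_mul_of_nonneg_left this (by positivity)
      _ = _ := by ring
  · rw [← mul_sub, abs_mul, abs_of_nonneg hs]
    refine mul_le_mul_of_nonneg_left ?_ hs
    rw [expB, expB, ← inner_sub_left, sub_sub_sub_cancel_right]
    exact (abs_real_inner_le_norm _ _).trans (mul_le_mul (norm_feat_flip_sub_le _ _ _)
      (norm_feat_le _ _) (norm_nonneg _) (by positivity))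
  · have : s * (‖(frob U)⁻¹ • U (.inr q)‖ * √(r + n : ℝ)) ≤ s * (1 * (r + n)) := by gcongr
    have : 0 ≤ s * (r + n) := by positivity
    linarith

/-- On the noise columns the gradient is small in proportion to the column: without dependence of
the weights on a noise sign, its contribution would cancel. -/
theorem norm_gradH_noise_le (q : Fin n) :
    ‖gradH K s U V (.inr q)‖ ≤
      48 * s * (r + n) * ‖(frob U)⁻¹ • U (.inr q)‖ * (K / (1 + K)) := by
  have hmul : √(r + n : ℝ) * √(r + n : ℝ) = r + n := Real.mul_self_sqrt (by positivity)
  set ν := ‖(frob U)⁻¹ • U (.inr q)‖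
  have e : gradH K s U V (.inr q) =
      (avg fun ω : PairSample r n × Sample r n =>
        sgn ω.1.fstSide (.inr q) • (wtA K s U V ω • (feat V ω.2 - feat V ω.1.sndSide) -
          wtB K s U V ω • feat V ω.1.sndSide)) +
      avg fun ω : PairSample r n × Sample r n =>
        sgn ω.2 (.inr q) • (wtB K s U V ω • feat V ω.1.sndSide) := by
    rw [gradH, ← avg_add]
    exact congrArg avg (funext fun ω => by module)
  rw [e]
  refine (norm_add_le _ _).trans ?_
  have h1 : ‖avg fun ω : PairSample r n × Sample r n =>
        sgn ω.1.fstSide (.inr q) • (wtA K s U V ω • (feat V ω.2 - feat V ω.1.sndSide) -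
          wtB K s U V ω • feat V ω.1.sndSide)‖ ≤ 40 * s * (r + n) * ν * (K / (1 + K)) := by
    refine norm_avg_le_of_odd ((flipPair (.inr q)).prodCongr (Equiv.refl _)) fun ω => ?_
    have e1 : sgn (flipPair (.inr q) ω.1).fstSide (.inr q) = -sgn ω.1.fstSide (.inr q) := by
      rw [fstSide_flipPair, sgn_flipSample, if_pos rfl]
    simp only [Equiv.prodCongr_apply, Prod.map, Equiv.refl_apply, e1, sndSide_flipPair_inr]
    have e2 : ∀ (ς wa wa' wb wb' : ℝ) (f f' : E), ς • (wa • f - wb • f') + -ς • (wa' • f - wb' • f')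
        = ς • ((wb' - wb) • f' - (wa' - wa) • f) := fun ς wa wa' wb wb' f f' => by module
    rw [e2, norm_smul, Real.norm_eq_abs, abs_sgn, one_mul]
    refine (norm_sub_le _ _).trans ?_
    rw [norm_smul, norm_smul, Real.norm_eq_abs, Real.norm_eq_abs]
    have h2 := abs_wtA_flip_sub_le U V hK hs hN hsN q ω
    have h3 := abs_wtB_flip_fst_sub_le U V hK hs hN hsN q ω
    have h4 := norm_feat_sub_le V ω.2 ω.1.sndSide
    have h5 := norm_feat_le V ω.1.sndSide
    calc _ ≤ (16 * s * √(r + n : ℝ) * ν * (K / (1 + K))) * √(r + n : ℝ) +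
          (32 * s * √(r + n : ℝ) * ν * (K / (1 + K))) * (2 * √(r + n : ℝ)) := by gcongr
      _ = 2 * (40 * s * (√(r + n : ℝ) * √(r + n : ℝ)) * ν * (K / (1 + K))) := by ring
      _ = _ := by rw [hmul]
  have h2 : ‖avg fun ω : PairSample r n × Sample r n =>
        sgn ω.2 (.inr q) • (wtB K s U V ω • feat V ω.1.sndSide)‖ ≤
      8 * s * (r + n) * ν * (K / (1 + K)) := by
    refine norm_avg_le_of_odd ((Equiv.refl _).prodCongr (flipSample (.inr q))) fun ω => ?_
    have e1 : sgn (flipSample (.inr q) ω.2) (.inr q) = -sgn ω.2 (.inr q) := by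
      rw [sgn_flipSample, if_pos rfl]
    simp only [Equiv.prodCongr_apply, Prod.map, Equiv.refl_apply, e1]
    have e2 : ∀ (ς wb wb' : ℝ) (f' : E), ς • (wb • f') + -ς • (wb' • f')
        = ς • (-((wb' - wb) • f')) := fun ς wb wb' f' => by module
    rw [e2, norm_smul, Real.norm_eq_abs, abs_sgn, one_mul, norm_neg, norm_smul, Real.norm_eq_abs]
    have h3 := abs_wtB_flip_snd_sub_le U V hK hs hN hsN q ω
    have h5 := norm_feat_le V ω.1.sndSide
    calc _ ≤ (16 * s * √(r + n : ℝ) * ν * (K / (1 + K))) * √(r + n : ℝ) := by gcongr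
      _ = 2 * (8 * s * (√(r + n : ℝ) * √(r + n : ℝ)) * ν * (K / (1 + K))) := by ring
      _ = _ := by rw [hmul]
  linarith

/-- The gradient in a signal column `U p` at small `s`: the weights of the negatives are nearly
`K / (1 + K)`, which leaves attraction by `V p` and a decay from the normalization. -/
theorem norm_colGrad_signal_le (p : Fin r) :
    ‖-colGrad K s U V (.inl p) - (frob U)⁻¹ • ((2 * (K / (1 + K))) • (frob V)⁻¹ • V (.inl p) -
        (2 * (K / (1 + K)) * corr U V) • (frob U)⁻¹ • U (.inl p))‖ ≤
      (frob U)⁻¹ * (80 * (r + n) ^ 2 * s * (K / (1 + K))) := by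
  have hu := norm_normalized_le U (.inl p)
  have h1 := norm_gradH_signal_le U V hK hs hN hsN p
  have h2 := abs_gradR_add_le U V hK hs hN hsN
  have hsq : √(r + n : ℝ) ≤ r + n := Real.sqrt_le_self_iff.2 (Or.inr hN)
  have hw : 0 < K / (1 + K) := by positivity
  have e : -colGrad K s U V (.inl p) - (frob U)⁻¹ • ((2 * (K / (1 + K))) • (frob V)⁻¹ • V (.inl p) -
        (2 * (K / (1 + K)) * corr U V) • (frob U)⁻¹ • U (.inl p)) =
      (frob U)⁻¹ • ((gradR K s U V + 2 * (K / (1 + K)) * corr U V) • (frob U)⁻¹ • U (.inl p) -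
        (gradH K s U V (.inl p) + (2 * (K / (1 + K))) • (frob V)⁻¹ • V (.inl p))) := by
    rw [colGrad]; module
  rw [e, norm_smul, norm_inv, Real.norm_of_nonneg (frob_nonneg U)]
  refine mul_le_mul_of_nonneg_left ((norm_sub_le _ _).trans ?_) (inv_nonneg.2 (frob_nonneg U))
  rw [norm_smul (_ + _), Real.norm_eq_abs]
  calc _ ≤ 32 * (r + n) ^ 2 * s * (K / (1 + K)) * 1 + 32 * (r + n) * s * (K / (1 + K)) * (r + n) := by
        gcongr
        exact h1.trans (by gcongr)
    _ = 64 * ((r + n) ^ 2 * s * (K / (1 + K))) := by ring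
    _ ≤ 80 * ((r + n) ^ 2 * s * (K / (1 + K))) := by gcongr; norm_num
    _ = _ := by ring

/-- The gradient in a noise column at small `s` is the decay from the normalization. The error is
proportional to the column. -/
theorem norm_colGrad_noise_le (q : Fin n) :
    ‖-colGrad K s U V (.inr q) +
        (frob U)⁻¹ • (2 * (K / (1 + K)) * corr U V) • (frob U)⁻¹ • U (.inr q)‖ ≤
      (frob U)⁻¹ * (80 * (r + n) ^ 2 * s * (K / (1 + K)) * ‖(frob U)⁻¹ • U (.inr q)‖) := by
  have h1 := norm_gradH_noise_le U V hK hs hN hsN q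
  have h2 := abs_gradR_add_le U V hK hs hN hsN
  have hw : 0 < K / (1 + K) := by positivity
  have e : -colGrad K s U V (.inr q) +
        (frob U)⁻¹ • (2 * (K / (1 + K)) * corr U V) • (frob U)⁻¹ • U (.inr q) =
      (frob U)⁻¹ • ((gradR K s U V + 2 * (K / (1 + K)) * corr U V) • (frob U)⁻¹ • U (.inr q) -
        gradH K s U V (.inr q)) := by
    rw [colGrad]; module
  rw [e, norm_smul, norm_inv, Real.norm_of_nonneg (frob_nonneg U)]
  refine mul_le_mul_of_nonneg_left ((norm_sub_le _ _).trans ?_) (inv_nonneg.2 (frob_nonneg U))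
  rw [norm_smul (_ + _), Real.norm_eq_abs]
  set ν := ‖(frob U)⁻¹ • U (.inr q)‖
  have h3 : (r + n : ℝ) ≤ (r + n) ^ 2 := by nlinarith
  calc _ ≤ 32 * (r + n) ^ 2 * s * (K / (1 + K)) * ν + 48 * s * (r + n) ^ 2 * ν * (K / (1 + K)) := by
        refine add_le_add (by gcongr) (h1.trans (by gcongr))
    _ = _ := by ring

end Expansion

end Contrastive

end

noncomputable section

namespace Contrastive

open Set

set_option linter.unusedSectionVars false

/-! ### From weights to columns -/

section Columns

variable {d r m : ℕ}

/-- The columns of `Wᵀ Φ`, where `Φ` consists of the signal and the noise encoders. -/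
def cols {ι : Type*} (W : Matrix (Fin d) (Fin m) ℝ) (Φ : Matrix (Fin d) ι ℝ) (j : ι) :
    EuclideanSpace ℝ (Fin m) :=
  WithLp.toLp 2 fun k => ∑ i, Φ i j * W i k

@[simp] theorem cols_apply {ι : Type*} (W : Matrix (Fin d) (Fin m) ℝ) (Φ : Matrix (Fin d) ι ℝ)
    (j : ι) (k : Fin m) : cols W Φ j k = ∑ i, Φ i j * W i k := rfl

theorem column_transpose_mul {n : ℕ} (W : Matrix (Fin d) (Fin m) ℝ) (M : Matrix (Fin d) (Fin n) ℝ)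
    (p : Fin n) : column (Wᵀ * M) p = cols W M p := by
  ext k
  simp [column, Matrix.mul_apply, mul_comm]

theorem lin_apply {n : ℕ} (U : Fin r ⊕ Fin n → EuclideanSpace ℝ (Fin m)) (ω : Sample r n)
    (k : Fin m) : lin U ω k = ∑ j, sgn ω j * U j k := by
  simp [lin, -Fintype.sum_sum_type]

theorem rawOutput_eq (M : Matrix (Fin d) (Fin r) ℝ) (Mξ : Matrix (Fin d) (Fin (d - r)) ℝ)
    (W : Matrix (Fin d) (Fin m) ℝ) (z : SignVec r) (ξ : SignVec (d - r)) :
    rawOutput M Mξ W z ξ = (√(d : ℝ))⁻¹ • lin (cols W (Matrix.fromCols M Mξ)) (z, ξ) := by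
  ext k
  rw [PiLp.smul_apply, lin_apply]
  simp only [rawOutput, encode, latent, Matrix.mulVec, dotProduct, Matrix.transpose_apply,
    Pi.add_apply, smul_eq_mul, Fintype.sum_sum_type, sgn, Sum.elim_inl, Sum.elim_inr, cols_apply,
    Matrix.fromCols_apply_inl, Matrix.fromCols_apply_inr, mul_add, Finset.mul_sum,
    Finset.sum_add_distrib]
  congr 1 <;>
  · rw [Finset.sum_comm]
    exact Finset.sum_congr rfl fun _ _ => Finset.sum_congr rfl fun _ _ => by ring

theorem feature_eq (hd : 0 < d) (M : Matrix (Fin d) (Fin r) ℝ) (Mξ : Matrix (Fin d) (Fin (d - r)) ℝ)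
    (W : Matrix (Fin d) (Fin m) ℝ) (z : SignVec r) (ξ : SignVec (d - r)) :
    feature M Mξ W z ξ = feat (cols W (Matrix.fromCols M Mξ)) (z, ξ) := by
  have hd' : 0 < √(d : ℝ) := Real.sqrt_pos.2 (by exact_mod_cast hd)
  set U := cols W (Matrix.fromCols M Mξ)
  have h1 : (𝔼 z' : SignVec r, 𝔼 ξ' : SignVec (d - r), ‖rawOutput M Mξ W z' ξ'‖ ^ 2) =
      ((√(d : ℝ))⁻¹ * frob U) ^ 2 := by
    simp only [← avg_eq_expect]
    rw [← avg_prod fun ω : Sample r (d - r) => ‖rawOutput M Mξ W ω.1 ω.2‖ ^ 2]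
    simp only [rawOutput_eq, norm_smul, mul_pow]
    rw [← smul_eq_mul, frob_sq, ← avg_norm_lin_sq, ← avg_smul]
    simp [U]
  rw [feature, h1, Real.sqrt_sq (mul_nonneg (by positivity) (frob_nonneg U)), rawOutput_eq, feat,
    smul_smul, mul_inv, inv_inv, mul_right_comm, mul_inv_cancel₀ hd'.ne', one_mul]

variable (D : DataModel d r) (K τ : ℝ) (WA WB : Matrix (Fin d) (Fin m) ℝ)

/-- All encoders of the `A` side. -/
def DataModel.encA : Matrix (Fin d) (Fin r ⊕ Fin (d - r)) ℝ := Matrix.fromCols D.A D.Aξ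

/-- All encoders of the `B` side. -/
def DataModel.encB : Matrix (Fin d) (Fin r ⊕ Fin (d - r)) ℝ := Matrix.fromCols D.B D.Bξ

/-- Dividing by the exponential of the positive pair, only differences of exponents remain. -/
theorem neg_log_softmax_eq {Ω : Type*} [Fintype Ω] {K : ℝ} (hK : 0 < K) (c : ℝ) (f : Ω → ℝ) :
    -Real.log (Real.exp c / (Real.exp c + K * avg fun ω => Real.exp (f ω))) =
      Real.log (1 + K * avg fun ω => Real.exp (f ω - c)) := by
  have h : (avg fun ω => Real.exp (f ω)) = Real.exp c * avg fun ω => Real.exp (f ω - c) := by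
    rw [← smul_eq_mul (Real.exp c), ← avg_smul]
    refine congrArg avg (funext fun ω => ?_)
    rw [smul_eq_mul, ← Real.exp_add]
    congr 1
    ring
  have h2 := wt_den_pos hK fun ω => f ω - c
  have e : Real.exp c + K * (Real.exp c * avg fun ω => Real.exp (f ω - c)) =
      Real.exp c * (1 + K * avg fun ω => Real.exp (f ω - c)) := by ring
  rw [h, e, div_mul_cancel_left₀ (Real.exp_pos c).ne', Real.log_inv, neg_neg]

theorem loss_eq (hd : 0 < d) (hK : 0 < K) :
    loss D K τ WA WB = colLoss K (τ ^ 2) (cols WA D.encA) (cols WB D.encB) := by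
  have hA : ∀ z ξA ξB, -Real.log (SA D K τ WA WB z ξA ξB) =
      Real.log (1 + K * avg fun ω' : Sample r (d - r) =>
        Real.exp (τ ^ 2 * expA (cols WA D.encA) (cols WB D.encB) (z, ξA, ξB) ω')) := by
    intro z ξA ξB
    simp only [SA, feature_eq hd, ← avg_eq_expect]
    rw [← avg_prod fun ω' : Sample r (d - r) => Real.exp (τ ^ 2 * inner ℝ
      (feat (cols WA (Matrix.fromCols D.A D.Aξ)) (z, ξA))
      (feat (cols WB (Matrix.fromCols D.B D.Bξ)) (ω'.1, ω'.2))), neg_log_softmax_eq hK]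
    simp only [← mul_sub, ← inner_sub_right]
    rfl
  have hB : ∀ z ξA ξB, -Real.log (SB D K τ WA WB z ξA ξB) =
      Real.log (1 + K * avg fun ω' : Sample r (d - r) =>
        Real.exp (τ ^ 2 * expB (cols WA D.encA) (cols WB D.encB) (z, ξA, ξB) ω')) := by
    intro z ξA ξB
    simp only [SB, feature_eq hd, ← avg_eq_expect]
    rw [← avg_prod fun ω' : Sample r (d - r) => Real.exp (τ ^ 2 * inner ℝ
      (feat (cols WA (Matrix.fromCols D.A D.Aξ)) (ω'.1, ω'.2))
      (feat (cols WB (Matrix.fromCols D.B D.Bξ)) (z, ξB))), neg_log_softmax_eq hK]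
    simp only [← mul_sub, ← inner_sub_left]
    rfl
  rw [loss, sub_eq_add_neg, colLoss, avg_add]
  simp only [← avg_eq_expect, ← avg_neg, hA, hB]
  rw [avg_prod, avg_prod]
  simp only [avg_prod (Ω := SignVec (d - r)) (Ω' := SignVec (d - r))]

theorem cols_add_single {ι : Type*} (W : Matrix (Fin d) (Fin m) ℝ) (Φ : Matrix (Fin d) ι ℝ)
    (i : Fin d) (k : Fin m) (x : ℝ) :
    cols (W + x • Matrix.single i k 1) Φ =
      cols W Φ + x • fun j => Φ i j • EuclideanSpace.single k (1 : ℝ) := by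
  funext j
  ext k'
  simp only [cols_apply, Matrix.add_apply, Matrix.smul_apply, Matrix.single_apply, smul_eq_mul,
    mul_add, Finset.sum_add_distrib, Pi.add_apply, Pi.smul_apply, PiLp.add_apply, PiLp.smul_apply,
    PiLp.single_apply]
  congr 1
  rcases eq_or_ne k k' with h | h
  · subst h; simp [mul_comm]
  · simp [h, h.symm]

theorem deriv_colLoss_entry {K s : ℝ} (hK : 0 < K) (W : Matrix (Fin d) (Fin m) ℝ)
    (Φ : Matrix (Fin d) (Fin r ⊕ Fin (d - r)) ℝ)
    (V : Fin r ⊕ Fin (d - r) → EuclideanSpace ℝ (Fin m)) (hU : 0 < frob (cols W Φ))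
    (i : Fin d) (k : Fin m) :
    deriv (fun x : ℝ => colLoss K s (cols (W + x • Matrix.single i k 1) Φ) V) 0 =
      s * ∑ j, Φ i j * colGrad K s (cols W Φ) V j k := by
  simp only [cols_add_single]
  rw [(hasDerivAt_colLoss hK s _ V _ hU).deriv]
  simp [real_inner_smul_right, EuclideanSpace.inner_single_right]

theorem gradA_eq (hd : 0 < d) (hK : 0 < K) (hU : 0 < frob (cols WA D.encA)) (i : Fin d)
    (k : Fin m) : gradA D K τ WA WB i k =
      τ ^ 2 * ∑ j, D.encA i j * colGrad K (τ ^ 2) (cols WA D.encA) (cols WB D.encB) j k := by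
  rw [gradA, Matrix.of_apply]
  simp only [loss_eq D K τ _ _ hd hK]
  exact deriv_colLoss_entry hK WA D.encA _ hU i k

theorem gradB_eq (hd : 0 < d) (hK : 0 < K) (hU : 0 < frob (cols WB D.encB)) (i : Fin d)
    (k : Fin m) : gradB D K τ WA WB i k =
      τ ^ 2 * ∑ j, D.encB i j * colGrad K (τ ^ 2) (cols WB D.encB) (cols WA D.encA) j k := by
  rw [gradB, Matrix.of_apply]
  simp only [loss_eq D K τ _ _ hd hK]
  simp only [← colLoss_swap K (τ ^ 2) (cols WA _)]
  exact deriv_colLoss_entry hK WB D.encB _ hU i k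

/-- The squared singular values of the encoders. -/
def DataModel.sq : Fin r ⊕ Fin (d - r) → ℝ := Sum.elim (fun p => D.σ p ^ 2) fun _ => D.σξ ^ 2

theorem gram_fromCols {M : Matrix (Fin d) (Fin r) ℝ} {Mξ : Matrix (Fin d) (Fin (d - r)) ℝ}
    (h1 : Mᵀ * M = Matrix.diagonal fun p => D.σ p ^ 2)
    (h2 : Mξᵀ * Mξ = D.σξ ^ 2 • (1 : Matrix (Fin (d - r)) (Fin (d - r)) ℝ)) (h3 : Mᵀ * Mξ = 0)
    (j j' : Fin r ⊕ Fin (d - r)) :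
    ∑ i, Matrix.fromCols M Mξ i j * Matrix.fromCols M Mξ i j' = if j = j' then D.sq j else 0 := by
  have h3' : Mξᵀ * M = 0 := by
    have := congrArg Matrix.transpose h3
    simpa using this
  rcases j with p | q <;> rcases j' with p' | q'
  · have := congrFun (congrFun h1 p) p'
    simpa [Matrix.mul_apply, Matrix.diagonal_apply, DataModel.sq] using this
  · have := congrFun (congrFun h3 p) q'
    simpa [Matrix.mul_apply] using this
  · have := congrFun (congrFun h3' q) p'
    simpa [Matrix.mul_apply] using this
  · have := congrFun (congrFun h2 q) q'
    simpa [Matrix.mul_apply, Matrix.one_apply, DataModel.sq] using this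

theorem DataModel.encA_gram (j j' : Fin r ⊕ Fin (d - r)) :
    ∑ i, D.encA i j * D.encA i j' = if j = j' then D.sq j else 0 :=
  gram_fromCols D D.A_gram D.Aξ_gram D.A_orth j j'

theorem DataModel.encB_gram (j j' : Fin r ⊕ Fin (d - r)) :
    ∑ i, D.encB i j * D.encB i j' = if j = j' then D.sq j else 0 :=
  gram_fromCols D D.B_gram D.Bξ_gram D.B_orth j j'

/-- The columns of `Wᵀ Φ` move along their own gradients, at a speed given by the squared singular
values, because the columns of `Φ` are orthogonal. -/
theorem cols_grad_eq {s : ℝ} (hs : s ≠ 0) {Φ : Matrix (Fin d) (Fin r ⊕ Fin (d - r)) ℝ}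
    (hΦ : ∀ j j', ∑ i, Φ i j * Φ i j' = if j = j' then D.sq j else 0)
    {G : Matrix (Fin d) (Fin m) ℝ} {g : Fin r ⊕ Fin (d - r) → EuclideanSpace ℝ (Fin m)}
    (hG : ∀ i k, G i k = s * ∑ j, Φ i j * g j k) (j : Fin r ⊕ Fin (d - r)) :
    cols (-s⁻¹ • G) Φ j = -(D.sq j • g j) := by
  ext k
  simp only [cols_apply, Matrix.smul_apply, hG, smul_eq_mul, PiLp.neg_apply, PiLp.smul_apply]
  have e : ∀ i, Φ i j * (-s⁻¹ * (s * ∑ j', Φ i j' * g j' k)) =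
      -∑ j', (Φ i j * Φ i j') * g j' k := by
    intro i
    rw [neg_mul, inv_mul_cancel_left₀ hs, mul_neg, Finset.mul_sum]
    simp only [mul_assoc]
  simp only [e, Finset.sum_neg_distrib]
  rw [Finset.sum_comm]
  simp [← Finset.sum_mul, hΦ]

theorem hasDerivWithinAt_cols {ι : Type*} {W : ℝ → Matrix (Fin d) (Fin m) ℝ}
    {W' : Matrix (Fin d) (Fin m) ℝ} {S : Set ℝ} {t : ℝ}
    (h : ∀ i k, HasDerivWithinAt (fun s => W s i k) (W' i k) S t) (Φ : Matrix (Fin d) ι ℝ) (j : ι) :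
    HasDerivWithinAt (fun s => cols (W s) Φ j) (cols W' Φ j) S t := by
  have h1 : HasDerivWithinAt (fun s k => ∑ i, Φ i j * W s i k) (fun k => ∑ i, Φ i j * W' i k) S t :=
    hasDerivWithinAt_pi.2 fun k => HasDerivWithinAt.fun_sum fun i _ => (h i k).const_mul _
  exact (PiLp.hasFDerivAt_toLp (𝕜 := ℝ) 2 _).comp_hasDerivWithinAt t h1

end Columns

/-! ### The flow of the columns -/

section MatFlow

variable {d r m : ℕ} (D : DataModel d r) (K τ : ℝ) (WA WB : ℝ → Matrix (Fin d) (Fin m) ℝ)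

/-- The factor that normalizes the smallest singular value to one. -/
def DataModel.scale : ℝ := (√D.sigmaMinSq)⁻¹

/-- The trajectories of the columns along a gradient flow, normalized by the smallest singular
value. -/
def matFlow : Flow (Fin r) (Fin (d - r)) (EuclideanSpace ℝ (Fin m)) where
  a p t := D.scale • cols (WA t) D.encA (.inl p)
  b p t := D.scale • cols (WB t) D.encB (.inl p)
  x q t := D.scale • cols (WA t) D.encA (.inr q)
  y q t := D.scale • cols (WB t) D.encB (.inr q)
  a' p t := D.scale • cols (-(τ ^ 2)⁻¹ • gradA D K τ (WA t) (WB t)) D.encA (.inl p)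
  b' p t := D.scale • cols (-(τ ^ 2)⁻¹ • gradB D K τ (WA t) (WB t)) D.encB (.inl p)
  x' q t := D.scale • cols (-(τ ^ 2)⁻¹ • gradA D K τ (WA t) (WB t)) D.encA (.inr q)
  y' q t := D.scale • cols (-(τ ^ 2)⁻¹ • gradB D K τ (WA t) (WB t)) D.encB (.inr q)
  lam p := D.σ p ^ 2 * D.scale ^ 2
  lamx := D.σξ ^ 2 * D.scale ^ 2
  η := 2 * (K / (1 + K))

theorem sqrt_sum_smul_eq {r n : ℕ} {E : Type*} [NormedAddCommGroup E] [InnerProductSpace ℝ E]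
    {c : ℝ} (hc : 0 < c) (U : Fin r ⊕ Fin n → E) :
    √(∑ p, ‖c • U (.inl p)‖ ^ 2 + ∑ q, ‖c • U (.inr q)‖ ^ 2) = c * frob U := by
  simp only [norm_smul, mul_pow, ← Finset.mul_sum, ← mul_add, ← Fintype.sum_sum_type
    (fun i => ‖U i‖ ^ 2), Real.norm_eq_abs, abs_of_pos hc]
  rw [Real.sqrt_mul (sq_nonneg c), Real.sqrt_sq hc.le, frob]

theorem corr_comm {r n : ℕ} {E : Type*} [NormedAddCommGroup E] [InnerProductSpace ℝ E]
    (U V : Fin r ⊕ Fin n → E) : corr V U = corr U V := by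
  simp only [corr, mul_comm (frob V), real_inner_comm]

theorem DataModel.sigmaMinSq_pos (hr : 1 ≤ r) : 0 < D.sigmaMinSq := by
  have : Nonempty (Fin r) := ⟨⟨0, hr⟩⟩
  refine lt_min ?_ (pow_pos D.σξ_pos 2)
  obtain ⟨p, hp⟩ := exists_eq_ciInf_of_finite (f := fun p => D.σ p ^ 2)
  rw [← hp]
  exact pow_pos (D.σ_pos p) 2

theorem DataModel.scale_pos (hr : 1 ≤ r) : 0 < D.scale :=
  inv_pos.2 (Real.sqrt_pos.2 (D.sigmaMinSq_pos hr))

theorem DataModel.scale_sq (hr : 1 ≤ r) : D.scale ^ 2 = (D.sigmaMinSq)⁻¹ := by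
  rw [DataModel.scale, inv_pow, Real.sq_sqrt (D.sigmaMinSq_pos hr).le]

theorem matFlow_nA (hc : 0 < D.scale) (t : ℝ) :
    (matFlow D K τ WA WB).nA t = D.scale * frob (cols (WA t) D.encA) :=
  sqrt_sum_smul_eq hc _

theorem matFlow_nB (hc : 0 < D.scale) (t : ℝ) :
    (matFlow D K τ WA WB).nB t = D.scale * frob (cols (WB t) D.encB) :=
  sqrt_sum_smul_eq hc _

theorem matFlow_ρ (hc : 0 < D.scale) (t : ℝ) :
    (matFlow D K τ WA WB).ρ t = corr (cols (WA t) D.encA) (cols (WB t) D.encB) := by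
  rw [Flow.ρ, matFlow_nA _ _ _ _ _ hc, matFlow_nB _ _ _ _ _ hc, corr]
  simp only [matFlow, real_inner_smul_left, real_inner_smul_right, ← Finset.mul_sum]
  rw [← mul_assoc, mul_mul_mul_comm, mul_div_mul_left _ _ (by positivity)]

section Errors

variable {r n : ℕ} {E : Type*} [NormedAddCommGroup E] [InnerProductSpace ℝ E]
  {U V : Fin r ⊕ Fin n → E} {K s c l ε : ℝ}

/-- The gradient estimate on the signal columns, in normalized form. -/
theorem signal_velocity_le (hK : 0 < K) (hs : 0 ≤ s) (hN : (1 : ℝ) ≤ r + n)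
    (hsN : 8 * (r + n : ℝ) * s ≤ 1) (hε : 40 * (r + n : ℝ) ^ 2 * s ≤ ε) (hc : 0 < c) (hl : 0 ≤ l)
    (hU : 0 < frob U) (hV : 0 < frob V) (p : Fin r) :
    ‖c • -(l • colGrad K s U V (.inl p)) - (l * c ^ 2) •
        ((2 * (K / (1 + K)) / (c * frob U * (c * frob V))) • c • V (.inl p) -
        (2 * (K / (1 + K)) / (c * frob U * (c * frob V)) * corr U V *
          (c * frob V / (c * frob U))) • c • U (.inl p))‖ ≤
      l * c ^ 2 * (ε * (2 * (K / (1 + K)) / (c * frob U * (c * frob V))) * (c * frob V)) := by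
  have h := norm_colGrad_signal_le U V hK hs hN hsN p
  have hw : 0 < K / (1 + K) := by positivity
  set w := K / (1 + K)
  set f := frob U
  set f' := frob V
  have e : c • -(l • colGrad K s U V (.inl p)) - (l * c ^ 2) •
        ((2 * w / (c * f * (c * f'))) • c • V (.inl p) -
        (2 * w / (c * f * (c * f')) * corr U V * (c * f' / (c * f))) • c • U (.inl p)) =
      (c * l) • (-colGrad K s U V (.inl p) - f⁻¹ • ((2 * w) • f'⁻¹ • V (.inl p) -
        (2 * w * corr U V) • f⁻¹ • U (.inl p))) := by
    match_scalars <;> field_simp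
  rw [e, norm_smul, Real.norm_of_nonneg (by positivity)]
  calc _ ≤ c * l * (f⁻¹ * (80 * (r + n) ^ 2 * s * w)) := by gcongr
    _ = c * l * (f⁻¹ * ((40 * (r + n) ^ 2 * s) * (2 * w))) := by ring
    _ ≤ c * l * (f⁻¹ * (ε * (2 * w))) := by gcongr
    _ = _ := by field_simp

/-- The gradient estimate on the noise columns, in normalized form. -/
theorem noise_velocity_le (hK : 0 < K) (hs : 0 ≤ s) (hN : (1 : ℝ) ≤ r + n)
    (hsN : 8 * (r + n : ℝ) * s ≤ 1) (hε : 40 * (r + n : ℝ) ^ 2 * s ≤ ε) (hc : 0 < c) (hl : 0 ≤ l)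
    (hU : 0 < frob U) (hV : 0 < frob V) (q : Fin n) :
    ‖c • -(l • colGrad K s U V (.inr q)) - (l * c ^ 2) •
        (-(2 * (K / (1 + K)) / (c * frob U * (c * frob V)) * corr U V *
          (c * frob V / (c * frob U))) • c • U (.inr q))‖ ≤
      l * c ^ 2 * (ε * (2 * (K / (1 + K)) / (c * frob U * (c * frob V))) *
        (c * frob V / (c * frob U)) * ‖c • U (.inr q)‖) := by
  have h := norm_colGrad_noise_le U V hK hs hN hsN q
  have hw : 0 < K / (1 + K) := by positivity
  set w := K / (1 + K)
  set f := frob U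
  set f' := frob V
  have e : c • -(l • colGrad K s U V (.inr q)) - (l * c ^ 2) •
        (-(2 * w / (c * f * (c * f')) * corr U V * (c * f' / (c * f))) • c • U (.inr q)) =
      (c * l) • (-colGrad K s U V (.inr q) + f⁻¹ • (2 * w * corr U V) • f⁻¹ • U (.inr q)) := by
    match_scalars <;> field_simp
  rw [norm_smul, norm_inv, Real.norm_of_nonneg hU.le] at h
  rw [e, norm_smul, norm_smul, Real.norm_of_nonneg (by positivity), Real.norm_of_nonneg hc.le]
  calc _ ≤ c * l * (f⁻¹ * (80 * (r + n) ^ 2 * s * w * (f⁻¹ * ‖U (.inr q)‖))) := by gcongr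
    _ = c * l * (f⁻¹ * ((40 * (r + n) ^ 2 * s) * (2 * w) * (f⁻¹ * ‖U (.inr q)‖))) := by ring
    _ ≤ c * l * (f⁻¹ * (ε * (2 * w) * (f⁻¹ * ‖U (.inr q)‖))) := by gcongr
    _ = _ := by field_simp

end Errors

variable {D K τ WA WB}

/-- Along the gradient flow the columns follow the infinite-temperature flow up to an error of
order `d² τ²`. -/
theorem isPerturbed_matFlow {ε : ℝ} (hr : 1 ≤ r) (hrd : r ≤ d) (hK : 0 < K) (hτ : 0 < τ)
    (hsmall : 8 * (d : ℝ) * τ ^ 2 ≤ 1) (hε : 40 * (d : ℝ) ^ 2 * τ ^ 2 ≤ ε)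
    (hflow : IsGradientFlow D K τ WA WB) : (matFlow D K τ WA WB).IsPerturbed ε := by
  have hd : 0 < d := by omega
  have hc := D.scale_pos hr
  have hs : 0 ≤ τ ^ 2 := by positivity
  have hs' : τ ^ 2 ≠ 0 := by positivity
  have hsum : (r : ℝ) + (d - r : ℕ) = d := by rw [Nat.cast_sub hrd]; ring
  have hN : (1 : ℝ) ≤ (r : ℝ) + (d - r : ℕ) := by rw [hsum]; exact_mod_cast hd
  rw [← hsum] at hsmall hε
  have hdA : ∀ j t, 0 ≤ t → HasDerivWithinAt (fun t => D.scale • cols (WA t) D.encA j)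
      (D.scale • cols (-(τ ^ 2)⁻¹ • gradA D K τ (WA t) (WB t)) D.encA j) (Ici 0) t :=
    fun j t ht => (hasDerivWithinAt_cols (W' := -(τ ^ 2)⁻¹ • gradA D K τ (WA t) (WB t))
      (fun i k => (hflow t ht i k).1) _ _).fun_const_smul _
  have hdB : ∀ j t, 0 ≤ t → HasDerivWithinAt (fun t => D.scale • cols (WB t) D.encB j)
      (D.scale • cols (-(τ ^ 2)⁻¹ • gradB D K τ (WA t) (WB t)) D.encB j) (Ici 0) t :=
    fun j t ht => (hasDerivWithinAt_cols (W' := -(τ ^ 2)⁻¹ • gradB D K τ (WA t) (WB t))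
      (fun i k => (hflow t ht i k).2) _ _).fun_const_smul _
  refine ⟨fun p => hdA _, fun p => hdB _, fun q => hdA _, fun q => hdB _, ?_, ?_, ?_, ?_⟩
  all_goals
    intro j t ht hA hB
    simp only [Flow.α, matFlow_nA D K τ WA WB hc, matFlow_nB D K τ WA WB hc,
      matFlow_ρ D K τ WA WB hc] at hA hB ⊢
    have hU := pos_of_mul_pos_right hA hc.le
    have hV := pos_of_mul_pos_right hB hc.le
    have eA := cols_grad_eq D hs' D.encA_gram (gradA_eq D K τ (WA t) (WB t) hd hK hU)
    have eB := cols_grad_eq D hs' D.encB_gram (gradB_eq D K τ (WA t) (WB t) hd hK hV)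
    simp only [matFlow, eA, eB]
  · exact signal_velocity_le hK hs hN hsmall hε hc (sq_nonneg _) hU hV j
  · rw [← corr_comm, mul_comm (D.scale * frob (cols (WA t) D.encA))]
    exact signal_velocity_le hK hs hN hsmall hε hc (sq_nonneg _) hV hU j
  · exact noise_velocity_le hK hs hN hsmall hε hc (sq_nonneg _) hU hV j
  · rw [← corr_comm, mul_comm (D.scale * frob (cols (WA t) D.encA))]
    exact noise_velocity_le hK hs hN hsmall hε hc (sq_nonneg _) hV hU j

end MatFlow

/-! ### Concentration of the initial weights -/

section Concentration

open MeasureTheory ProbabilityTheory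

variable {ι : Type*} [Fintype ι] {m : ℕ}

theorem iIndepFun_entries (μ : Measure ℝ) [IsProbabilityMeasure μ] :
    iIndepFun (fun (e : ι × Fin m) (w : ι → Fin m → ℝ) => w e.1 e.2)
      (Measure.pi fun _ : ι => Measure.pi fun _ : Fin m => μ) := by
  have h := iIndepFun_uncurry_infinitePi' (ι := ι) (κ := Fin m) (Ω := fun _ _ => ℝ)
    (X := fun _ _ (x : ℝ) => x) (fun _ _ => μ) (fun _ _ => measurable_id)
  simpa only [Measure.infinitePi_eq_pi] using h

theorem measurePreserving_entry (μ : Measure ℝ) [IsProbabilityMeasure μ] (i : ι) (k : Fin m) :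
    MeasurePreserving (fun w : ι → Fin m → ℝ => w i k)
      (Measure.pi fun _ : ι => Measure.pi fun _ : Fin m => μ) μ :=
  (measurePreserving_eval (fun _ : Fin m => μ) k).comp
    (measurePreserving_eval (fun _ : ι => Measure.pi fun _ : Fin m => μ) i)

theorem integral_entry (μ : Measure ℝ) [IsProbabilityMeasure μ] (i : ι) (k : Fin m) {f : ℝ → ℝ}
    (hf : Measurable f) :
    ∫ w, f (w i k) ∂(Measure.pi fun _ : ι => Measure.pi fun _ : Fin m => μ) = ∫ x, f x ∂μ := by
  have h := measurePreserving_entry (ι := ι) μ i k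
  refine (integral_map h.measurable.aemeasurable hf.aestronglyMeasurable).symm.trans ?_
  rw [h.map_eq]

/-- Chebyshev's inequality for the entries of the Gram matrix of the rows of a random matrix with
iid centered entries. -/
theorem measure_gram_sub_ge_le [DecidableEq ι] (μ : Measure ℝ) [IsProbabilityMeasure μ]
    (h4 : MemLp id 4 μ) (h0 : ∫ x, x ∂μ = 0) (i j : ι) {ε : ℝ} (hε : 0 < ε) :
    (Measure.pi fun _ : ι => Measure.pi fun _ : Fin m => μ)
      {w | ε ≤ |∑ k, w i k * w j k - if i = j then m * ∫ x, x ^ 2 ∂μ else 0|} ≤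
    ENNReal.ofReal (m * (∫ x, x ^ 4 ∂μ) / ε ^ 2) := by
  set P := Measure.pi fun _ : ι => Measure.pi fun _ : Fin m => μ
  set Z : Fin m → (ι → Fin m → ℝ) → ℝ := fun k w => w i k * w j k with hZ
  have hmeas : ∀ e : ι × Fin m, Measurable fun w : ι → Fin m → ℝ => w e.1 e.2 := fun e => by
    fun_prop
  have hind := iIndepFun_entries (ι := ι) (m := m) μ
  have hL4 : ∀ i k, MemLp (fun w : ι → Fin m → ℝ => w i k) 4 P := fun i k =>
    h4.comp_measurePreserving (measurePreserving_entry μ i k)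
  have hL2 : ∀ k, MemLp (Z k) 2 P := by
    intro k
    have : ENNReal.HolderTriple 4 4 2 := ⟨by
      rw [← two_mul, show (4 : ENNReal) = 2 * 2 by norm_num,
        ENNReal.mul_inv (Or.inl (by norm_num)) (Or.inl (by norm_num)), ← mul_assoc,
        ENNReal.mul_inv_cancel (by norm_num) (by norm_num), one_mul]⟩
    exact (hL4 j k).mul (hL4 i k)
  have hint4 : Integrable (fun x : ℝ => x ^ 4) μ := by
    simpa [Even.pow_abs (show Even 4 by decide)] using h4.integrable_norm_pow (p := 4) (by norm_num)
  have hmean : ∀ k, ∫ w, Z k w ∂P = if i = j then ∫ x, x ^ 2 ∂μ else 0 := by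
    intro k
    split_ifs with hij
    · subst hij
      rw [← integral_entry (ι := ι) μ i k (f := fun x => x ^ 2) (by fun_prop)]
      simp only [hZ, pow_two]
      rfl
    · have h := (hind.indepFun (i := (i, k)) (j := (j, k)) (by simpa using hij))
      have h1 := h.integral_fun_mul_eq_mul_integral (hmeas (i, k)).aestronglyMeasurable
        (hmeas (j, k)).aestronglyMeasurable
      rw [integral_entry (ι := ι) μ i k (f := fun x => x) measurable_id, h0, zero_mul] at h1
      exact h1
  have hvar : ∀ k, variance (Z k) P ≤ ∫ x, x ^ 4 ∂μ := by
    intro k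
    refine (variance_le_expectation_sq (hL2 k).1).trans ?_
    have hi : ∀ i, Integrable (fun w : ι → Fin m → ℝ => w i k ^ 4) P := fun i =>
      (measurePreserving_entry μ i k).integrable_comp_of_integrable hint4
    have e : ∀ i, ∫ w : ι → Fin m → ℝ, w i k ^ 4 ∂P = ∫ x, x ^ 4 ∂μ := fun i =>
      integral_entry μ i k (f := fun x => x ^ 4) (by fun_prop)
    calc ∫ w, (Z k ^ 2) w ∂P ≤ ∫ w : ι → Fin m → ℝ, (w i k ^ 4 + w j k ^ 4) / 2 ∂P := by
          refine integral_mono (hL2 k).integrable_sq (((hi i).add (hi j)).div_const 2) fun w => ?_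
          simp only [hZ, Pi.pow_apply]
          nlinarith [sq_nonneg (w i k ^ 2 - w j k ^ 2)]
      _ = ∫ x, x ^ 4 ∂μ := by
          rw [integral_div, integral_add (hi i) (hi j), e, e]
          ring
  have hsum : variance (∑ k, Z k) P ≤ m * ∫ x, x ^ 4 ∂μ := by
    rw [IndepFun.variance_sum (fun k _ => hL2 k)]
    · refine (Finset.sum_le_card_nsmul _ _ _ fun k _ => hvar k).trans_eq ?_
      simp
    · intro k _ k' _ hk
      exact hind.indepFun_mul_mul hmeas (i, k) (j, k) (i, k') (j, k') (by simp [hk]) (by simp [hk])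
        (by simp [hk]) (by simp [hk])
  have hE : ∫ w, (∑ k, Z k) w ∂P = if i = j then m * ∫ x, x ^ 2 ∂μ else 0 := by
    simp only [Finset.sum_apply]
    rw [integral_finsetSum _ fun k _ => (hL2 k).integrable (by norm_num)]
    simp only [hmean]
    split_ifs <;> simp
  have h := meas_ge_le_variance_div_sq (memLp_finsetSum' Finset.univ fun k _ => hL2 k) hε
  rw [hE] at h
  simp only [Finset.sum_apply, hZ] at h
  refine h.trans (ENNReal.ofReal_le_ofReal ?_)
  gcongr

/-- The rows of both weight matrices. -/
def allRows {d : ℕ} (w : (Fin d → Fin m → ℝ) × (Fin d → Fin m → ℝ)) : Fin d ⊕ Fin d → Fin m → ℝ :=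
  Sum.elim w.1 w.2

/-- With high probability the rows of both initial weight matrices are nearly orthonormal. -/
theorem exists_initLaw_gram_le : ∃ C : ℝ, 0 < C ∧ ∀ (d m : ℕ) (ε : ℝ), 0 < m → 0 < ε →
    initLaw d m {w | ¬∀ i j, |∑ k, allRows w i k * allRows w j k - if i = j then 1 else 0| < ε} ≤
      ENNReal.ofReal ((2 * d) ^ 2 * (C / (m * ε ^ 2))) := by
  refine ⟨∫ x, x ^ 4 ∂gaussianReal 0 1 + 1, ?_, fun d m ε hm hε => ?_⟩
  · have : 0 ≤ ∫ x, x ^ 4 ∂gaussianReal 0 1 := integral_nonneg fun x => by positivity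
    linarith
  set C := ∫ x, x ^ 4 ∂gaussianReal 0 1
  have hC : 0 ≤ C := integral_nonneg fun x => by positivity
  have hm' : (0 : ℝ) < m := by exact_mod_cast hm
  set γ := gaussianReal 0 (m : NNReal)⁻¹ with hγ
  have h2 : ∫ x, x ^ 2 ∂γ = (m : ℝ)⁻¹ := by
    have h := variance_fun_id_gaussianReal (μ := 0) (v := (m : NNReal)⁻¹)
    rw [variance_of_integral_eq_zero aemeasurable_id' (by simp)] at h
    simpa using h
  -- the law `N(0, 1/m)` is a rescaling of `N(0, 1)`
  have h4 : ∫ x, x ^ 4 ∂γ = C / m ^ 2 := by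
    have e : γ = (gaussianReal 0 1).map fun x => (√(m : ℝ))⁻¹ * x := by
      rw [gaussianReal_map_const_mul, hγ, mul_zero, mul_one]
      congr 1
      ext
      simp [inv_pow]
    rw [e, integral_map (by fun_prop) (by fun_prop)]
    simp only [mul_pow]
    rw [integral_const_mul, inv_pow, show (4 : ℕ) = 2 * 2 by rfl, pow_mul √(m : ℝ),
      Real.sq_sqrt hm'.le, inv_mul_eq_div]
  have hpair : ∀ i j : Fin d ⊕ Fin d, initLaw d m
      {w | ε ≤ |∑ k, allRows w i k * allRows w j k - if i = j then 1 else 0|} ≤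
      ENNReal.ofReal ((C + 1) / (m * ε ^ 2)) := by
    intro i j
    have h := measure_gram_sub_ge_le (m := m) γ
      (memLp_id_gaussianReal' 4 (by norm_num)) (by simp [hγ]) i j hε
    have hp := measurePreserving_sumPiEquivProdPi_symm
      (fun _ : Fin d ⊕ Fin d => Measure.pi fun _ : Fin m => γ)
    rw [← hp.measure_preimage_equiv, h2, h4, mul_inv_cancel₀ hm'.ne'] at h
    refine le_trans (le_of_eq ?_) (h.trans (ENNReal.ofReal_le_ofReal ?_))
    · rfl
    · rw [show (m : ℝ) * (C / m ^ 2) / ε ^ 2 = C / (m * ε ^ 2) by field_simp]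
      gcongr
      linarith
  have hsub : {w | ¬∀ i j, |∑ k, allRows w i k * allRows w j k - if i = j then 1 else 0| < ε} ⊆
      ⋃ ij : (Fin d ⊕ Fin d) × (Fin d ⊕ Fin d), {w : (Fin d → Fin m → ℝ) × (Fin d → Fin m → ℝ) |
        ε ≤ |∑ k, allRows w ij.1 k * allRows w ij.2 k - if ij.1 = ij.2 then 1 else 0|} := by
    intro w hw
    simp only [mem_ofPred, not_forall, not_lt] at hw
    obtain ⟨i, j, h⟩ := hw
    exact mem_iUnion.2 ⟨(i, j), h⟩
  refine (measure_mono hsub).trans ((measure_iUnion_le _).trans ?_)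
  rw [tsum_fintype]
  refine (Finset.sum_le_sum fun ij _ => hpair ij.1 ij.2).trans (le_of_eq ?_)
  rw [Finset.sum_const, Finset.card_univ, Fintype.card_prod, Fintype.card_sum, Fintype.card_fin,
    nsmul_eq_mul, ENNReal.ofReal_mul (by positivity)]
  congr 1
  rw [show ((2 : ℝ) * d) ^ 2 = (((d + d) * (d + d) : ℕ) : ℝ) by push_cast; ring,
    ENNReal.ofReal_natCast]

end Concentration

/-! ### The initial columns -/

section Initial

variable {d r m : ℕ}

theorem sum_abs_sq_le {ι : Type*} [Fintype ι] {φ : ι → ℝ} {S : ℝ} (h : ∑ i, φ i * φ i ≤ S) :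
    (∑ i, |φ i|) ^ 2 ≤ Fintype.card ι * S := by
  refine (sq_sum_le_card_mul_sum_sq (s := Finset.univ) (f := fun i => |φ i|)).trans ?_
  rw [Finset.card_univ]
  refine mul_le_mul_of_nonneg_left ((Finset.sum_congr rfl fun i _ => ?_).trans_le h) (by positivity)
  rw [sq_abs, sq]

/-- Inner products of columns of `Wᵀ Φ` and `W'ᵀ Ψ` when the inner products of the rows of `W` and
`W'` are close to `G`. -/
theorem abs_inner_cols_sub_le {ι : Type*} {W W' : Matrix (Fin d) (Fin m) ℝ}
    {Φ Ψ : Matrix (Fin d) ι ℝ} {G : Fin d → Fin d → ℝ} {ε S : ℝ} (hε : 0 ≤ ε)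
    (hG : ∀ i i', |∑ k, W i k * W' i' k - G i i'| ≤ ε) (j j' : ι)
    (hΦ : ∑ i, Φ i j * Φ i j ≤ S) (hΨ : ∑ i, Ψ i j' * Ψ i j' ≤ S) :
    |inner ℝ (cols W Φ j) (cols W' Ψ j') - ∑ i, ∑ i', Φ i j * Ψ i' j' * G i i'| ≤ ε * (d * S) := by
  have e : inner ℝ (cols W Φ j) (cols W' Ψ j') =
      ∑ i, ∑ i', Φ i j * Ψ i' j' * ∑ k, W i k * W' i' k := by
    have h : ∀ k, inner ℝ (cols W Φ j k) (cols W' Ψ j' k) =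
        ∑ i, ∑ i', Φ i j * Ψ i' j' * (W i k * W' i' k) := by
      intro k
      rw [RCLike.inner_apply, conj_trivial, mul_comm, cols_apply, cols_apply, Finset.sum_mul_sum]
      exact Finset.sum_congr rfl fun i _ => Finset.sum_congr rfl fun i' _ => by ring
    simp only [PiLp.inner_apply, h, Finset.mul_sum]
    rw [Finset.sum_comm]
    exact Finset.sum_congr rfl fun i _ => Finset.sum_comm
  rw [e]
  simp only [← Finset.sum_sub_distrib, ← mul_sub]
  calc |∑ i, ∑ i', Φ i j * Ψ i' j' * (∑ k, W i k * W' i' k - G i i')|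
      ≤ ∑ i, ∑ i', |Φ i j| * |Ψ i' j'| * ε := by
        refine (Finset.abs_sum_le_sum_abs _ _).trans (Finset.sum_le_sum fun i _ => ?_)
        refine (Finset.abs_sum_le_sum_abs _ _).trans (Finset.sum_le_sum fun i' _ => ?_)
        rw [abs_mul, abs_mul]
        exact mul_le_mul_of_nonneg_left (hG i i') (by positivity)
    _ = ε * ((∑ i, |Φ i j|) * ∑ i', |Ψ i' j'|) := by
        simp only [← Finset.sum_mul, ← Finset.mul_sum]
        ring
    _ ≤ ε * (d * S) := by
        refine mul_le_mul_of_nonneg_left ?_ hε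
        have h1 := sum_abs_sq_le hΦ
        have h2 := sum_abs_sq_le hΨ
        rw [Fintype.card_fin] at h1 h2
        nlinarith [sq_nonneg (∑ i, |Φ i j| - ∑ i', |Ψ i' j'|)]

theorem DataModel.sq_le (D : DataModel d r) (j : Fin r ⊕ Fin (d - r)) : D.sq j ≤ D.sigmaMaxSq := by
  rcases j with p | q
  · exact (le_ciSup (f := fun p => D.σ p ^ 2) (Set.finite_range _).bddAbove p).trans
      (le_max_left _ _)
  · exact le_max_right _ _

theorem DataModel.le_sq (D : DataModel d r) (j : Fin r ⊕ Fin (d - r)) : D.sigmaMinSq ≤ D.sq j := by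
  rcases j with p | q
  · exact (min_le_left _ _).trans
      (ciInf_le (f := fun p => D.σ p ^ 2) (Set.finite_range _).bddBelow p)
  · exact min_le_right _ _

variable (D : DataModel d r) (K τ : ℝ) {WA WB : ℝ → Matrix (Fin d) (Fin m) ℝ}

/-- Nearly orthonormal rows of the weight matrices give nearly orthogonal columns. -/
theorem nearOrthogonal_matFlow (hr : 1 ≤ r) {w : (Fin d → Fin m → ℝ) × (Fin d → Fin m → ℝ)}
    (hA : WA 0 = Matrix.of w.1) (hB : WB 0 = Matrix.of w.2) {ε : ℝ} (hε : 0 ≤ ε)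
    (hw : ∀ i j, |∑ k, allRows w i k * allRows w j k - if i = j then 1 else 0| < ε) :
    (matFlow D K τ WA WB).NearOrthogonal (ε * (d * (D.sigmaMaxSq / D.sigmaMinSq))) := by
  have hμ := D.sigmaMinSq_pos hr
  have hS : 0 ≤ D.sigmaMaxSq := (sq_nonneg D.σξ).trans (le_max_right _ _)
  set S := D.sigmaMaxSq
  have hgA : ∀ j, ∑ i, D.encA i j * D.encA i j ≤ S := fun j => by
    rw [D.encA_gram, if_pos rfl]; exact D.sq_le j
  have hgB : ∀ j, ∑ i, D.encB i j * D.encB i j ≤ S := fun j => by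
    rw [D.encB_gram, if_pos rfl]; exact D.sq_le j
  have hAA : ∀ j j', |inner ℝ (cols (WA 0) D.encA j) (cols (WA 0) D.encA j') -
      if j = j' then D.sq j else 0| ≤ ε * (d * S) := by
    intro j j'
    have h := abs_inner_cols_sub_le (W := WA 0) (W' := WA 0)
      (G := fun i i' => if i = i' then 1 else 0) hε
      (fun i i' => by simpa [allRows, hA] using (hw (.inl i) (.inl i')).le) j j' (hgA j) (hgA j')
    simpa [D.encA_gram] using h
  have hBB : ∀ j j', |inner ℝ (cols (WB 0) D.encB j) (cols (WB 0) D.encB j') -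
      if j = j' then D.sq j else 0| ≤ ε * (d * S) := by
    intro j j'
    have h := abs_inner_cols_sub_le (W := WB 0) (W' := WB 0)
      (G := fun i i' => if i = i' then 1 else 0) hε
      (fun i i' => by simpa [allRows, hB] using (hw (.inr i) (.inr i')).le) j j' (hgB j) (hgB j')
    simpa [D.encB_gram] using h
  have hAB : ∀ j j', |inner ℝ (cols (WA 0) D.encA j) (cols (WB 0) D.encB j')| ≤ ε * (d * S) := by
    intro j j'
    have h := abs_inner_cols_sub_le (W := WA 0) (W' := WB 0) (G := fun _ _ => 0) hε
      (fun i i' => by simpa [allRows, hA, hB] using (hw (.inl i) (.inr i')).le) j j' (hgA j) (hgB j')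
    simpa using h
  have hscale : ∀ {u v : EuclideanSpace ℝ (Fin m)} {l : ℝ}, |inner ℝ u v - l| ≤ ε * (d * S) →
      |inner ℝ (D.scale • u) (D.scale • v) - l * D.scale ^ 2| ≤
        ε * (d * (S / D.sigmaMinSq)) := by
    intro u v l h
    rw [real_inner_smul_left, real_inner_smul_right,
      show D.scale * (D.scale * inner ℝ u v) - l * D.scale ^ 2 =
        D.scale ^ 2 * (inner ℝ u v - l) by ring, abs_mul, abs_of_nonneg (sq_nonneg _),
      D.scale_sq hr]
    calc _ ≤ D.sigmaMinSq⁻¹ * (ε * (d * S)) := mul_le_mul_of_nonneg_left h (by positivity)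
      _ = _ := by field_simp
  have hscale0 : ∀ {u v : EuclideanSpace ℝ (Fin m)}, |inner ℝ u v| ≤ ε * (d * S) →
      |inner ℝ (D.scale • u) (D.scale • v)| ≤ ε * (d * (S / D.sigmaMinSq)) := by
    intro u v h
    simpa using hscale (l := 0) (by simpa using h)
  have hBA : ∀ j j', |inner ℝ (cols (WB 0) D.encB j) (cols (WA 0) D.encA j')| ≤ ε * (d * S) :=
    fun j j' => by rw [real_inner_comm]; exact hAB j' j
  refine ⟨fun p => ?_, fun p => ?_, fun q => ?_, fun q => ?_, fun p p' h => ?_, fun p p' h => ?_,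
    fun p p' => hscale0 (hAB _ _), fun p q => ?_, fun p q => hscale0 (hAB _ _),
    fun p q => hscale0 (hBA _ _), fun p q => ?_, fun q q' => hscale0 (hAB _ _)⟩
  · rw [← real_inner_self_eq_norm_sq]
    exact hscale (by simpa [DataModel.sq] using hAA (.inl p) (.inl p))
  · rw [← real_inner_self_eq_norm_sq]
    exact hscale (by simpa [DataModel.sq] using hBB (.inl p) (.inl p))
  · rw [← real_inner_self_eq_norm_sq]
    exact hscale (by simpa [DataModel.sq] using hAA (.inr q) (.inr q))
  · rw [← real_inner_self_eq_norm_sq]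
    exact hscale (by simpa [DataModel.sq] using hBB (.inr q) (.inr q))
  · exact hscale0 (by simpa [h] using hAA (.inl p) (.inl p'))
  · exact hscale0 (by simpa [h] using hBB (.inl p) (.inl p'))
  · exact hscale0 (by simpa using hAA (.inl p) (.inr q))
  · exact hscale0 (by simpa using hBB (.inl p) (.inr q))

end Initial

/-! ### The first time of alignment -/

/-- Finitely many continuous conditions that hold at time `T` hold simultaneously at some earliest
time. -/
theorem exists_isLeast_of_continuousOn {ι : Type*} {f : ι → ℝ → ℝ} {T : ℝ}
    (hT : 0 ≤ T) (hf : ∀ i, ContinuousOn (f i) (Icc 0 T)) (hend : ∀ i, 0 ≤ f i T) :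
    ∃ t, IsLeast {t | 0 ≤ t ∧ ∀ i, 0 ≤ f i t} t ∧ t ≤ T := by
  have hclosed : IsClosed (Icc 0 T ∩ ⋂ i, (Icc 0 T ∩ f i ⁻¹' Ici 0)) :=
    isClosed_Icc.inter (isClosed_iInter fun i =>
      (hf i).preimage_isClosed_of_isClosed isClosed_Icc isClosed_Ici)
  have hcomp : IsCompact (Icc 0 T ∩ ⋂ i, (Icc 0 T ∩ f i ⁻¹' Ici 0)) :=
    isCompact_Icc.of_isClosed_subset hclosed inter_subset_left
  have hTm : T ∈ Icc 0 T := ⟨hT, le_rfl⟩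
  obtain ⟨t, ⟨ht, ht'⟩, hmin⟩ := hcomp.exists_isLeast ⟨T, hTm, mem_iInter.2 fun i => ⟨hTm, hend i⟩⟩
  refine ⟨t, ⟨⟨ht.1, fun i => (mem_iInter.1 ht' i).2⟩, fun s hs => ?_⟩, ht.2⟩
  by_contra! hst
  have hs' : s ∈ Icc 0 T := ⟨hs.1, hst.le.trans ht.2⟩
  exact hst.not_ge (hmin ⟨hs', mem_iInter.2 fun i => ⟨hs', hs.2 i⟩⟩)

section StageOne

variable {d r m : ℕ} {D : DataModel d r} {K τ : ℝ} {WA WB : ℝ → Matrix (Fin d) (Fin m) ℝ}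

theorem inv_norm_smul_smul {E : Type*} [NormedAddCommGroup E] [NormedSpace ℝ E] {c : ℝ}
    (hc : 0 < c) (v : E) : ‖c • v‖⁻¹ • c • v = ‖v‖⁻¹ • v := by
  rw [norm_smul, Real.norm_of_nonneg hc.le, mul_inv, smul_smul, mul_right_comm,
    inv_mul_cancel₀ hc.ne', one_mul]

theorem inner_normalized {E : Type*} [NormedAddCommGroup E] [InnerProductSpace ℝ E] (u v : E) :
    inner ℝ (‖u‖⁻¹ • u) (‖v‖⁻¹ • v) = inner ℝ u v / (‖u‖ * ‖v‖) := by
  rw [real_inner_smul_left, real_inner_smul_right]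
  field_simp

theorem abs_inner_normalized_le {E : Type*} [NormedAddCommGroup E] [InnerProductSpace ℝ E]
    {u v : E} {g δ : ℝ} (hg : 0 ≤ g) (h : |inner ℝ u v| ≤ g * (‖u‖ * ‖v‖)) (hgδ : g ≤ δ) :
    |inner ℝ (‖u‖⁻¹ • u) (‖v‖⁻¹ • v)| ≤ δ := by
  rw [inner_normalized, abs_div, abs_of_nonneg (by positivity : 0 ≤ ‖u‖ * ‖v‖)]
  exact (div_le_of_le_mul₀ (by positivity) hg h).trans hgδ

theorem abs_sq_sub_sq_le {x y g δ : ℝ} (hg : 0 ≤ g) (_hg1 : g ≤ 1)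
    (h1 : x ^ 2 ≤ (1 + g) * y ^ 2) (h2 : y ^ 2 ≤ (1 + g) * x ^ 2) (hgδ : 2 * g ≤ δ) :
    |x ^ 2 - y ^ 2| ≤ δ * y ^ 2 := by
  have hy := sq_nonneg y
  rw [abs_le]
  constructor <;> nlinarith

/-- The conclusion on a trajectory of the columns in a quantitative regime. -/
theorem stageOneConclusion_of_regime {κ M H g Tend R κmax δm δNS δAB δξκ δperp δξperp : ℝ}
    (hc : 0 < D.scale) (hr : (matFlow D K τ WA WB).Regime κ M H g Tend)
    (hR : 1 ≤ R) (hRg : R * g ≤ 1) (hRκ : κ ≤ R) (hRM : Real.exp (112 * M) ≤ R)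
    (hlong : 2 * Real.log R * H ^ 2 ≤ 2 * (K / (1 + K)) * Tend)
    (hκmax : 0 ≤ κmax) (hκ : 10 * κ * Real.exp (112 * κ * M) ≤ κmax ^ 2)
    (hm : 8 / R ≤ δm) (hNS0 : 0 ≤ δNS) (hNS : 8 / R ^ 2 ≤ δNS ^ 2) (hAB : g ≤ δAB) (hξκ : g ≤ δξκ)
    (hperp : g ≤ δperp) (hξperp : g ≤ δξperp) :
    StageOneConclusion D WA WB Tend κmax δm δNS δAB δξκ δperp δξperp := by
  set F := matFlow D K τ WA WB with hF
  have hctl := Flow.controlled hr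
  have hTT : Tend ∈ Icc 0 Tend := ⟨hr.Tend_nonneg, le_rfl⟩
  obtain ⟨θ, w, hk⟩ := Flow.exists_clocks hr hTT hctl
  have hg := hr.g_pos
  have hgle := hr.g_le
  -- columns of the weights in terms of the normalized columns
  have eA : ∀ t p, unitColumn ((WA t)ᵀ * D.A) p = ‖F.a p t‖⁻¹ • F.a p t := fun t p => by
    rw [unitColumn, column_transpose_mul]; exact (inv_norm_smul_smul hc _).symm
  have eB : ∀ t p, unitColumn ((WB t)ᵀ * D.B) p = ‖F.b p t‖⁻¹ • F.b p t := fun t p => by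
    rw [unitColumn, column_transpose_mul]; exact (inv_norm_smul_smul hc _).symm
  have eX : ∀ t q, unitColumn ((WA t)ᵀ * D.Aξ) q = ‖F.x q t‖⁻¹ • F.x q t := fun t q => by
    rw [unitColumn, column_transpose_mul]; exact (inv_norm_smul_smul hc _).symm
  have eY : ∀ t q, unitColumn ((WB t)ᵀ * D.Bξ) q = ‖F.y q t‖⁻¹ • F.y q t := fun t q => by
    rw [unitColumn, column_transpose_mul]; exact (inv_norm_smul_smul hc _).symm
  have nA : ∀ t p, ‖F.a p t‖ = D.scale * ‖column ((WA t)ᵀ * D.A) p‖ := fun t p => by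
    rw [column_transpose_mul]
    exact (norm_smul _ _).trans (by rw [Real.norm_of_nonneg hc.le]; rfl)
  have nB : ∀ t p, ‖F.b p t‖ = D.scale * ‖column ((WB t)ᵀ * D.B) p‖ := fun t p => by
    rw [column_transpose_mul]
    exact (norm_smul _ _).trans (by rw [Real.norm_of_nonneg hc.le]; rfl)
  have nX : ∀ t q, ‖F.x q t‖ = D.scale * ‖column ((WA t)ᵀ * D.Aξ) q‖ := fun t q => by
    rw [column_transpose_mul]
    exact (norm_smul _ _).trans (by rw [Real.norm_of_nonneg hc.le]; rfl)
  have nY : ∀ t q, ‖F.y q t‖ = D.scale * ‖column ((WB t)ᵀ * D.Bξ) q‖ := fun t q => by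
    rw [column_transpose_mul]
    exact (norm_smul _ _).trans (by rw [Real.norm_of_nonneg hc.le]; rfl)
  have hratio : ∀ u v : ℝ, u / v = D.scale * u / (D.scale * v) := fun u v =>
    (mul_div_mul_left u v hc.ne').symm
  -- no column vanishes up to the time horizon
  have hposA : ∀ t ∈ Icc 0 Tend, ∀ p, 0 < ‖F.a p t‖ := fun t ht p => by
    linarith [Flow.norm_a_ge hr (hk.approx t ht) (hctl t ht) p]
  have hposB : ∀ t ∈ Icc 0 Tend, ∀ p, 0 < ‖F.b p t‖ := fun t ht p => by
    linarith [show 1 / 2 ≤ ‖F.b p t‖ from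
      Flow.norm_a_ge hr.swap (hk.approx t ht).swap (hctl t ht).swap p]
  have hposX : ∀ t ∈ Icc 0 Tend, ∀ q, 0 < ‖F.x q t‖ := fun t ht q =>
    lt_of_lt_of_le (by positivity) (Flow.norm_y_ge hr.swap (hk.approx t ht).swap q)
  have hposY : ∀ t ∈ Icc 0 Tend, ∀ q, 0 < ‖F.y q t‖ := fun t ht q =>
    lt_of_lt_of_le (by positivity) (Flow.norm_y_ge hr (hk.approx t ht) q)
  -- alignment as finitely many inequalities between continuous functions
  let f : Fin r ⊕ (Fin r × Fin (d - r)) → ℝ → ℝ := Sum.elim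
    (fun p t => inner ℝ (F.a p t) (F.b p t) / (‖F.a p t‖ * ‖F.b p t‖) - (1 - δm))
    fun pq t => δNS - ‖F.x pq.2 t‖ / ‖F.a pq.1 t‖
  have hset : ∀ t, Aligned ((WA t)ᵀ * D.A) ((WB t)ᵀ * D.B) ((WA t)ᵀ * D.Aξ) δm δNS ↔
      ∀ i, 0 ≤ f i t := by
    intro t
    rw [Aligned, Sum.forall, Prod.forall]
    refine and_congr (forall_congr' fun p => ?_) (forall_congr' fun p => forall_congr' fun q => ?_)
    · rw [eA, eB, inner_normalized]
      exact sub_nonneg.symm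
    · rw [hratio, ← nX, ← nA]
      exact sub_nonneg.symm
  have hcA : ∀ p, ContinuousOn (F.a p) (Icc 0 Tend) := fun p t ht =>
    ((hr.perturbed.hasDeriv_a p t ht.1).continuousWithinAt).mono Icc_subset_Ici_self
  have hcB : ∀ p, ContinuousOn (F.b p) (Icc 0 Tend) := fun p t ht =>
    ((hr.perturbed.hasDeriv_b p t ht.1).continuousWithinAt).mono Icc_subset_Ici_self
  have hcX : ∀ q, ContinuousOn (F.x q) (Icc 0 Tend) := fun q t ht =>
    ((hr.perturbed.hasDeriv_x q t ht.1).continuousWithinAt).mono Icc_subset_Ici_self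
  have hfc : ∀ i, ContinuousOn (f i) (Icc 0 Tend) := by
    rintro (p | ⟨p, q⟩)
    · exact (((hcA p).inner (hcB p)).div ((hcA p).norm.mul (hcB p).norm) fun t ht =>
        (mul_pos (hposA t ht p) (hposB t ht p)).ne').sub continuousOn_const
    · exact continuousOn_const.sub ((hcX q).norm.div (hcA p).norm fun t ht => (hposA t ht p).ne')
  obtain ⟨hend1, hend2⟩ := Flow.aligned_at_end hr hR hRg hRκ hRM hlong
  have hfend : ∀ i, 0 ≤ f i Tend := by
    rintro (p | ⟨p, q⟩)
    · refine sub_nonneg.2 ?_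
      rw [le_div_iff₀ (mul_pos (hposA _ hTT p) (hposB _ hTT p))]
      refine le_trans ?_ (hend1 p)
      gcongr
    · refine sub_nonneg.2 ?_
      rw [div_le_iff₀ (hposA _ hTT p)]
      refine le_of_sq_le_sq ((hend2 p q).trans ?_) (by positivity)
      rw [mul_pow]
      gcongr
  obtain ⟨T₁, hT₁, hT₁le⟩ := exists_isLeast_of_continuousOn hr.Tend_nonneg hfc hfend
  refine ⟨T₁, by simpa only [hset] using hT₁, hT₁le, fun t ht => ?_⟩
  replace ht : t ∈ Icc 0 Tend := ⟨ht.1, ht.2.trans hT₁le⟩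
  have ha := hk.approx t ht
  have hct := hctl t ht
  have hg8 : 2 * g ^ 8 ≤ g := by
    have h1 : g ^ 7 ≤ g := by simpa using hr.pow_le 7 1 (by norm_num)
    have e : g ^ 8 = g * g ^ 7 := by ring
    rw [e]
    nlinarith
  refine ⟨⟨fun p => ⟨?_, ?_⟩, fun q => ⟨?_, ?_⟩⟩, fun p q => ?_, ⟨fun p => ?_, fun q => ?_,
    fun p q => ?_, ?_, ?_, fun s q => ?_⟩⟩
  · have := hposA t ht p
    rw [nA] at this
    exact norm_pos_iff.1 (pos_of_mul_pos_right this hc.le)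
  · have := hposB t ht p
    rw [nB] at this
    exact norm_pos_iff.1 (pos_of_mul_pos_right this hc.le)
  · have := hposX t ht q
    rw [nX] at this
    exact norm_pos_iff.1 (pos_of_mul_pos_right this hc.le)
  · have := hposY t ht q
    rw [nY] at this
    exact norm_pos_iff.1 (pos_of_mul_pos_right this hc.le)
  · rw [hratio, ← nA, ← nA, div_le_iff₀ (hposA t ht q)]
    refine le_of_sq_le_sq ((Flow.norm_a_sq_le_mul hr hk hctl ht p q).trans ?_) (by positivity)
    rw [mul_pow]
    gcongr
  · have h := abs_sq_sub_sq_le (by positivity) (by linarith) (hct.ab p) (hct.ba p) (hg8.trans hAB)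
    rw [nA, nB, mul_pow, mul_pow, ← mul_sub, abs_mul, abs_of_nonneg (sq_nonneg _),
      mul_left_comm] at h
    exact le_of_mul_le_mul_left h (by positivity)
  · have h := abs_sq_sub_sq_le (by positivity) (by linarith) (hct.xy q) (hct.yx q) (hg8.trans hAB)
    rw [nX, nY, mul_pow, mul_pow, ← mul_sub, abs_mul, abs_of_nonneg (sq_nonneg _),
      mul_left_comm] at h
    exact le_of_mul_le_mul_left h (by positivity)
  · rw [hratio, ← nX, ← nX]
    exact (Flow.noise_ratio_le hr ha hct p q).trans hξκ
  · intro N hN N' hN' p q hpq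
    obtain ⟨u, hu, eu⟩ : ∃ u, (u = F.a p t ∨ u = F.b p t) ∧ unitColumn N p = ‖u‖⁻¹ • u := by
      rcases hN with rfl | rfl
      exacts [⟨_, Or.inl rfl, eA t p⟩, ⟨_, Or.inr rfl, eB t p⟩]
    obtain ⟨v, hv, ev⟩ : ∃ v, (v = F.a q t ∨ v = F.b q t) ∧ unitColumn N' q = ‖v‖⁻¹ • v := by
      rcases hN' with rfl | rfl
      exacts [⟨_, Or.inl rfl, eA t q⟩, ⟨_, Or.inr rfl, eB t q⟩]
    rw [eu, ev]
    exact abs_inner_normalized_le hg.le (Flow.signal_signal_le hr ha hct hpq hu hv) hperp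
  · intro N hN N' hN' p q
    obtain ⟨u, hu, eu⟩ : ∃ u, (u = F.a p t ∨ u = F.b p t) ∧ unitColumn N p = ‖u‖⁻¹ • u := by
      rcases hN with rfl | rfl
      exacts [⟨_, Or.inl rfl, eA t p⟩, ⟨_, Or.inr rfl, eB t p⟩]
    obtain ⟨v, hv, ev⟩ : ∃ v, (v = F.x q t ∨ v = F.y q t) ∧ unitColumn N' q = ‖v‖⁻¹ • v := by
      rcases hN' with rfl | rfl
      exacts [⟨_, Or.inl rfl, eX t q⟩, ⟨_, Or.inr rfl, eY t q⟩]
    rw [eu, ev]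
    exact abs_inner_normalized_le hg.le (Flow.signal_noise_le hr ha hct p q hu hv) hξperp
  · rw [eX, eY]
    exact abs_inner_normalized_le hg.le (Flow.noise_noise_le hr ha hct s q) hξperp

end StageOne

/-! ### Choice of the parameters -/

section Parameters

variable {d r m : ℕ} {D : DataModel d r} {K τ : ℝ} {WA WB : ℝ → Matrix (Fin d) (Fin m) ℝ}

theorem Flow.NearOrthogonal.mono {P Q E : Type*} [NormedAddCommGroup E] [InnerProductSpace ℝ E]
    {F : Flow P Q E} {ε ε' : ℝ} (h : F.NearOrthogonal ε) (hε : ε ≤ ε') : F.NearOrthogonal ε' where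
  norm_a p := (h.norm_a p).trans hε
  norm_b p := (h.norm_b p).trans hε
  norm_x q := (h.norm_x q).trans hε
  norm_y q := (h.norm_y q).trans hε
  aa p p' hp := (h.aa p p' hp).trans hε
  bb p p' hp := (h.bb p p' hp).trans hε
  ab p p' := (h.ab p p').trans hε
  ax p q := (h.ax p q).trans hε
  ay p q := (h.ay p q).trans hε
  bx p q := (h.bx p q).trans hε
  bt p q := (h.bt p q).trans hε
  xy q q' := (h.xy q q').trans hε

/-- The condition number of the squared singular values. -/
def DataModel.cond (D : DataModel d r) : ℝ := D.sigmaMaxSq / D.sigmaMinSq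

/-- The ratio of noise to signal, at least one. -/
def DataModel.noiseRatio (D : DataModel d r) : ℝ :=
  max 1 (((d : ℝ) - r) * D.σξ ^ 2 / (r * D.sigmaMinSq))

theorem DataModel.one_le_cond (hr : 1 ≤ r) : 1 ≤ D.cond := by
  rw [DataModel.cond, one_le_div (D.sigmaMinSq_pos hr)]
  exact (D.le_sq (.inl ⟨0, hr⟩)).trans (D.sq_le _)

/-- Under the assumption on the data, the dimension is astronomically large. -/
theorem DataModel.WellConditioned.le_dim (hr : 1 ≤ r) (h : D.WellConditioned (1 / 1000)) :
    1000 ≤ Real.log d := by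
  have h1 := D.one_le_cond hr
  have h2 : 1 ≤ D.noiseRatio := le_max_left _ _
  have h3 : D.cond * D.noiseRatio ≤ 1 / 1000 * Real.log d := h
  nlinarith

/-- The assumption on the data gives `κ M ≤ log d / 1000`, so that all exponentials in the regime
are at most `d`; the powers `H = d ^ 2`, `Tend = d ^ e` and `g = d ^ (-γ)` then fit together. -/
theorem regime_matFlow (hr : 1 ≤ r) (hrd : r ≤ d) (hK : 0 < K) (hwc : D.WellConditioned (1 / 1000))
    {e γ : ℕ} (heγ : e + 2 ≤ γ)
    (hpert : (matFlow D K τ WA WB).IsPerturbed (((d : ℝ) ^ γ)⁻¹ ^ 18))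
    (hinit : (matFlow D K τ WA WB).NearOrthogonal (((d : ℝ) ^ γ)⁻¹ ^ 18)) :
    (matFlow D K τ WA WB).Regime D.cond D.noiseRatio ((d : ℝ) ^ 2) ((d : ℝ) ^ γ)⁻¹ (d ^ e) := by
  have hμ := D.sigmaMinSq_pos hr
  have hlog := hwc.le_dim hr
  have hd : (0 : ℝ) < d := by exact_mod_cast (by omega : 0 < d)
  set x : ℝ := (d : ℝ)
  set L := Real.log x
  set κ := D.cond with hκdef
  set M := D.noiseRatio with hMdef
  have hκ : 1 ≤ κ := D.one_le_cond hr
  have hM : 1 ≤ M := le_max_left _ _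
  have hκM : κ * M ≤ 1 / 1000 * L := hwc
  have hLx : L ≤ x - 1 := Real.log_le_sub_one_of_pos hd
  have hx : 1001 ≤ x := by linarith
  have hexpL : Real.exp L = x := Real.exp_log hd
  have hκx : κ ≤ x := by nlinarith
  have hg : 0 < (x ^ γ)⁻¹ := by positivity
  have hxg : ∀ n ≤ γ, x ^ n * (x ^ γ)⁻¹ ≤ 1 := fun n hn =>
    mul_inv_le_one_of_le₀ (pow_le_pow_right₀ (by linarith) hn) (by positivity)
  have hxg1 : x * (x ^ γ)⁻¹ ≤ 1 := by simpa using hxg 1 (by omega)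
  have hlam : ∀ j, 1 ≤ D.sq j * D.scale ^ 2 ∧ D.sq j * D.scale ^ 2 ≤ κ := by
    intro j
    rw [D.scale_sq hr, ← div_eq_mul_inv, one_le_div hμ]
    exact ⟨D.le_sq j, div_le_div_of_nonneg_right (D.sq_le j) hμ.le⟩
  have hw : 0 < K / (1 + K) := by positivity
  have hw1 : K / (1 + K) ≤ 1 := by rw [div_le_one (by linarith)]; linarith
  have hr' : (1 : ℝ) ≤ r := by exact_mod_cast hr
  have hrx : (r : ℝ) ≤ x := by simp only [x]; exact_mod_cast hrd
  have hexp : ∀ c : ℝ, 0 ≤ c → c ≤ 1000 → Real.exp (c * κ * M) ≤ x := by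
    intro c hc0 hc
    rw [← hexpL, Real.exp_le_exp]
    have : 0 ≤ κ * M := by positivity
    nlinarith
  refine
    { one_le_lam := fun p => (hlam (.inl p)).1
      lam_le := fun p => (hlam (.inl p)).2
      one_le_lamx := ?_
      lamx_le := ?_
      one_le_M := hM
      one_le_card := by simpa using hr'
      noise_le := ?_
      η_pos := by simp only [matFlow]; positivity
      η_le := by simp only [matFlow]; linarith
      g_pos := hg
      g_le := ?_
      κ_le := (mul_le_mul_of_nonneg_right hκx hg.le).trans hxg1
      H_pos := one_le_pow₀ (by linarith)
      H_le := hxg 2 (by omega)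
      Tend_nonneg := by positivity
      Tend_le := ?_
      exp_le := (mul_le_mul_of_nonneg_right (hexp 256 (by norm_num) (by norm_num)) hg.le).trans hxg1
      lt_H := ?_
      perturbed := hpert
      initial := hinit }
  · change 1 ≤ D.σξ ^ 2 * D.scale ^ 2
    rw [D.scale_sq hr, ← div_eq_mul_inv, one_le_div hμ]
    exact min_le_right _ _
  · change D.σξ ^ 2 * D.scale ^ 2 ≤ κ
    rw [D.scale_sq hr, ← div_eq_mul_inv]
    exact div_le_div_of_nonneg_right (le_max_right _ _) hμ.le
  · have h1 : (x - r) * D.σξ ^ 2 / (r * D.sigmaMinSq) ≤ M := le_max_right _ _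
    rw [div_le_iff₀ (by positivity)] at h1
    change (Fintype.card (Fin (d - r)) : ℝ) * (D.σξ ^ 2 * D.scale ^ 2) ≤ M * Fintype.card (Fin r)
    rw [Fintype.card_fin, Fintype.card_fin, Nat.cast_sub hrd, D.scale_sq hr, ← mul_assoc,
      ← div_eq_mul_inv, div_le_iff₀ hμ]
    linarith
  · rw [le_div_iff₀ (by norm_num)]
    nlinarith
  · refine le_trans ?_ (hxg (e + 1) (by omega))
    rw [pow_succ']
    have : 0 < x ^ e * (x ^ γ)⁻¹ := by positivity
    nlinarith
  · rw [Fintype.card_fin]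
    have h1 := hexp 112 (by norm_num) (by norm_num)
    have h2 : κ * M ≤ x := by linarith
    calc 20 * M * r * κ * Real.exp (112 * κ * M) = 20 * (κ * M) * r * Real.exp (112 * κ * M) := by
          ring
      _ ≤ 20 * x * x * x := by gcongr
      _ < (x ^ 2) ^ 2 := by
          have : 0 < x ^ 3 := by positivity
          nlinarith

/-- Nearly orthonormal initial weights and a small temperature imply the conclusion, with all
error parameters powers of the dimension. -/
theorem stageOneConclusion_of_gram (hr : 1 ≤ r) (hrd : r ≤ d) (hK : 0 < K) (hτ : 0 < τ)
    (hwc : D.WellConditioned (1 / 1000)) {k e γ : ℕ} (hγ : γ = e + k + 2)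
    (he : (k + 1) * (d : ℝ) ^ 5 ≤ K / (1 + K) * (d : ℝ) ^ e)
    (hτd : τ ^ 2 ≤ ((d : ℝ) ^ (18 * γ + 3))⁻¹)
    {w : (Fin d → Fin m → ℝ) × (Fin d → Fin m → ℝ)}
    (hw : ∀ i j, |∑ l, allRows w i l * allRows w j l - if i = j then 1 else 0| <
      ((d : ℝ) ^ (18 * γ + 2))⁻¹)
    (hA : WA 0 = Matrix.of w.1) (hB : WB 0 = Matrix.of w.2) (hflow : IsGradientFlow D K τ WA WB)
    {δm δNS δAB δξκ δperp δξperp : ℝ} (hm : ((d : ℝ) ^ k)⁻¹ ≤ δm) (hNS : ((d : ℝ) ^ k)⁻¹ ≤ δNS)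
    (hAB : ((d : ℝ) ^ k)⁻¹ ≤ δAB) (hξκ : ((d : ℝ) ^ k)⁻¹ ≤ δξκ) (hperp : ((d : ℝ) ^ k)⁻¹ ≤ δperp)
    (hξperp : ((d : ℝ) ^ k)⁻¹ ≤ δξperp) :
    StageOneConclusion D WA WB ((d : ℝ) ^ e) (√(d : ℝ)) δm δNS δAB δξκ δperp δξperp := by
  have hlog := hwc.le_dim hr
  have hd : (0 : ℝ) < d := by exact_mod_cast (by omega : 0 < d)
  set x : ℝ := (d : ℝ)
  set L := Real.log x
  set κ := D.cond with hκdef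
  set M := D.noiseRatio with hMdef
  have hκ : 1 ≤ κ := D.one_le_cond hr
  have hM : 1 ≤ M := le_max_left _ _
  have hκM : κ * M ≤ 1 / 1000 * L := hwc
  have hLx : L ≤ x - 1 := Real.log_le_sub_one_of_pos hd
  have hx : 1001 ≤ x := by linarith
  have hx1 : 1 ≤ x := by linarith
  have hexpL : Real.exp L = x := Real.exp_log hd
  have hκL : κ ≤ 1 / 1000 * L := by nlinarith
  have hg18 : ((x ^ γ)⁻¹) ^ 18 = (x ^ (18 * γ))⁻¹ := by rw [inv_pow, ← pow_mul, mul_comm]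
  have hpert : (matFlow D K τ WA WB).IsPerturbed (((x ^ γ)⁻¹) ^ 18) := by
    have h3 : (x ^ (18 * γ + 3))⁻¹ = (x ^ (18 * γ))⁻¹ * (x ^ 3)⁻¹ := by rw [pow_add, mul_inv]
    have h1 : x ^ 3 * τ ^ 2 ≤ (x ^ (18 * γ))⁻¹ := by
      calc x ^ 3 * τ ^ 2 ≤ x ^ 3 * ((x ^ (18 * γ))⁻¹ * (x ^ 3)⁻¹) := by rw [← h3]; gcongr
        _ = _ := by field_simp
    have h2 : (x ^ (18 * γ))⁻¹ ≤ 1 := inv_le_one_of_one_le₀ (one_le_pow₀ hx1)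
    have hx2 : x ^ 2 * τ ^ 2 = x * (x * τ ^ 2) := by ring
    have hx3 : x ^ 3 * τ ^ 2 = x * (x ^ 2 * τ ^ 2) := by ring
    have h4 : 0 ≤ x * τ ^ 2 := by positivity
    have h5 : 0 ≤ x ^ 2 * τ ^ 2 := by positivity
    refine isPerturbed_matFlow hr hrd hK hτ ?_ ?_ hflow
    · change 8 * x * τ ^ 2 ≤ 1
      nlinarith
    · rw [hg18]
      change 40 * x ^ 2 * τ ^ 2 ≤ _
      nlinarith
  have hinit : (matFlow D K τ WA WB).NearOrthogonal (((x ^ γ)⁻¹) ^ 18) := by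
    have h := nearOrthogonal_matFlow D K τ hr hA hB (by positivity) hw
    have hle : (x ^ (18 * γ + 2))⁻¹ * (x * (D.sigmaMaxSq / D.sigmaMinSq)) ≤ ((x ^ γ)⁻¹) ^ 18 := by
      rw [hg18, pow_add, mul_inv]
      have : x * κ ≤ x ^ 2 := by nlinarith
      calc (x ^ (18 * γ))⁻¹ * (x ^ 2)⁻¹ * (x * κ) ≤ (x ^ (18 * γ))⁻¹ * (x ^ 2)⁻¹ * x ^ 2 := by gcongr
        _ = _ := by field_simp
    exact h.mono hle
  have hreg := regime_matFlow hr hrd hK hwc (e := e) (γ := γ) (by omega) hpert hinit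
  have hgk : (x ^ γ)⁻¹ ≤ (x ^ k)⁻¹ := inv_anti₀ (by positivity) (pow_le_pow_right₀ hx1 (by omega))
  have hxk : 0 < x ^ k := by positivity
  have hR : x ≤ x ^ (k + 1) := by
    rw [pow_succ']; exact le_mul_of_one_le_right hd.le (one_le_pow₀ hx1)
  refine stageOneConclusion_of_regime (R := x ^ (k + 1)) (D.scale_pos hr) hreg (hx1.trans hR) ?_
    (by linarith) ?_ ?_ (Real.sqrt_nonneg _) ?_ (le_trans ?_ hm)
    ((inv_nonneg.2 hxk.le).trans hNS) (le_trans ?_ (pow_le_pow_left₀ (by positivity) hNS 2))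
    (hgk.trans hAB) (hgk.trans hξκ) (hgk.trans hperp) (hgk.trans hξperp)
  · exact mul_inv_le_one_of_le₀ (pow_le_pow_right₀ hx1 (by omega)) (by positivity)
  · refine le_trans ?_ hR
    rw [← hexpL, Real.exp_le_exp]
    nlinarith
  · rw [Real.log_pow]
    push_cast
    calc 2 * ((k + 1) * Real.log x) * (x ^ 2) ^ 2 ≤ 2 * ((k + 1) * x) * (x ^ 2) ^ 2 := by
          gcongr; change L ≤ x; linarith
      _ = 2 * ((k + 1) * x ^ 5) := by ring
      _ ≤ 2 * (K / (1 + K) * x ^ e) := by gcongr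
      _ = _ := by ring
  · -- the factor `κ exp (112 κ M)` is at most a small power of the dimension
    rw [Real.sq_sqrt hd.le]
    have h1 : 10 * κ ≤ Real.exp (L / 2) := by linarith [Real.add_one_le_exp (L / 2)]
    have h2 : Real.exp (112 * κ * M) ≤ Real.exp (L / 2) := Real.exp_le_exp.2 (by nlinarith)
    calc 10 * κ * Real.exp (112 * κ * M) ≤ Real.exp (L / 2) * Real.exp (L / 2) := by gcongr
      _ = x := by rw [← Real.exp_add, add_halves, hexpL]
  · rw [pow_succ, div_le_iff₀ (by positivity), inv_mul_cancel_left₀ hxk.ne']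
    linarith
  · rw [pow_succ x k, mul_pow, div_le_iff₀ (by positivity), inv_pow,
      inv_mul_cancel_left₀ (by positivity)]
    exact (by linarith : (8 : ℝ) ≤ x).trans (le_self_pow₀ hx1 two_ne_zero)

end Parameters

end Contrastive

end

theorem mainTheorem2 :
    -- the small constant in the assumption on the data and the constant in `O(√d)`
    ∃ c : ℝ, 0 < c ∧ ∃ C : ℝ, 0 < C ∧
    ∀ K : ℝ, 0 < K →
    -- all given accuracies, and the failure probability, are at least `d^(-k)`
    ∀ k : ℕ,
    -- exponents of the polynomials bounding `m`, `1/τ²` and `T₁`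
    ∃ a b e : ℕ,
    -- the bounds are uniform over all dimensions, widths, data models, temperatures and accuracies
    ∀ d r m : ℕ, 1 ≤ r → r ≤ d → d ^ a ≤ m →
    ∀ D : Contrastive.DataModel d r, D.WellConditioned c →
    ∀ τ : ℝ, 0 < τ → τ ≤ 1 → τ ^ 2 ≤ ((d : ℝ) ^ b)⁻¹ →
    ∀ δm δNS δAB δξκ δperp δξperp δfail : ℝ,
      ((d : ℝ) ^ k)⁻¹ ≤ δm → ((d : ℝ) ^ k)⁻¹ ≤ δNS → ((d : ℝ) ^ k)⁻¹ ≤ δAB →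
      ((d : ℝ) ^ k)⁻¹ ≤ δξκ → ((d : ℝ) ^ k)⁻¹ ≤ δperp → ((d : ℝ) ^ k)⁻¹ ≤ δξperp →
      ((d : ℝ) ^ k)⁻¹ ≤ δfail →
      Contrastive.initLaw d m {w | ¬ ∀ WA WB : ℝ → Matrix (Fin d) (Fin m) ℝ,
        WA 0 = Matrix.of w.1 → WB 0 = Matrix.of w.2 → Contrastive.IsGradientFlow D K τ WA WB →
          Contrastive.StageOneConclusion D WA WB ((d : ℝ) ^ e) (C * √(d : ℝ))
            δm δNS δAB δξκ δperp δξperp} ≤ ENNReal.ofReal δfail := by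
  obtain ⟨C₀, hC₀, hlaw⟩ := Contrastive.exists_initLaw_gram_le
  refine ⟨1 / 1000, by norm_num, 1, one_pos, fun K hK k => ?_⟩
  have hη : 0 < K / (1 + K) := by positivity
  -- the constants that depend on `K` and `k` or are absolute are absorbed into powers of `d`
  obtain ⟨e₀, he₀⟩ := pow_unbounded_of_one_lt ((k + 1) / (K / (1 + K))) (one_lt_two (α := ℝ))
  obtain ⟨a₀, ha₀⟩ := pow_unbounded_of_one_lt C₀ (one_lt_two (α := ℝ))
  -- the errors are powers of `g = d ^ (-γ)`, which beats the time horizon `d ^ (e₀ + 5)`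
  obtain ⟨γ, hγ⟩ : ∃ γ, γ = e₀ + 5 + k + 2 := ⟨_, rfl⟩
  -- initialization and gradient are needed up to errors of order `g ^ 18`, with extra powers of `d`
  -- for the sums over coordinates; Chebyshev's inequality for each of the `(2 d) ^ 2` entries of the
  -- Gram matrix then needs `m` of order `d ^ k * d ^ 2 * (d ^ 4 / g ^ 36)`
  refine ⟨a₀ + 36 * γ + k + 7, 18 * γ + 3, e₀ + 5, ?_⟩
  intro d r m hr hrd hm D hwc τ hτ _ hτd δm δNS δAB δξκ δperp δξperp δfail h1 h2 h3 h4 h5 h6 h7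
  have hd : (0 : ℝ) < d := by exact_mod_cast (by omega : 0 < d)
  have hx : (1001 : ℝ) ≤ d := by
    linarith [hwc.le_dim hr, Real.log_le_sub_one_of_pos hd]
  have hm' : (d : ℝ) ^ (a₀ + 36 * γ + k + 7) ≤ m := by exact_mod_cast hm
  have hmpos : (0 : ℝ) < m := lt_of_lt_of_le (by positivity) hm'
  have hε : (0 : ℝ) < ((d : ℝ) ^ (18 * γ + 2))⁻¹ := by positivity
  refine (MeasureTheory.measure_mono fun w hw => ?_).trans
    ((hlaw d m _ (by exact_mod_cast hmpos) hε).trans (ENNReal.ofReal_le_ofReal (le_trans ?_ h7)))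
  · intro hgram
    refine hw fun WA WB hA hB hflow => ?_
    rw [one_mul]
    refine Contrastive.stageOneConclusion_of_gram hr hrd hK hτ hwc hγ ?_ hτd hgram hA hB hflow
      h1 h2 h3 h4 h5 h6
    have h8 : ((k : ℝ) + 1) / (K / (1 + K)) ≤ (d : ℝ) ^ e₀ :=
      he₀.le.trans (pow_le_pow_left₀ (by norm_num) (by linarith) _)
    rw [div_le_iff₀ hη] at h8
    rw [pow_add]
    calc ((k : ℝ) + 1) * (d : ℝ) ^ 5 ≤ (d : ℝ) ^ e₀ * (K / (1 + K)) * (d : ℝ) ^ 5 := by gcongr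
      _ = _ := by ring
  · have h8 : C₀ ≤ (d : ℝ) ^ a₀ := ha₀.le.trans (pow_le_pow_left₀ (by norm_num) (by linarith) _)
    rw [inv_pow, ← pow_mul, mul_div_assoc', div_le_iff₀ (by positivity)]
    calc (2 * (d : ℝ)) ^ 2 * C₀ = 4 * C₀ * (d : ℝ) ^ 2 := by ring
      _ ≤ d * (d : ℝ) ^ a₀ * (d : ℝ) ^ 2 := by gcongr; linarith
      _ = ((d : ℝ) ^ k)⁻¹ *
          ((d : ℝ) ^ (a₀ + 36 * γ + k + 7) * ((d : ℝ) ^ ((18 * γ + 2) * 2))⁻¹) := by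
        rw [show a₀ + 36 * γ + k + 7 = k + (18 * γ + 2) * 2 + (1 + a₀ + 2) by ring, pow_add,
          pow_add (d : ℝ) k]
        field_simp
        ring
      _ ≤ _ := by gcongr
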